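/- Setting. Let $\mathcal S,\mathcal A$ be finite nonempty sets, $\mathcal P(\cdot|s,a)$ a transition kernel on $\mathcal S$, $c:\mathcal S\times\mathcal A\to\mathbb R$ a cost with $|c|\le\bar c$, and $\gamma\in(0,1)$. For each $s$ let $p\mapsto h^p(s)$ be an extended-valued closed convex function on the probability simplex $\Delta_{|\mathcal A|}$ with $|h^p(s)|\le\bar h$ on its domain; a policy $\pi$ is feasible if $h^{\pi}(s):=h^{\pi(\cdot|s)}(s)<\infty$ for all $s$. Let $D_{p}^{q}(s)=\sum_a q(a|s)\log\frac{q(a|s)}{p(a|s)}$, and let $\mu>0$ be such that $h^{q}(s)-h^{p}(s)-\langle (h')^{p}(s,\cdot),q(\cdot|s)-p(\cdot|s)\rangle\ge\mu D_{p}^{q}(s)$ for all $q$ and all strictly positive $p$ in the domain and all subgradients $(h')^p(s,\cdot)$ of $h(s)$ at $p$. Let $V^\pi(s)$, $Q^\pi(s,a)$ be the expected discounted sums $\mathbb E[\sum_{t\ge 0}\gamma^t(c(s_t,a_t)+h^\pi(s_t))]$ given $s_0=s$, resp. $(s_0,a_0)=(s,a)$, under $\pi$. Let $\pi^*$ be a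 feasible policy minimizing $V^\pi(s)$ over feasible $\pi$ for all $s$ simultaneously, $\nu^*$ a stationary distribution of the state chain under $\pi^*$, $f(\pi)=\mathbb E_{s\sim\nu^*}[V^\pi(s)]$, $\mathcal D(\pi,\pi^*)=\mathbb E_{s\sim\nu^*}[D_\pi^{\pi^*}(s)]$. Let $\Pi$ be a set of feasible policies such that, for some $\underline\pi>0$, $\pi(a|s)\ge\underline\pi$ for all $\pi\in\Pi$ and all $(s,a)$, and such that the state chain of each $\pi\in\Pi$ is ergodic (its transition matrix has a power with positive entries only), with stationary distribution $\nu(\pi)$. Put $M^\pi=\mathrm{Diag}(\nu(\pi))\otimes\mathrm{Diag}(\pi)$, $T^\pi\theta(s,a)=c(s,a)+h^\pi(s)+\gamma\sum_{s'}\mathcal P(s'|s,a)\sum_{a'}\pi(a'|s')\theta(s',a')$, $F^\pi(\theta)=M^\pi(\theta-T^\pi\theta)$ and, for a transition $\zeta=(s,a,s',a')$, $\tilde F^\pi(\theta,\zeta)=(\theta(s,a)-c(s,a)-h^\pi(s)-\gamma\theta(s',a'))\,e(s,a)$, where $e(s,a)$ is the unit vector. Call $(\Lambda_{\min},\Lambda_{\max},C,\rho,B)$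 valid for $\Pi$ if $C>0$, $\rho\in(0,1)$ and, for all $\pi\in\Pi$: $0<\Lambda_{\min}\le(1-\gamma)\lambda_{\min}(M^\pi)$, $(1-\gamma)\lambda_{\max}(M^\pi)\le\Lambda_{\max}$, $\|Q^\pi\|_2\le B$, and $$\|F^\pi(\theta)-\mathbb E[\tilde F^\pi(\theta,\zeta^\alpha)\mid z_0]\|_2\le C\rho^\alpha\|\theta-Q^\pi\|_2$$ for all $\theta$, all integers $\alpha\ge1$ and all pairs $z_0\in\mathcal S\times\mathcal A$, where $\zeta^1,\dots,\zeta^\alpha$ are the first $\alpha$ transitions of the chain of state-action pairs started at $z_0$ under $\pi$. Given valid constants let $n=|\mathcal S||\mathcal A|$, $l=\lceil\log_\gamma\frac14\rceil$, $\bar\theta=\sqrt n\,\frac{\bar c+\bar h}{1-\gamma}$, $t_0=8\max\{\Lambda_{\max}^2,8(1+\gamma)^2\}/\Lambda_{\min}^2$, $R^2=8B^2+\frac{3[B^2+2(\bar c+\bar h)^2]}{4(1+\gamma)^2}$, $\sigma_F^2=4(1+\gamma)^2R^2+B^2+2(\bar c+\bar h)^2$, and let $$T_k=t_0(3\bar\theta2^{\lfloor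 k/l\rfloor+2})^{2/3}+(4t_0^2\bar\theta^22^{\lfloor k/l\rfloor+2})^{1/2}+24\sigma_F^2\Lambda_{\min}^{-2}2^{\lfloor k/l\rfloor+2},$$ $$\alpha_k=\max\Big\{2(\lfloor\tfrac kl\rfloor+2)\log_\rho\tfrac12+\log_\rho\tfrac{\Lambda_{\min}}{24CR^2},\ (\lfloor\tfrac kl\rfloor+2)\log_\rho\tfrac12+\log_\rho\tfrac{\Lambda_{\min}}{3CR^2},\ \log_\rho\tfrac{\Lambda_{\min}}{9C}\Big\},$$ where $T_k$ is rounded up to an integer and $\alpha_k$ is rounded up to an integer $\ge1$. Algorithm. Along one trajectory of state-action pairs (with arbitrary initial law), starting from the uniform policy $\pi_0$, iteration $k$ of SPMD runs $T_k$ steps of conditional temporal difference under the policy $\pi_k$: start at $\theta_1=0$; at step $t$ observe the next $\alpha_k$ transitions $\zeta_t^1,\dots,\zeta_t^{\alpha_k}$ of the trajectory and set $\theta_{t+1}=\theta_t-\beta_t\tilde F^{\pi_k}(\theta_t,\zeta_t^{\alpha_k})$ with $\beta_t=\frac{2}{\Lambda_{\min}(t+t_0-1)}$. With $\mathcal Q_k=\theta_{T_k+1}$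 and $\eta=\frac{1-\gamma}{\gamma\mu}$ it then sets $\pi_{k+1}(\cdot|s)=\operatorname{argmin}_{p}\{\eta[\langle\mathcal Q_k(s,\cdot),p\rangle+h^p(s)]+D_{\pi_k}^p(s)\}$ for all $s$, over the domain of $h(s)$. Assume that almost surely all iterates $\pi_k$ belong to $\Pi$. Claim. Valid constants for $\Pi$ exist, and for every choice of them the following holds. Let $$\Delta:=f(\pi_0)-f(\pi^*)+\tfrac1{1-\gamma}\big(\mu\log|\mathcal A|+\tfrac52+\tfrac5{8\gamma\mu}\big).$$ (1) For all $k\ge0$, $\ \mathbb E\big[f(\pi_k)-f(\pi^*)+\frac{\mu}{1-\gamma}\mathcal D(\pi_k,\pi^*)\big]\le2^{-\lfloor k/l\rfloor}\Delta$, the quantity on the left being integrable. (2) There are iteration numbers $\bar k(\varepsilon)$, $\varepsilon>0$, common to all such trajectories, with $\mathbb E[f(\pi_{\bar k(\varepsilon)})-f(\pi^*)+\frac\mu{1-\gamma}\mathcal D(\pi_{\bar k(\varepsilon)},\pi^*)]\le\varepsilon$, such that for all sufficiently small $\varepsilon>0$ $$\bar k(\varepsilon)\le K\log_\gamma\varepsilon,$$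 and the total number $N(\varepsilon)=\sum_{k<\bar k(\varepsilon)}T_k\alpha_k$ of samples satisfies $$N(\varepsilon)\le K\,(\log_\gamma\tfrac12)\Big(\log_2\tfrac1\varepsilon\,\log_\rho\tfrac12+\log_\rho\tfrac{\Lambda_{\min}}{CR^2}\Big)\Big(\tfrac{t_0\bar\theta^{2/3}}{(\mu(1-\gamma)\varepsilon)^{2/3}}+\tfrac{t_0\bar\theta}{\sqrt{\mu(1-\gamma)\varepsilon}}+\tfrac{\sigma_F^2}{\mu(1-\gamma)\Lambda_{\min}^2\varepsilon}\Big),$$ and, if $CR^2\ge2\Lambda_{\min}$, also $$N(\varepsilon)\le K\,(\log_\gamma\tfrac12)(\log_2\tfrac1\varepsilon)\Big(\log_\rho\tfrac{\Lambda_{\min}}{CR^2}\Big)\Big(\tfrac{t_0\bar\theta^{2/3}}{(\mu(1-\gamma)\varepsilon)^{2/3}}+\tfrac{t_0\bar\theta}{\sqrt{\mu(1-\gamma)\varepsilon}}+\tfrac{\sigma_F^2}{\mu(1-\gamma)\Lambda_{\min}^2\varepsilon}\Big).$$ Here the constant $K>0$ depends only on an upper bound $\kappa$ of the number $\mu(1-\gamma)\Delta$;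 in particular not on $\varepsilon$, nor otherwise on the problem, the trajectory or the valid constants. -/

import Mathlib

open MeasureTheory ProbabilityTheory

universe u v w

/-- A finite discounted Markov decision process with a convex policy regularizer.
`P s a s'` is the transition probability to `s'` from `s` under the action `a`, and `c` is the cost.
The extended-valued regularizer `h^π(s)`, a function of `π(·|s)`, is given by its effective domain
`dom s`, a subset of the probability simplex, and by its (finite) values `h s` on that domain. -/
structure RegMDP (S A : Type*) [Fintype S] [Fintype A] where
  P : S → A → S → ℝ
  c : S → A → ℝ
  γ : ℝ
  dom : S → Set (A → ℝ)
  h : S → (A → ℝ) → ℝ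
  P_nonneg : ∀ s a s', 0 ≤ P s a s'
  P_sum : ∀ s a, ∑ s', P s a s' = 1
  γ_pos : 0 < γ
  γ_lt_one : γ < 1
  dom_subset : ∀ s, dom s ⊆ stdSimplex ℝ A
  h_convex : ∀ s, ConvexOn ℝ (dom s) (h s)
  h_closed : ∀ s, IsClosed {z : (A → ℝ) × ℝ | z.1 ∈ dom s ∧ h s z.1 ≤ z.2}

/-- A policy, `π s a` being the probability of the action `a` at the state `s`. -/
abbrev Policy (S A : Type*) := S → A → ℝ

/-- The Kullback-Leibler divergence `KL(p ‖ q)`, used for strictly positive `q`. -/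
noncomputable def klDist {A : Type*} [Fintype A] (p q : A → ℝ) : ℝ :=
  ∑ a, p a * Real.log (p a / q a)

/-- The Euclidean norm. -/
noncomputable def norm2 {ι : Type*} [Fintype ι] (x : ι → ℝ) : ℝ :=
  Real.sqrt (∑ i, x i ^ 2)

/-- The uniform policy. -/
noncomputable def uniformPolicy (S A : Type*) [Fintype A] : Policy S A :=
  fun _ _ => 1 / (Fintype.card A : ℝ)

/-- The smallest eigenvalue of a real matrix with real spectrum. -/
noncomputable def minEig {ι : Type*} [Fintype ι] [DecidableEq ι] (M : Matrix ι ι ℝ) : ℝ :=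
  sInf (spectrum ℝ M)

/-- The largest eigenvalue of a real matrix with real spectrum. -/
noncomputable def maxEig {ι : Type*} [Fintype ι] [DecidableEq ι] (M : Matrix ι ι ℝ) : ℝ :=
  sSup (spectrum ℝ M)

namespace RegMDP

variable {S A : Type*} [Fintype S] [Fintype A] [DecidableEq S] [DecidableEq A]

/-- Feasible policies: those with `h^π(s) < ∞` (in particular `π(·|s)` in the simplex). -/
def Feasible (M : RegMDP S A) (π : Policy S A) : Prop := ∀ s, π s ∈ M.dom s

/-- `g` is a subgradient at `p` of the extended-valued convex function `h(s)`. -/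
def IsSubgradient (M : RegMDP S A) (s : S) (p g : A → ℝ) : Prop :=
  ∀ q ∈ M.dom s, M.h s p + ∑ a, g a * (q a - p a) ≤ M.h s q

/-- The regularizer has strong convexity modulus `μ` relative to the Kullback-Leibler divergence:
`h^q(s) - [h^p(s) + ⟨h'^p(s, ·), q - p⟩] ≥ μ KL(q ‖ p)` for all subgradients `h'^p(s, ·)`. -/
def StronglyConvex (M : RegMDP S A) (μ : ℝ) : Prop :=
  ∀ s, ∀ p ∈ M.dom s, (∀ a, 0 < p a) → ∀ g, M.IsSubgradient s p g → ∀ q ∈ M.dom s,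
    μ * klDist q p ≤ M.h s q - (M.h s p + ∑ a, g a * (q a - p a))

/-- The transition matrix `P^π` of the states under the policy `π`. -/
def stateMat (M : RegMDP S A) (π : Policy S A) : Matrix S S ℝ :=
  Matrix.of fun s s' => ∑ a, π s a * M.P s a s'

/-- The transition matrix of the state-action pairs under the policy `π`. -/
def pairMat (M : RegMDP S A) (π : Policy S A) : Matrix (S × A) (S × A) ℝ :=
  Matrix.of fun z z' => M.P z.1 z.2 z'.1 * π z'.1 z'.2

/-- The running cost `c(s, a) + h^π(s)` at the pair `z = (s, a)`. -/
def runCost (M : RegMDP S A) (π : Policy S A) (z : S × A) : ℝ :=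
  M.c z.1 z.2 + M.h z.1 (π z.1)

/-- The state-value function: the expected discounted cost from `s₀ = s` under `π`, the law of
`s_t` being the row `s` of the `t`-th power of `P^π`. -/
noncomputable def V (M : RegMDP S A) (π : Policy S A) (s : S) : ℝ :=
  ∑' t : ℕ, M.γ ^ t * ∑ s', (M.stateMat π ^ t) s s' * ∑ a, π s' a * M.runCost π (s', a)

/-- The action-value function: the expected discounted cost from `(s₀, a₀) = z` under `π`. -/
noncomputable def Q (M : RegMDP S A) (π : Policy S A) (z : S × A) : ℝ :=
  ∑' t : ℕ, M.γ ^ t * ∑ z', (M.pairMat π ^ t) z z' * M.runCost π z'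

/-- An optimal policy: feasible, and of minimal value at every state simultaneously. -/
def IsOptimal (M : RegMDP S A) (πs : Policy S A) : Prop :=
  M.Feasible πs ∧ ∀ π, M.Feasible π → ∀ s, M.V πs s ≤ M.V π s

/-- `ν` is a stationary distribution of the state chain under `π`. -/
def IsStationary (M : RegMDP S A) (π : Policy S A) (ν : S → ℝ) : Prop :=
  ν ∈ stdSimplex ℝ S ∧ Matrix.vecMul ν (M.stateMat π) = ν

open Classical in
/-- The stationary distribution of the state chain under `π`; it is only used for policies whose
chain is ergodic, hence has exactly one stationary distribution. -/
noncomputable def statDist (M : RegMDP S A) (π : Policy S A) : S → ℝ :=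
  if hν : ∃ ν, M.IsStationary π ν then hν.choose else 0

/-- The objective `f(π) = E_{s ∼ ν} [V^π(s)]`. -/
noncomputable def f (M : RegMDP S A) (ν : S → ℝ) (π : Policy S A) : ℝ := ∑ s, ν s * M.V π s

/-- The distance `E_{s ∼ ν} [KL(π*(·|s) ‖ π(·|s))]`. -/
noncomputable def dist (_M : RegMDP S A) (ν : S → ℝ) (π πs : Policy S A) : ℝ :=
  ∑ s, ν s * klDist (πs s) (π s)

/-- The optimality gap `f(π) - f(π*) + μ / (1 - γ) * D(π, π*)`. -/
noncomputable def gap (M : RegMDP S A) (μ : ℝ) (ν : S → ℝ) (πs π : Policy S A) : ℝ :=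
  M.f ν π - M.f ν πs + μ / (1 - M.γ) * M.dist ν π πs

/-- The constant
`f(π₀) - f(π*) + (μ log |A| + 5 / 2 + 5 / (8 γ μ)) / (1 - γ)` with `π₀` uniform. -/
noncomputable def gapConst (M : RegMDP S A) (μ : ℝ) (ν : S → ℝ) (πs : Policy S A) : ℝ :=
  M.f ν (uniformPolicy S A) - M.f ν πs +
    1 / (1 - M.γ) * (μ * Real.log (Fintype.card A) + 5 / 2 + 5 / (8 * M.γ * μ))

/-- The weighting matrix `M^π = Diag(ν(π)) ⊗ Diag(π)`. -/
noncomputable def weight (M : RegMDP S A) (π : Policy S A) : Matrix (S × A) (S × A) ℝ :=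
  Matrix.diagonal fun z => M.statDist π z.1 * π z.1 z.2

/-- The Bellman operator `T^π`. -/
def bellman (M : RegMDP S A) (π : Policy S A) (θ : S × A → ℝ) : S × A → ℝ :=
  fun z => M.runCost π z + M.γ * ∑ s', M.P z.1 z.2 s' * ∑ a', π s' a' * θ (s', a')

/-- The operator `F^π(θ) = M^π (θ - T^π θ)`. -/
noncomputable def opF (M : RegMDP S A) (π : Policy S A) (θ : S × A → ℝ) : S × A → ℝ :=
  Matrix.mulVec (M.weight π) (θ - M.bellman π θ)

/-- The stochastic operator `F̃^π(θ, ζ)` at the transition `ζ = (z, z')`. -/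
def opFtilde (M : RegMDP S A) (π : Policy S A) (θ : S × A → ℝ) (z z' : S × A) : S × A → ℝ :=
  Pi.single z (θ z - M.runCost π z - M.γ * θ z')

/-- The expectation of `F̃^π(θ, ζ^α)` given that the first of the `α ≥ 1` transitions
`ζ¹, …, ζ^α` of the policy `π` starts at the state-action pair `z₀`. -/
noncomputable def meanOpFtilde (M : RegMDP S A) (π : Policy S A) (θ : S × A → ℝ) (α : ℕ)
    (z₀ : S × A) : S × A → ℝ :=
  ∑ z, (M.pairMat π ^ (α - 1)) z₀ z • ∑ z', M.pairMat π z z' • M.opFtilde π θ z z'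

end RegMDP

/-- The constants which govern the conditional temporal difference method:
bounds `lamMin`, `lamMax` for the spectrum of the weighting matrices, the mixing constants
`C`, `ρ`, and a bound `B` for the Euclidean norm of the action-value functions. -/
structure CTDConst where
  lamMin : ℝ
  lamMax : ℝ
  C : ℝ
  ρ : ℝ
  B : ℝ

namespace RegMDP

variable {S A : Type*} [Fintype S] [Fintype A] [DecidableEq S] [DecidableEq A]

/-- The constants are valid, uniformly for all policies of the class `Pol`. -/
structure ValidConst (M : RegMDP S A) (Pol : Set (Policy S A)) (k : CTDConst) : Prop where
  lamMin_pos : 0 < k.lamMin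
  lamMin_le : ∀ π ∈ Pol, k.lamMin ≤ (1 - M.γ) * minEig (M.weight π)
  le_lamMax : ∀ π ∈ Pol, (1 - M.γ) * maxEig (M.weight π) ≤ k.lamMax
  C_pos : 0 < k.C
  ρ_pos : 0 < k.ρ
  ρ_lt_one : k.ρ < 1
  mixing : ∀ π ∈ Pol, ∀ (θ : S × A → ℝ) (z₀ : S × A) (α : ℕ), 1 ≤ α →
    norm2 (M.opF π θ - M.meanOpFtilde π θ α z₀) ≤ k.C * k.ρ ^ α * norm2 (θ - M.Q π)
  norm_le : ∀ π ∈ Pol, norm2 (M.Q π) ≤ k.B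

section parameters

variable (M : RegMDP S A) (cbar hbar : ℝ) (k : CTDConst)

/-- The epoch length `l = ⌈log_γ (1 / 4)⌉`. -/
noncomputable def epochLen : ℕ := ⌈Real.logb M.γ (1 / 4)⌉₊

/-- `θ̄ = √n (c̄ + h̄) / (1 - γ)` with `n = |S| |A|`. -/
noncomputable def thetaBar : ℝ :=
  Real.sqrt ((Fintype.card S : ℝ) * Fintype.card A) * ((cbar + hbar) / (1 - M.γ))

/-- `t₀ = 8 max {Λ_max², 8 (1 + γ)²} / Λ_min²`. -/
noncomputable def tZero : ℝ :=
  8 * max (k.lamMax ^ 2) (8 * (1 + M.γ) ^ 2) / k.lamMin ^ 2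

/-- `R²`, for the initial point `θ₁ = 0` and with `‖θ*‖₂` bounded by `B`. -/
noncomputable def Rsq : ℝ :=
  8 * k.B ^ 2 + 3 * (k.B ^ 2 + 2 * (cbar + hbar) ^ 2) / (4 * (1 + M.γ) ^ 2)

/-- `σ_F²`, with `‖θ*‖₂` bounded by `B`. -/
noncomputable def sigmaFsq : ℝ :=
  4 * (1 + M.γ) ^ 2 * M.Rsq cbar hbar k + k.B ^ 2 + 2 * (cbar + hbar) ^ 2

/-- The number `T_j` of temporal difference steps in the iteration `j`, rounded up. -/
noncomputable def numSteps (j : ℕ) : ℕ :=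
  ⌈M.tZero k * (3 * M.thetaBar cbar hbar * 2 ^ (j / M.epochLen + 2)) ^ (2 / 3 : ℝ)
    + Real.sqrt (4 * M.tZero k ^ 2 * M.thetaBar cbar hbar ^ 2 * 2 ^ (j / M.epochLen + 2))
    + 24 * M.sigmaFsq cbar hbar k / k.lamMin ^ 2 * 2 ^ (j / M.epochLen + 2)⌉₊

/-- The skipping parameter `α_j`, rounded up to a positive integer. The third term of the maximum
is the requirement `C ρ^α ≤ Λ_min / 9` on every skipping parameter of the method. -/
noncomputable def skip (j : ℕ) : ℕ :=
  max 1 ⌈max (max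
    (2 * ((j / M.epochLen : ℕ) + 2 : ℝ) * Real.logb k.ρ (1 / 2)
      + Real.logb k.ρ (k.lamMin / (24 * k.C * M.Rsq cbar hbar k)))
    (((j / M.epochLen : ℕ) + 2 : ℝ) * Real.logb k.ρ (1 / 2)
      + Real.logb k.ρ (k.lamMin / (3 * k.C * M.Rsq cbar hbar k))))
    (Real.logb k.ρ (k.lamMin / (9 * k.C)))⌉₊

/-- The step size `β_t = 2 / (Λ_min (t + t₀ - 1))`. -/
noncomputable def stepSize (t : ℕ) : ℝ := 2 / (k.lamMin * (t + M.tZero k - 1))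

/-- The number of samples used in the first `j` iterations. -/
noncomputable def numSamples (j : ℕ) : ℕ :=
  ∑ i ∈ Finset.range j, M.numSteps cbar hbar k i * M.skip cbar hbar k i

end parameters

/-- Conditional temporal difference for evaluating `π` along the trajectory `Z`, starting at time
`n₀`, with `α` transitions per step and step sizes `β`: `ctd … t` is the iterate `θ_{t+1}`, where
`θ₁ = 0` and the step `t` uses the last transition of the `t`-th block of `α` transitions. -/
noncomputable def ctd (M : RegMDP S A) (π : Policy S A) (α : ℕ) (β : ℕ → ℝ) (Z : ℕ → S × A)
    (n₀ : ℕ) : ℕ → S × A → ℝ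
  | 0 => 0
  | t + 1 => M.ctd π α β Z n₀ t - β (t + 1) • M.opFtilde π (M.ctd π α β Z n₀ t)
      (Z (n₀ + (t + 1) * α - 1)) (Z (n₀ + (t + 1) * α))

/-- `π₊` is the result of the prox-mapping at `π` with step size `η` and estimate `G`. -/
def IsProx (M : RegMDP S A) (η : ℝ) (G : S × A → ℝ) (π πp : Policy S A) : Prop :=
  ∀ s, πp s ∈ M.dom s ∧
    IsMinOn (fun p => η * (∑ a, G (s, a) * p a + M.h s p) + klDist p (π s)) (M.dom s) (πp s)

/-- The σ-algebra generated by the trajectory `Z` up to time `n`. -/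
abbrev history {Ω : Type*} (Z : ℕ → Ω → S × A) (n : ℕ) : MeasurableSpace Ω :=
  ⨆ i ∈ Finset.range (n + 1), MeasurableSpace.comap (Z i) ⊤

/-- A run of stochastic policy mirror descent with step size `η = (1 - γ) / (γ μ)` and conditional
temporal difference evaluation along one trajectory `Z` of state-action pairs (with arbitrary
initial law). The iteration `j` uses the transitions number
`numSamples j, …, numSamples (j + 1) - 1` of the trajectory, which follow the policy `π j`. -/
structure IsRun (M : RegMDP S A) (μ cbar hbar : ℝ) (k : CTDConst) {Ω : Type*}
    [MeasurableSpace Ω] (Pr : Measure Ω) (Z : ℕ → Ω → S × A) (π : ℕ → Ω → Policy S A) :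
    Prop where
  meas : ∀ n, @Measurable Ω (S × A) _ ⊤ (Z n)
  init : ∀ ω, π 0 ω = uniformPolicy S A
  step : ∀ᵐ ω ∂Pr, ∀ j, M.IsProx ((1 - M.γ) / (M.γ * μ))
    (M.ctd (π j ω) (M.skip cbar hbar k j) (M.stepSize k) (fun n => Z n ω)
      (M.numSamples cbar hbar k j) (M.numSteps cbar hbar k j)) (π j ω) (π (j + 1) ω)
  markov : ∀ j n, M.numSamples cbar hbar k j ≤ n → n < M.numSamples cbar hbar k (j + 1) →
    ∀ z' : S × A, Pr⟦Z (n + 1) ⁻¹' {z'} | history Z n⟧ =ᵐ[Pr]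
      fun ω => M.P (Z n ω).1 (Z n ω).2 z'.1 * π j ω z'.1 z'.2

/-- `t₀ θ̄^{2/3} / (μ (1-γ) ε)^{2/3} + t₀ θ̄ / √(μ (1-γ) ε) + σ_F² / (μ (1-γ) Λ_min² ε)`. -/
noncomputable def sampleRate (M : RegMDP S A) (μ cbar hbar : ℝ) (k : CTDConst) (ε : ℝ) : ℝ :=
  M.tZero k * M.thetaBar cbar hbar ^ (2 / 3 : ℝ) / (μ * (1 - M.γ) * ε) ^ (2 / 3 : ℝ)
    + M.tZero k * M.thetaBar cbar hbar / Real.sqrt (μ * (1 - M.γ) * ε)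
    + M.sigmaFsq cbar hbar k / (μ * (1 - M.γ) * k.lamMin ^ 2 * ε)

end RegMDP

/-!
Let the gap of a policy be its excess value plus `μ / (1 - γ)` times its divergence from `π*`.
First-order optimality of a prox-mapping and strong convexity give a three-point inequality. With
the performance difference identity, averaged over the stationary distribution of `π*`, and the
step size `η = (1 - γ) / (γ μ)`, it shows that one iteration contracts the gap by the factor `γ`,
up to `(γ μ)⁻¹` times the squared error of the estimate of `Q^π` and up to the pairing of that error
with a direction which is known before the iteration starts.

Expectations of both terms are controlled through the linear part of `F^π`, which is monotone with
modulus `Λ_min`. The mean squared error `e_t` of conditional temporal difference satisfies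
`e_{t+1} ≤ (1 - 3 / (t + t₀)) e_t + O((t + t₀)⁻²)`, hence decays like `1 / T`. A norm bound would
give only `T^{-1/2}` for the pairing. Instead one moves the adjoint of the expected step onto the
direction: its norm is multiplied by `√(1 - 3 / (t + t₀))` in each step, the noise has mean zero up
to the mixing error `C ρ^α`, and what remains is the initial error times `O(T^{-3/2})`.

With the given `T_k` and `α_k` both terms are of order `2^{-⌊k/l⌋}`, and `γ^l ≤ 1/4`, so the gap
bound is halved every `l` iterations. The number of samples is a sum of geometric sums with ratios
`2^{2/3}`, `2^{1/2}` and `2`, each dominated by its last epoch, times a factor `α_k` that is affine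
in the epoch. Valid constants exist because the transition matrices of policies bounded below by a
positive number are comparable, which gives a Doeblin minorization common to the whole class.
-/

section EuclideanNorm

variable {ι : Type*} [Fintype ι]

lemma norm2_nonneg (x : ι → ℝ) : 0 ≤ norm2 x := Real.sqrt_nonneg _

lemma norm2_sq (x : ι → ℝ) : norm2 x ^ 2 = ∑ i, x i ^ 2 :=
  Real.sq_sqrt (Finset.sum_nonneg fun _ _ => sq_nonneg _)

lemma norm2_sub_smul_sq (x y : ι → ℝ) (β : ℝ) :
    norm2 (x - β • y) ^ 2 = norm2 x ^ 2 - 2 * β * ∑ i, x i * y i + β ^ 2 * norm2 y ^ 2 := by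
  simp only [norm2_sq, Finset.mul_sum, ← Finset.sum_sub_distrib, ← Finset.sum_add_distrib,
    Pi.sub_apply, Pi.smul_apply, smul_eq_mul]
  exact Finset.sum_congr rfl fun i _ => by ring

lemma norm2_single [DecidableEq ι] (i : ι) (b : ℝ) : norm2 (Pi.single i b) = |b| := by
  rw [norm2, Finset.sum_eq_single i (fun j _ hj => by simp [Pi.single_eq_of_ne hj]) (by simp),
    Pi.single_eq_same, Real.sqrt_sq_eq_abs]

lemma norm2_le_iff {x : ι → ℝ} {b : ℝ} (hb : 0 ≤ b) : norm2 x ≤ b ↔ ∑ i, x i ^ 2 ≤ b ^ 2 :=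
  Real.sqrt_le_left hb

lemma norm2_neg (x : ι → ℝ) : norm2 (-x) = norm2 x := by simp [norm2]

lemma sum_mul_le_norm2_mul_norm2 (x y : ι → ℝ) : ∑ i, x i * y i ≤ norm2 x * norm2 y :=
  Real.sum_mul_le_sqrt_mul_sqrt _ _ _

lemma abs_sum_mul_le_norm2_mul_norm2 (x y : ι → ℝ) :
    |∑ i, x i * y i| ≤ norm2 x * norm2 y := by
  refine abs_le'.2 ⟨sum_mul_le_norm2_mul_norm2 x y, ?_⟩
  simpa only [norm2_neg, Pi.neg_apply, neg_mul, Finset.sum_neg_distrib] using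
    sum_mul_le_norm2_mul_norm2 (-x) y

lemma abs_apply_le_norm2 (x : ι → ℝ) (i : ι) : |x i| ≤ norm2 x :=
  Real.abs_le_sqrt <| Finset.single_le_sum (f := fun i => x i ^ 2)
    (fun _ _ => sq_nonneg _) (Finset.mem_univ i)

lemma norm2_le_of_abs_le {x : ι → ℝ} {b : ℝ} (hb : 0 ≤ b) (h : ∀ i, |x i| ≤ b) :
    norm2 x ≤ √(Fintype.card ι) * b := by
  rw [norm2_le_iff (by positivity), mul_pow, Real.sq_sqrt (by positivity)]
  calc ∑ i, x i ^ 2 ≤ ∑ _i : ι, b ^ 2 :=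
        Finset.sum_le_sum fun i _ => sq_le_sq.2 ((h i).trans (le_abs_self b))
    _ = _ := by simp

end EuclideanNorm

section Simplex

variable {ι : Type*} [Fintype ι] {p : ι → ℝ}

lemma le_one_of_mem_stdSimplex (hp : p ∈ stdSimplex ℝ ι) (i : ι) : p i ≤ 1 :=
  (mem_Icc_of_mem_stdSimplex hp i).2

lemma sum_mul_const_of_mem_stdSimplex (hp : p ∈ stdSimplex ℝ ι) (b : ℝ) :
    ∑ i, p i * b = b := by
  rw [← Finset.sum_mul, hp.2, one_mul]

lemma sum_mul_le_of_mem_stdSimplex (hp : p ∈ stdSimplex ℝ ι) {r : ι → ℝ} {b : ℝ}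
    (hr : ∀ i, r i ≤ b) : ∑ i, p i * r i ≤ b :=
  calc ∑ i, p i * r i ≤ ∑ i, p i * b :=
        Finset.sum_le_sum fun i _ => mul_le_mul_of_nonneg_left (hr i) (hp.1 i)
    _ = b := sum_mul_const_of_mem_stdSimplex hp b

lemma abs_sum_mul_le_of_mem_stdSimplex (hp : p ∈ stdSimplex ℝ ι) {r : ι → ℝ} {b : ℝ}
    (hr : ∀ i, |r i| ≤ b) : |∑ i, p i * r i| ≤ b := by
  refine abs_le'.2 ⟨sum_mul_le_of_mem_stdSimplex hp fun i => (abs_le'.1 (hr i)).1, ?_⟩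
  simpa only [Pi.neg_apply, mul_neg, Finset.sum_neg_distrib] using
    sum_mul_le_of_mem_stdSimplex hp (r := -r) fun i => (abs_le'.1 (hr i)).2

lemma sq_sum_mul_le_of_mem_stdSimplex (hp : p ∈ stdSimplex ℝ ι) (r : ι → ℝ) :
    (∑ i, p i * r i) ^ 2 ≤ ∑ i, p i * r i ^ 2 :=
  Real.pow_arith_mean_le_arith_mean_pow_of_even _ _ _ (fun i _ => hp.1 i) hp.2 even_two

lemma sum_mul_sq_le_norm2_sq_of_mem_stdSimplex (hp : p ∈ stdSimplex ℝ ι) (r : ι → ℝ) :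
    ∑ i, p i * r i ^ 2 ≤ norm2 r ^ 2 := by
  rw [norm2_sq]
  exact Finset.sum_le_sum fun i _ =>
    mul_le_of_le_one_left (sq_nonneg _) (le_one_of_mem_stdSimplex hp i)

lemma sum_mul_sub_mean_sq_le_of_mem_stdSimplex (hp : p ∈ stdSimplex ℝ ι) (r : ι → ℝ) :
    ∑ i, p i * (∑ j, p j * r j - r i) ^ 2 ≤ ∑ i, p i * r i ^ 2 := by
  set m := ∑ j, p j * r j with hm
  have hexpand : ∑ i, p i * (m - r i) ^ 2 = ∑ i, p i * r i ^ 2 - m ^ 2 := by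
    calc ∑ i, p i * (m - r i) ^ 2
        = ∑ i, (p i * m ^ 2 - 2 * m * (p i * r i) + p i * r i ^ 2) :=
          Finset.sum_congr rfl fun i _ => by ring
      _ = ∑ i, p i * r i ^ 2 - m ^ 2 := by
          rw [Finset.sum_add_distrib, Finset.sum_sub_distrib, ← Finset.mul_sum, ← hm,
            sum_mul_const_of_mem_stdSimplex hp]
          ring
  linarith [sq_nonneg m]

end Simplex

lemma sum_mul_sum_mul_of_vecMul_eq_self {ι : Type*} [Fintype ι] {K : Matrix ι ι ℝ} {ν : ι → ℝ}
    (hν : Matrix.vecMul ν K = ν) (x : ι → ℝ) : ∑ i, ν i * ∑ j, K i j * x j = ∑ i, ν i * x i :=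
  (Matrix.dotProduct_mulVec ν K x).trans (congrArg (· ⬝ᵥ x) hν)

section DiscountedSum

variable {ι : Type*} [Fintype ι] [DecidableEq ι] {K : Matrix ι ι ℝ} {γ : ℝ}

lemma row_mem_stdSimplex (hK : K ∈ Matrix.rowStochastic ℝ ι) (i : ι) : K i ∈ stdSimplex ℝ ι :=
  ⟨hK.1 i, Matrix.sum_row_of_mem_rowStochastic hK i⟩

lemma le_div_of_le_add_discounted (hK : K ∈ Matrix.rowStochastic ℝ ι) (h0 : 0 ≤ γ) (h1 : γ < 1)
    {u : ι → ℝ} {b : ℝ} (hu : ∀ i, u i ≤ b + γ * ∑ j, K i j * u j) (i : ι) :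
    u i ≤ b / (1 - γ) := by
  have : Nonempty ι := ⟨i⟩
  obtain ⟨m, hm⟩ := Finite.exists_max u
  have hmean : γ * ∑ j, K m j * u j ≤ γ * u m :=
    mul_le_mul_of_nonneg_left (sum_mul_le_of_mem_stdSimplex (row_mem_stdSimplex hK m) hm) h0
  refine (hm i).trans ?_
  rw [le_div_iff₀ (by linarith)]
  linarith [hu m]

lemma abs_le_div_of_eq_add_discounted (hK : K ∈ Matrix.rowStochastic ℝ ι) (h0 : 0 ≤ γ)
    (h1 : γ < 1) {r u : ι → ℝ} {b : ℝ} (hr : ∀ i, |r i| ≤ b)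
    (hu : ∀ i, u i = r i + γ * ∑ j, K i j * u j) (i : ι) : |u i| ≤ b / (1 - γ) := by
  refine abs_le'.2 ⟨le_div_of_le_add_discounted hK h0 h1 (fun i => ?_) i,
    le_div_of_le_add_discounted hK h0 h1 (u := -u) (fun i => ?_) i⟩
  · linarith [hu i, (abs_le'.1 (hr i)).1]
  · simp only [Pi.neg_apply, mul_neg, Finset.sum_neg_distrib]
    linarith [hu i, (abs_le'.1 (hr i)).2]

lemma eq_of_eq_add_discounted (hK : K ∈ Matrix.rowStochastic ℝ ι) (h0 : 0 ≤ γ) (h1 : γ < 1)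
    {r u v : ι → ℝ} (hu : ∀ i, u i = r i + γ * ∑ j, K i j * u j)
    (hv : ∀ i, v i = r i + γ * ∑ j, K i j * v j) : u = v := by
  have hdiff : ∀ i, (u - v) i = 0 + γ * ∑ j, K i j * (u - v) j := fun i => by
    simp only [Pi.sub_apply, mul_sub, Finset.sum_sub_distrib]
    linarith [hu i, hv i]
  funext i
  have hle := abs_le_div_of_eq_add_discounted hK h0 h1 (r := 0) (b := 0) (by simp) hdiff i
  rwa [zero_div, abs_nonpos_iff, Pi.sub_apply, sub_eq_zero] at hle

/-- The expected discounted sum of `r` along the Markov chain with transition matrix `K`: the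
common form of the state-value and the action-value functions. -/
noncomputable def discSum (γ : ℝ) (K : Matrix ι ι ℝ) (r : ι → ℝ) (i : ι) : ℝ :=
  ∑' t : ℕ, γ ^ t * ∑ j, (K ^ t) i j * r j

lemma summable_discSum (hK : K ∈ Matrix.rowStochastic ℝ ι) (h0 : 0 ≤ γ) (h1 : γ < 1)
    (r : ι → ℝ) (i : ι) : Summable fun t : ℕ => γ ^ t * ∑ j, (K ^ t) i j * r j := by
  refine Summable.of_norm_bounded (g := fun t : ℕ => γ ^ t * norm2 r)
    ((summable_geometric_of_lt_one h0 h1).mul_right _) fun t => ?_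
  rw [Real.norm_eq_abs, abs_mul, abs_of_nonneg (pow_nonneg h0 t)]
  exact mul_le_mul_of_nonneg_left (abs_sum_mul_le_of_mem_stdSimplex
    (row_mem_stdSimplex (pow_mem hK t) i) (abs_apply_le_norm2 r)) (pow_nonneg h0 t)

lemma discSum_eq_add (hK : K ∈ Matrix.rowStochastic ℝ ι) (h0 : 0 ≤ γ) (h1 : γ < 1)
    (r : ι → ℝ) (i : ι) :
    discSum γ K r i = r i + γ * ∑ j, K i j * discSum γ K r j := by
  have hterm : ∀ t : ℕ, γ ^ (t + 1) * ∑ j, (K ^ (t + 1)) i j * r j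
      = ∑ l, γ * (K i l * (γ ^ t * ∑ j, (K ^ t) l j * r j)) := fun t => by
    rw [pow_succ' K, pow_succ' γ]
    simp only [Matrix.mul_apply, Finset.sum_mul, Finset.mul_sum]
    rw [Finset.sum_comm]
    exact Finset.sum_congr rfl fun _ _ => Finset.sum_congr rfl fun _ _ => by ring
  unfold discSum
  rw [(summable_discSum hK h0 h1 r i).tsum_eq_zero_add]
  congr 1
  · simp [Matrix.one_apply]
  · simp only [hterm]
    rw [Summable.tsum_finsetSum fun l _ => ((summable_discSum hK h0 h1 r l).mul_left _).mul_left _,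
      Finset.mul_sum]
    exact Finset.sum_congr rfl fun l _ => by rw [tsum_mul_left, tsum_mul_left]

lemma abs_discSum_le (hK : K ∈ Matrix.rowStochastic ℝ ι) (h0 : 0 ≤ γ) (h1 : γ < 1)
    {r : ι → ℝ} {b : ℝ} (hr : ∀ i, |r i| ≤ b) (i : ι) : |discSum γ K r i| ≤ b / (1 - γ) :=
  abs_le_div_of_eq_add_discounted hK h0 h1 hr (discSum_eq_add hK h0 h1 r) i

end DiscountedSum

namespace RegMDP

variable {S A : Type*} [Fintype S] [Fintype A] {M : RegMDP S A} {π : Policy S A}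

lemma Feasible.mem_stdSimplex (hπ : M.Feasible π) (s : S) : π s ∈ stdSimplex ℝ A :=
  M.dom_subset s (hπ s)

lemma sum_stateMat_mul (s : S) (x : S → ℝ) :
    ∑ s', M.stateMat π s s' * x s' = ∑ a, π s a * ∑ s', M.P s a s' * x s' := by
  simp only [stateMat, Matrix.of_apply, Finset.sum_mul, Finset.mul_sum, mul_assoc]
  rw [Finset.sum_comm]

lemma sum_pairMat_mul (z : S × A) (x : S × A → ℝ) :
    ∑ z', M.pairMat π z z' * x z' = ∑ s', M.P z.1 z.2 s' * ∑ a', π s' a' * x (s', a') := by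
  simp only [pairMat, Matrix.of_apply, Fintype.sum_prod_type, Finset.mul_sum, mul_assoc]

lemma abs_runCost_le {cbar hbar : ℝ} (hc : ∀ s a, |M.c s a| ≤ cbar)
    (hh : ∀ s, ∀ p ∈ M.dom s, |M.h s p| ≤ hbar) (hπ : M.Feasible π) (z : S × A) :
    |M.runCost π z| ≤ cbar + hbar :=
  (abs_add_le _ _).trans (add_le_add (hc _ _) (hh _ _ (hπ _)))

variable [DecidableEq S]

lemma stateMat_mem_rowStochastic (hπ : ∀ s, π s ∈ stdSimplex ℝ A) :
    M.stateMat π ∈ Matrix.rowStochastic ℝ S := by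
  refine Matrix.mem_rowStochastic_iff_sum.2 ⟨fun s s' =>
    Finset.sum_nonneg fun a _ => mul_nonneg ((hπ s).1 a) (M.P_nonneg _ _ _), fun s => ?_⟩
  simpa only [Pi.one_apply, mul_one, M.P_sum, (hπ s).2] using M.sum_stateMat_mul (π := π) s 1

lemma V_eq_add (hπ : ∀ s, π s ∈ stdSimplex ℝ A) (s : S) :
    M.V π s = ∑ a, π s a * M.runCost π (s, a) + M.γ * ∑ s', M.stateMat π s s' * M.V π s' :=
  discSum_eq_add (stateMat_mem_rowStochastic hπ) M.γ_pos.le M.γ_lt_one _ s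

variable [DecidableEq A]

lemma pairMat_mem_rowStochastic (hπ : ∀ s, π s ∈ stdSimplex ℝ A) :
    M.pairMat π ∈ Matrix.rowStochastic ℝ (S × A) := by
  refine Matrix.mem_rowStochastic_iff_sum.2 ⟨fun z z' =>
    mul_nonneg (M.P_nonneg _ _ _) ((hπ _).1 _), fun z => ?_⟩
  simpa only [mul_one, Pi.one_apply, M.P_sum, (hπ _).2] using M.sum_pairMat_mul (π := π) z 1

lemma Q_eq_add (hπ : ∀ s, π s ∈ stdSimplex ℝ A) (z : S × A) :
    M.Q π z = M.runCost π z + M.γ * ∑ z', M.pairMat π z z' * M.Q π z' :=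
  discSum_eq_add (pairMat_mem_rowStochastic hπ) M.γ_pos.le M.γ_lt_one _ z

lemma Q_eq_add_sum_V (hπ : ∀ s, π s ∈ stdSimplex ℝ A) (z : S × A) :
    M.Q π z = M.runCost π z + M.γ * ∑ s', M.P z.1 z.2 s' * M.V π s' := by
  have h : M.Q π = fun z => M.runCost π z + M.γ * ∑ s', M.P z.1 z.2 s' * M.V π s' := by
    refine eq_of_eq_add_discounted (pairMat_mem_rowStochastic hπ) M.γ_pos.le M.γ_lt_one
      (Q_eq_add hπ) fun z => ?_
    rw [sum_pairMat_mul]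
    congr 2
    refine Finset.sum_congr rfl fun s' _ => ?_
    congr 1
    rw [V_eq_add hπ s', sum_stateMat_mul, Finset.mul_sum, ← Finset.sum_add_distrib]
    exact Finset.sum_congr rfl fun a _ => by ring
  exact congrFun h z

lemma V_eq_sum_Q (hπ : ∀ s, π s ∈ stdSimplex ℝ A) (s : S) :
    M.V π s = ∑ a, π s a * M.Q π (s, a) := by
  rw [V_eq_add hπ s, sum_stateMat_mul, Finset.mul_sum, ← Finset.sum_add_distrib]
  exact Finset.sum_congr rfl fun a _ => by rw [Q_eq_add_sum_V hπ]; ring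

lemma norm2_Q_le_thetaBar [Nonempty S] [Nonempty A] {cbar hbar : ℝ}
    (hc : ∀ s a, |M.c s a| ≤ cbar) (hh : ∀ s, ∀ p ∈ M.dom s, |M.h s p| ≤ hbar)
    (hπ : M.Feasible π) : norm2 (M.Q π) ≤ M.thetaBar cbar hbar := by
  have hQ : ∀ z, |M.Q π z| ≤ (cbar + hbar) / (1 - M.γ) :=
    abs_discSum_le (pairMat_mem_rowStochastic hπ.mem_stdSimplex) M.γ_pos.le M.γ_lt_one
      (abs_runCost_le hc hh hπ)
  simpa only [thetaBar, Fintype.card_prod, Nat.cast_mul] using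
    norm2_le_of_abs_le ((abs_nonneg _).trans (hQ (Classical.arbitrary _))) hQ

lemma sub_bellman_apply (hπ : ∀ s, π s ∈ stdSimplex ℝ A) (θ : S × A → ℝ) (z : S × A) :
    (θ - M.bellman π θ) z =
      (θ - M.Q π) z - M.γ * ∑ z', M.pairMat π z z' * (θ - M.Q π) z' := by
  simp only [Pi.sub_apply, mul_sub, Finset.sum_sub_distrib, bellman]
  rw [← sum_pairMat_mul]
  linarith [M.Q_eq_add hπ z]

end RegMDP

section KL

variable {A : Type*} [Fintype A] {p q r : A → ℝ}

lemma sq_sqrt_sub_sqrt_le_mul_log {x y : ℝ} (hx : 0 ≤ x) (hy : 0 < y) :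
    (√x - √y) ^ 2 ≤ x * Real.log (x / y) - x + y := by
  rcases hx.eq_or_lt with rfl | hx
  · simp [Real.sq_sqrt hy.le]
  have hsx := Real.sqrt_pos.2 hx
  have hsy := Real.sqrt_pos.2 hy
  have hlog : Real.log (x / y) = -2 * Real.log (√y / √x) := by
    rw [Real.log_div hx.ne' hy.ne', Real.log_div hsy.ne' hsx.ne', Real.log_sqrt hx.le,
      Real.log_sqrt hy.le]
    ring
  have hle : x * Real.log (√y / √x) ≤ √x * √y - x :=
    calc x * Real.log (√y / √x) ≤ x * (√y / √x - 1) :=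
          mul_le_mul_of_nonneg_left (Real.log_le_sub_one_of_pos (div_pos hsy hsx)) hx.le
      _ = √x * √y - x := by
          rw [mul_sub, mul_one, mul_div_assoc', mul_comm, mul_div_assoc, Real.div_sqrt, mul_comm]
  rw [hlog, sub_sq, Real.sq_sqrt hx.le, Real.sq_sqrt hy.le]
  linarith

lemma sq_sub_le_mul_log {x y : ℝ} (hx : 0 ≤ x) (hx1 : x ≤ 1) (hy : 0 < y) (hy1 : y ≤ 1) :
    (x - y) ^ 2 ≤ 4 * (x * Real.log (x / y) - x + y) := by
  have hadd : (√x + √y) ^ 2 ≤ 2 ^ 2 :=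
    pow_le_pow_left₀ (by positivity)
      (by linarith [Real.sqrt_le_one.2 hx1, Real.sqrt_le_one.2 hy1]) 2
  calc (x - y) ^ 2 = (√x + √y) ^ 2 * (√x - √y) ^ 2 := by
        rw [← mul_pow, ← sq_sub_sq, Real.sq_sqrt hx, Real.sq_sqrt hy.le]
    _ ≤ 2 ^ 2 * (x * Real.log (x / y) - x + y) :=
        mul_le_mul hadd (sq_sqrt_sub_sqrt_le_mul_log hx hy) (sq_nonneg _) (by norm_num)
    _ = _ := by norm_num

lemma sum_sq_sub_le_klDist (hp : p ∈ stdSimplex ℝ A) (hq : q ∈ stdSimplex ℝ A)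
    (hq0 : ∀ a, 0 < q a) : ∑ a, (p a - q a) ^ 2 ≤ 4 * klDist p q := by
  have h := Finset.sum_le_sum (s := Finset.univ) fun a _ => sq_sub_le_mul_log (hp.1 a)
    (le_one_of_mem_stdSimplex hp a) (hq0 a) (le_one_of_mem_stdSimplex hq a)
  rw [← Finset.mul_sum, Finset.sum_add_distrib, Finset.sum_sub_distrib, hp.2, hq.2,
    sub_add_cancel] at h
  exact h

lemma klDist_nonneg (hp : p ∈ stdSimplex ℝ A) (hq : q ∈ stdSimplex ℝ A)
    (hq0 : ∀ a, 0 < q a) : 0 ≤ klDist p q := by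
  have hsq := Finset.sum_nonneg (s := Finset.univ) fun a _ => sq_nonneg (p a - q a)
  linarith [sum_sq_sub_le_klDist hp hq hq0]

lemma klDist_self (hp : ∀ a, 0 < p a) : klDist p p = 0 := by
  simp [klDist, div_self (hp _).ne']

lemma eq_of_klDist_nonpos (hp : p ∈ stdSimplex ℝ A) (hq : q ∈ stdSimplex ℝ A)
    (hq0 : ∀ a, 0 < q a) (h : klDist p q ≤ 0) : p = q := by
  have hsum : ∑ a, (p a - q a) ^ 2 = 0 :=
    le_antisymm (by linarith [sum_sq_sub_le_klDist hp hq hq0])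
      (Finset.sum_nonneg fun _ _ => sq_nonneg _)
  funext a
  simpa [sub_eq_zero] using
    (Finset.sum_eq_zero_iff_of_nonneg fun _ _ => sq_nonneg _).1 hsum a (Finset.mem_univ a)

lemma klDist_le_sum_sq_div (hp : p ∈ stdSimplex ℝ A) (hq : q ∈ stdSimplex ℝ A)
    (hq0 : ∀ a, 0 < q a) : klDist p q ≤ ∑ a, (p a - q a) ^ 2 / q a := by
  have h : klDist p q ≤ ∑ a, ((p a - q a) ^ 2 / q a + (p a - q a)) := by
    refine Finset.sum_le_sum fun a _ => ?_
    have heq : (p a - q a) ^ 2 / q a + (p a - q a) = p a * (p a / q a - 1) := by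
      field_simp [(hq0 a).ne']
      ring
    rw [heq]
    rcases (hp.1 a).eq_or_lt with h0 | h0
    · simp [← h0]
    · exact mul_le_mul_of_nonneg_left (Real.log_le_sub_one_of_pos (div_pos h0 (hq0 a))) h0.le
  rwa [Finset.sum_add_distrib, Finset.sum_sub_distrib, hp.2, hq.2, sub_self, add_zero] at h

lemma klDist_sub_klDist (hp : ∀ a, 0 ≤ p a) (hq : ∀ a, 0 < q a) (hr : ∀ a, 0 < r a) :
    klDist p r - klDist q r = klDist p q + ∑ a, Real.log (q a / r a) * (p a - q a) := by
  unfold klDist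
  rw [← Finset.sum_sub_distrib, ← Finset.sum_add_distrib]
  refine Finset.sum_congr rfl fun a _ => ?_
  rcases (hp a).eq_or_lt with h0 | h0
  · rw [← h0]; ring
  · rw [Real.log_div h0.ne' (hr a).ne', Real.log_div h0.ne' (hq a).ne',
      Real.log_div (hq a).ne' (hr a).ne']
    ring

lemma klDist_uniform_le (hp : p ∈ stdSimplex ℝ A) :
    klDist p (fun _ => 1 / (Fintype.card A : ℝ)) ≤ Real.log (Fintype.card A) := by
  rw [← sum_mul_const_of_mem_stdSimplex hp (Real.log _)]
  refine Finset.sum_le_sum fun a _ => ?_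
  rcases (hp.1 a).eq_or_lt with h0 | h0
  · simp [← h0]
  · have : Nonempty A := ⟨a⟩
    have hcard : (0 : ℝ) < Fintype.card A := by exact_mod_cast Fintype.card_pos
    refine mul_le_mul_of_nonneg_left (Real.log_le_log (by positivity) ?_) h0.le
    rw [div_div_eq_mul_div, div_one]
    exact mul_le_of_le_one_left hcard.le (le_one_of_mem_stdSimplex hp a)

lemma neg_mul_sum_mul_sub_le_klDist (hp : p ∈ stdSimplex ℝ A) (hq : q ∈ stdSimplex ℝ A)
    (hq0 : ∀ a, 0 < q a) (η : ℝ) (δ : A → ℝ) :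
    -(η * ∑ a, δ a * (p a - q a)) ≤ klDist p q + η ^ 2 * ∑ a, δ a ^ 2 := by
  have hyoung : ∑ a, -(η * (δ a * (p a - q a)))
      ≤ ∑ a, ((p a - q a) ^ 2 / 4 + η ^ 2 * δ a ^ 2) :=
    Finset.sum_le_sum fun a _ => by nlinarith [sq_nonneg ((p a - q a) / 2 + η * δ a)]
  rw [Finset.sum_add_distrib, ← Finset.mul_sum, Finset.sum_neg_distrib, ← Finset.mul_sum,
    ← Finset.sum_div] at hyoung
  linarith [sum_sq_sub_le_klDist hp hq hq0]

lemma nonneg_of_forall_nonneg_add_mul {x c : ℝ} (h : ∀ t, 0 < t → t ≤ 1 → 0 ≤ x + t * c) :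
    0 ≤ x := by
  have hlim : Filter.Tendsto (fun t : ℝ => x + t * c) (nhdsWithin 0 (Set.Ioi 0)) (nhds x) := by
    have hcont : Continuous fun t : ℝ => x + t * c := by fun_prop
    simpa using (hcont.tendsto 0).mono_left nhdsWithin_le_nhds
  refine ge_of_tendsto hlim ?_
  filter_upwards [Ioc_mem_nhdsGT one_pos] with t ht using h t ht.1 ht.2

lemma klDist_segment_le (hp : p ∈ stdSimplex ℝ A) (hq : q ∈ stdSimplex ℝ A)
    (hq0 : ∀ a, 0 < q a) (hr : ∀ a, 0 < r a) {t : ℝ} (ht0 : 0 ≤ t) (ht1 : t ≤ 1) :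
    klDist ((1 - t) • q + t • p) r ≤ klDist q r
      + t * (∑ a, Real.log (q a / r a) * (p a - q a) + t * ∑ a, (p a - q a) ^ 2 / q a) := by
  have hmem : (1 - t) • q + t • p ∈ stdSimplex ℝ A :=
    convex_stdSimplex ℝ A hq hp (by linarith) ht0 (by ring)
  have happly : ∀ a, ((1 - t) • q + t • p) a - q a = t * (p a - q a) := fun a => by
    simp only [Pi.add_apply, Pi.smul_apply, smul_eq_mul]; ring
  have hsub := klDist_sub_klDist hmem.1 hq0 hr
  have hsq := klDist_le_sum_sq_div hmem hq hq0
  simp only [happly, mul_pow, mul_left_comm _ t, mul_div_assoc, ← Finset.mul_sum] at hsub hsq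
  linarith

/-- First-order optimality for the sum of a convex function and the divergence, whose gradient
at a positive point `q` is `log (q / r)` up to a constant. -/
lemma nonneg_of_isMinOn_add_klDist {D : Set (A → ℝ)} (hD : D ⊆ stdSimplex ℝ A)
    {F : (A → ℝ) → ℝ} (hF : ConvexOn ℝ D F) (hmin : IsMinOn (fun x => F x + klDist x r) D q)
    (hq : q ∈ D) (hq0 : ∀ a, 0 < q a) (hr : ∀ a, 0 < r a) (hp : p ∈ D) :
    0 ≤ F p - F q + ∑ a, Real.log (q a / r a) * (p a - q a) := by
  refine nonneg_of_forall_nonneg_add_mul (c := ∑ a, (p a - q a) ^ 2 / q a) fun t ht0 ht1 => ?_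
  have hsegment : F q + klDist q r ≤ F ((1 - t) • q + t • p) + klDist ((1 - t) • q + t • p) r :=
    hmin (hF.1 hq hp (by linarith) ht0.le (by ring))
  have hconv : F ((1 - t) • q + t • p) ≤ (1 - t) * F q + t * F p :=
    hF.2 hq hp (by linarith) ht0.le (by ring)
  refine nonneg_of_mul_nonneg_right (a := t) ?_ ht0
  linarith [klDist_segment_le (hD hp) (hD hq) hq0 hr ht0.le ht1]

end KL

namespace RegMDP

variable {S A : Type*} [Fintype S] [Fintype A] {M : RegMDP S A} {π πp πs : Policy S A}
  {η μ : ℝ} {G : S × A → ℝ}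

lemma IsProx.feasible (h : M.IsProx η G π πp) : M.Feasible πp := fun s => (h s).1

lemma IsProx.optimality (h : M.IsProx η G π πp) (hη : 0 ≤ η) (s : S) (hπ : ∀ a, 0 < π s a)
    (hp : ∀ a, 0 < πp s a) {q : A → ℝ} (hq : q ∈ M.dom s) :
    0 ≤ η * (∑ a, G (s, a) * (q a - πp s a) + M.h s q - M.h s (πp s))
      + ∑ a, Real.log (πp s a / π s a) * (q a - πp s a) := by
  have hconv : ConvexOn ℝ (M.dom s) fun p => η * (∑ a, G (s, a) * p a + M.h s p) :=
    (((dotProductBilin ℝ ℝ fun a => G (s, a)).convexOn (M.h_convex s).1).add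
      (M.h_convex s)).smul hη
  have hopt :=
    nonneg_of_isMinOn_add_klDist (M.dom_subset s) hconv (h s).2 (h s).1 hp hπ hq
  simp only [mul_sub, Finset.sum_sub_distrib] at hopt ⊢
  linarith

/-- The first-order condition turns `-G - log (πp / π) / η` into a subgradient of the regularizer
at `πp`, to which strong convexity applies. -/
lemma IsProx.three_point (h : M.IsProx η G π πp) (hsc : M.StronglyConvex μ) (hη : 0 < η) (s : S)
    (hπ : ∀ a, 0 < π s a) (hp : ∀ a, 0 < πp s a) {q : A → ℝ} (hq : q ∈ M.dom s) :
    η * (∑ a, G (s, a) * πp s a + M.h s (πp s)) + klDist (πp s) (π s)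
        + (1 + η * μ) * klDist q (πp s)
      ≤ η * (∑ a, G (s, a) * q a + M.h s q) + klDist q (π s) := by
  set g : A → ℝ := fun a => -G (s, a) - Real.log (πp s a / π s a) / η with hg
  have hg_mul : ∀ q : A → ℝ, η * ∑ a, g a * (q a - πp s a)
      = -(η * ∑ a, G (s, a) * (q a - πp s a))
        - ∑ a, Real.log (πp s a / π s a) * (q a - πp s a) := fun q => by
    simp only [Finset.mul_sum, ← Finset.sum_neg_distrib, ← Finset.sum_sub_distrib, hg]
    refine Finset.sum_congr rfl fun a _ => ?_
    field_simp
  have hsub : M.IsSubgradient s (πp s) g := fun q hq =>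
    le_of_mul_le_mul_left (by linarith [h.optimality hη.le s hπ hp hq, hg_mul q]) hη
  have hstrong := mul_le_mul_of_nonneg_left (hsc s (πp s) (h s).1 hp g hsub q hq) hη.le
  have hthree := klDist_sub_klDist (M.dom_subset s hq).1 hp hπ
  have hgq := hg_mul q
  simp only [mul_sub (G _), Finset.sum_sub_distrib] at hgq
  linarith

lemma IsProx.unique {πp' : Policy S A} (h : M.IsProx η G π πp) (h' : M.IsProx η G π πp')
    (hsc : M.StronglyConvex μ) (hμ : 0 < μ) (hη : 0 < η)
    (hπ : ∀ s a, 0 < π s a) (hp : ∀ s a, 0 < πp s a) : πp' = πp := by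
  funext s
  have hle := h.three_point hsc hη s (hπ s) (hp s) (h' s).1
  have hge : η * (∑ a, G (s, a) * πp' s a + M.h s (πp' s)) + klDist (πp' s) (π s)
      ≤ η * (∑ a, G (s, a) * πp s a + M.h s (πp s)) + klDist (πp s) (π s) := (h' s).2 (h s).1
  refine eq_of_klDist_nonpos (h'.feasible.mem_stdSimplex s) (h.feasible.mem_stdSimplex s) (hp s) ?_
  exact nonpos_of_mul_nonpos_right (a := 1 + η * μ) (by linarith) (by positivity)

variable [DecidableEq S] [DecidableEq A]

/-- The advantage at the state `s` of the policy `πp` over `π`: the cost of choosing the first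
action according to `πp` and all later ones according to `π`, the regularizer of the first step
included, minus the value of `π`. -/
noncomputable def advantage (M : RegMDP S A) (π πp : Policy S A) (s : S) : ℝ :=
  ∑ a, M.Q π (s, a) * (πp s a - π s a) + M.h s (πp s) - M.h s (π s)

lemma advantage_self (M : RegMDP S A) (π : Policy S A) (s : S) : M.advantage π π s = 0 := by
  simp [advantage]

lemma advantage_eq (hπ : M.Feasible π) (hp : M.Feasible πp) (s : S) :
    M.advantage π πp s = (M.V πp s - M.V π s)
      - M.γ * ∑ s', M.stateMat πp s s' * (M.V πp s' - M.V π s') := by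
  have hQ : ∑ a, πp s a * M.Q π (s, a) = ∑ a, πp s a * M.c s a + M.h s (π s)
      + M.γ * ∑ s', M.stateMat πp s s' * M.V π s' := by
    rw [sum_stateMat_mul, ← sum_mul_const_of_mem_stdSimplex (hp.mem_stdSimplex s) (M.h s (π s)),
      Finset.mul_sum, ← Finset.sum_add_distrib, ← Finset.sum_add_distrib]
    refine Finset.sum_congr rfl fun a _ => ?_
    rw [Q_eq_add_sum_V hπ.mem_stdSimplex, runCost]
    ring
  have hV : M.V πp s = ∑ a, πp s a * M.c s a + M.h s (πp s)
      + M.γ * ∑ s', M.stateMat πp s s' * M.V πp s' := by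
    rw [V_eq_add hp.mem_stdSimplex,
      ← sum_mul_const_of_mem_stdSimplex (hp.mem_stdSimplex s) (M.h s (πp s)),
      ← Finset.sum_add_distrib]
    simp only [runCost, mul_add]
  have hadv : ∑ a, M.Q π (s, a) * (πp s a - π s a) = ∑ a, πp s a * M.Q π (s, a) - M.V π s := by
    rw [V_eq_sum_Q hπ.mem_stdSimplex, ← Finset.sum_sub_distrib]
    exact Finset.sum_congr rfl fun a _ => by ring
  rw [advantage, hadv, hQ, hV]
  simp only [mul_sub, Finset.sum_sub_distrib]
  ring

lemma sum_mul_advantage {ν : S → ℝ} (hν : M.IsStationary πs ν) (hπ : M.Feasible π)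
    (hs : M.Feasible πs) :
    ∑ s, ν s * M.advantage π πs s = -(1 - M.γ) * (M.f ν π - M.f ν πs) := by
  simp only [advantage_eq hπ hs, mul_sub (ν _), Finset.sum_sub_distrib, mul_left_comm (ν _) M.γ,
    ← Finset.mul_sum, sum_mul_sum_mul_of_vecMul_eq_self hν.2, f]
  ring

lemma V_sub_le_of_advantage_le (hπ : M.Feasible π) (hp : M.Feasible πp) {b : ℝ}
    (h : ∀ s, M.advantage π πp s ≤ b) (s : S) :
    M.V πp s - M.V π s ≤ M.advantage π πp s + M.γ * (b / (1 - M.γ)) := by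
  have hK := stateMat_mem_rowStochastic (M := M) hp.mem_stdSimplex
  have hle : ∀ s, M.V πp s - M.V π s ≤ b / (1 - M.γ) :=
    le_div_of_le_add_discounted hK M.γ_pos.le M.γ_lt_one (u := fun s => M.V πp s - M.V π s)
      fun s => by linarith [h s, advantage_eq hπ hp s]
  have hmean := mul_le_mul_of_nonneg_left
    (sum_mul_le_of_mem_stdSimplex (row_mem_stdSimplex hK s) hle) M.γ_pos.le
  linarith [advantage_eq hπ hp s]

lemma IsProx.mul_advantage_le (h : M.IsProx η G π πp) (hsc : M.StronglyConvex μ) (hη : 0 < η)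
    (hπ : M.Feasible π) (hs : M.Feasible πs) (hπ0 : ∀ s a, 0 < π s a)
    (hp0 : ∀ s a, 0 < πp s a) (s : S) :
    η * M.advantage π πp s ≤
      η * (M.advantage π πs s + ∑ a, (G - M.Q π) (s, a) * (πs s a - π s a))
        + klDist (πs s) (π s) - (1 + η * μ) * klDist (πs s) (πp s)
        + η ^ 2 * norm2 (G - M.Q π) ^ 2 := by
  have hthree := h.three_point hsc hη s (hπ0 s) (hp0 s) (hs s)
  have hcross := neg_mul_sum_mul_sub_le_klDist (h.feasible.mem_stdSimplex s)
    (hπ.mem_stdSimplex s) (hπ0 s) η fun a => (G - M.Q π) (s, a)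
  have hslice : ∑ a, (G - M.Q π) (s, a) ^ 2 ≤ norm2 (G - M.Q π) ^ 2 := by
    rw [norm2_sq, Fintype.sum_prod_type]
    exact Finset.single_le_sum (f := fun s => ∑ a, (G - M.Q π) (s, a) ^ 2)
      (fun _ _ => Finset.sum_nonneg fun _ _ => sq_nonneg _) (Finset.mem_univ s)
  have hslice' := mul_le_mul_of_nonneg_left hslice (sq_nonneg η)
  simp only [advantage, Pi.sub_apply, mul_sub, sub_mul, Finset.sum_sub_distrib]
    at hthree hcross hslice' ⊢
  linarith

lemma IsProx.advantage_le (h : M.IsProx η G π πp) (hsc : M.StronglyConvex μ) (hη : 0 < η)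
    (hμ : 0 ≤ μ) (hπ : M.Feasible π) (hπ0 : ∀ s a, 0 < π s a) (hp0 : ∀ s a, 0 < πp s a) (s : S) :
    M.advantage π πp s ≤ η * norm2 (G - M.Q π) ^ 2 := by
  have hle := h.mul_advantage_le hsc hη hπ hπ hπ0 hp0 s
  have hkl := mul_nonneg (by positivity : 0 ≤ 1 + η * μ)
    (klDist_nonneg (hπ.mem_stdSimplex s) (h.feasible.mem_stdSimplex s) (hp0 s))
  simp only [advantage_self, sub_self, mul_zero, Finset.sum_const_zero, add_zero,
    klDist_self (hπ0 s)] at hle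
  exact le_of_mul_le_mul_left (by linarith) hη

/-- The step size `η = (1 - γ) / (γ μ)` makes the coefficient `1 / η` of the old divergence equal
to `γ` times the coefficient `(1 + η μ) / η = μ / (1 - γ)` of the new one. -/
lemma IsProx.V_sub_le (h : M.IsProx ((1 - M.γ) / (M.γ * μ)) G π πp) (hμ : 0 < μ)
    (hsc : M.StronglyConvex μ) (hπ : M.Feasible π) (hs : M.Feasible πs)
    (hπ0 : ∀ s a, 0 < π s a) (hp0 : ∀ s a, 0 < πp s a) (s : S) :
    M.V πp s - M.V π s ≤ M.advantage π πs s
      + μ / (1 - M.γ) * (M.γ * klDist (πs s) (π s) - klDist (πs s) (πp s))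
      + ∑ a, (G - M.Q π) (s, a) * (πs s a - π s a)
      + 1 / (M.γ * μ) * norm2 (G - M.Q π) ^ 2 := by
  have hγ := M.γ_pos
  have hγ1 : 0 < 1 - M.γ := by linarith [M.γ_lt_one]
  set η := (1 - M.γ) / (M.γ * μ) with hηdef
  have hη : 0 < η := by positivity
  have hV := V_sub_le_of_advantage_le hπ h.feasible (h.advantage_le hsc hη hμ.le hπ hπ0 hp0) s
  have hadv := h.mul_advantage_le hsc hη hπ hs hπ0 hp0 s
  rw [← le_div_iff₀' hη] at hadv
  refine (hV.trans (add_le_add_left hadv _)).trans_eq ?_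
  rw [hηdef]
  field_simp
  ring

lemma IsProx.gap_le {ν : S → ℝ} (h : M.IsProx ((1 - M.γ) / (M.γ * μ)) G π πp)
    (hμ : 0 < μ) (hsc : M.StronglyConvex μ) (hν : M.IsStationary πs ν) (hπ : M.Feasible π)
    (hs : M.Feasible πs) (hπ0 : ∀ s a, 0 < π s a) (hp0 : ∀ s a, 0 < πp s a) :
    M.gap μ ν πs πp ≤ M.gap μ ν πs π * M.γ + 1 / (M.γ * μ) * norm2 (G - M.Q π) ^ 2
      + ∑ z : S × A, (G - M.Q π) z * (ν z.1 * (πs z.1 z.2 - π z.1 z.2)) := by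
  have hsum := Finset.sum_le_sum (s := Finset.univ) fun s _ =>
    mul_le_mul_of_nonneg_left (h.V_sub_le hμ hsc hπ hs hπ0 hp0 s) (hν.1.1 s)
  simp only [mul_add (ν _), Finset.sum_add_distrib, sum_mul_advantage hν hπ hs,
    sum_mul_const_of_mem_stdSimplex hν.1, mul_left_comm (ν _) (μ / _), mul_sub (ν _),
    mul_left_comm (ν _) M.γ, ← Finset.mul_sum, Finset.sum_sub_distrib] at hsum
  simp only [Finset.mul_sum (Finset.univ : Finset A), mul_left_comm (ν _) ((G - M.Q π) _)] at hsum
  rw [Fintype.sum_prod_type]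
  simp only [gap, f, dist] at hsum ⊢
  linarith

end RegMDP

section StochasticMatrix

variable {ι : Type*} [Fintype ι] {K : Matrix ι ι ℝ} {ν : ι → ℝ}

lemma sum_mul_sub_sum_mul_le_of_forall_le {p q g : ι → ℝ} {δ c : ℝ} (hp : p ∈ stdSimplex ℝ ι)
    (hq : q ∈ stdSimplex ℝ ι) (hδ : ∀ i, δ ≤ p i) (hg : ∀ i j, g i - g j ≤ c) :
    ∑ i, p i * g i - ∑ i, q i * g i ≤ (1 - δ) * c := by
  have : Nonempty ι := by
    by_contra h
    rw [not_nonempty_iff] at h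
    simpa using hp.2
  obtain ⟨b, hb⟩ := Finite.exists_max g
  obtain ⟨a, ha⟩ := Finite.exists_min g
  have hupper : δ * (g b - g a) ≤ g b - ∑ i, p i * g i := by
    calc δ * (g b - g a) ≤ p a * (g b - g a) :=
          mul_le_mul_of_nonneg_right (hδ a) (sub_nonneg.2 (hb a))
      _ ≤ ∑ i, p i * (g b - g i) := Finset.single_le_sum (f := fun i => p i * (g b - g i))
          (fun i _ => mul_nonneg (hp.1 i) (sub_nonneg.2 (hb i))) (Finset.mem_univ a)
      _ = g b - ∑ i, p i * g i := by
          simp only [mul_sub, Finset.sum_sub_distrib, sum_mul_const_of_mem_stdSimplex hp]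
  have hlower := sum_mul_le_of_mem_stdSimplex hq (r := -g) fun i => neg_le_neg (ha i)
  simp only [Pi.neg_apply, mul_neg, Finset.sum_neg_distrib] at hlower
  have hosc := mul_le_mul_of_nonneg_left (hg b a)
    (sub_nonneg.2 ((hδ a).trans (le_one_of_mem_stdSimplex hp a)))
  linarith

lemma vecMul_abs_of_vecMul_eq_self (hK0 : ∀ i j, 0 ≤ K i j) (hK1 : ∀ i, ∑ j, K i j = 1)
    (hν : Matrix.vecMul ν K = ν) :
    Matrix.vecMul (fun i => |ν i|) K = fun i => |ν i| := by
  have hle : ∀ j, |ν j| ≤ ∑ i, |ν i| * K i j := fun j =>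
    calc |ν j| = |∑ i, ν i * K i j| := congrArg abs (congrFun hν j).symm
      _ ≤ ∑ i, |ν i * K i j| := Finset.abs_sum_le_sum_abs _ _
      _ = _ := Finset.sum_congr rfl fun i _ => by rw [abs_mul, abs_of_nonneg (hK0 i j)]
  have hsum : ∑ j, |ν j| = ∑ j, ∑ i, |ν i| * K i j := by
    rw [Finset.sum_comm]
    simp only [← Finset.mul_sum, hK1, mul_one]
  funext j
  exact ((Finset.sum_eq_sum_iff_of_le fun j _ => hle j).1 hsum j (Finset.mem_univ j)).symm

variable [DecidableEq ι]

lemma exists_mem_stdSimplex_vecMul_eq_self [Nonempty ι] (hK : K ∈ Matrix.rowStochastic ℝ ι) :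
    ∃ ν ∈ stdSimplex ℝ ι, Matrix.vecMul ν K = ν := by
  have hker : ∃ v ≠ 0, Matrix.mulVec (K - 1) v = 0 :=
    ⟨1, one_ne_zero, by rw [Matrix.sub_mulVec, hK.2, Matrix.one_mulVec, sub_self]⟩
  obtain ⟨v, hv0, hv⟩ :=
    Matrix.exists_vecMul_eq_zero_iff.2 (Matrix.exists_mulVec_eq_zero_iff.1 hker)
  rw [Matrix.vecMul_sub, Matrix.vecMul_one, sub_eq_zero] at hv
  have hpos : 0 < ∑ j, |v j| := by
    obtain ⟨i, hi⟩ := Function.ne_iff.1 hv0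
    exact Finset.sum_pos' (fun _ _ => abs_nonneg _) ⟨i, Finset.mem_univ i, abs_pos.2 hi⟩
  refine ⟨(∑ j, |v j|)⁻¹ • fun i => |v i|,
    ⟨fun i => mul_nonneg (inv_nonneg.2 hpos.le) (abs_nonneg _), ?_⟩, ?_⟩
  · simp only [Pi.smul_apply, smul_eq_mul, ← Finset.mul_sum, inv_mul_cancel₀ hpos.ne']
  · rw [Matrix.smul_vecMul,
      vecMul_abs_of_vecMul_eq_self hK.1 (Matrix.sum_row_of_mem_rowStochastic hK) hv]

lemma vecMul_pow_of_vecMul_eq_self (hν : Matrix.vecMul ν K = ν) (t : ℕ) :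
    Matrix.vecMul ν (K ^ t) = ν := by
  induction t with
  | zero => simp
  | succ t ih => rw [pow_succ, ← Matrix.vecMul_vecMul, ih, hν]

lemma sum_mul_pow_apply_of_vecMul_eq_self (hν : Matrix.vecMul ν K = ν) (t : ℕ) (j : ι) :
    ∑ i, ν i * (K ^ t) i j = ν j :=
  congrFun (vecMul_pow_of_vecMul_eq_self hν t) j

lemma le_apply_of_vecMul_eq_self (hν0 : ν ∈ stdSimplex ℝ ι) (hν : Matrix.vecMul ν K = ν) {m : ℕ}
    {δ : ℝ} (hδ : ∀ i j, δ ≤ (K ^ m) i j) (j : ι) : δ ≤ ν j := by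
  rw [← sum_mul_pow_apply_of_vecMul_eq_self hν m, ← sum_mul_const_of_mem_stdSimplex hν0 δ]
  exact Finset.sum_le_sum fun i _ => mul_le_mul_of_nonneg_left (hδ i j) (hν0.1 i)

lemma pow_apply_sub_pow_apply_le (hK : K ∈ Matrix.rowStochastic ℝ ι) {δ : ℝ} {m : ℕ}
    (hδ : ∀ i j, δ ≤ (K ^ m) i j) (q r : ℕ) (i i' j : ι) :
    (K ^ (m * q + r)) i j - (K ^ (m * q + r)) i' j ≤ (1 - δ) ^ q := by
  induction q generalizing i i' with
  | zero =>
    have hle := Matrix.le_one_of_mem_rowStochastic (pow_mem hK r) (i := i) (j := j)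
    have hge := (pow_mem hK r).1 i' j
    simp only [mul_zero, zero_add, pow_zero]
    linarith
  | succ q ih =>
    have hexp : m * (q + 1) + r = m + (m * q + r) := by ring
    rw [hexp, pow_add, Matrix.mul_apply, Matrix.mul_apply, pow_succ']
    exact sum_mul_sub_sum_mul_le_of_forall_le (row_mem_stdSimplex (pow_mem hK m) i)
      (row_mem_stdSimplex (pow_mem hK m) i') (hδ i) fun a b => ih a b

lemma abs_stationary_sub_pow_apply_le (hK : K ∈ Matrix.rowStochastic ℝ ι) {δ : ℝ} {m : ℕ}
    (hδ : ∀ i j, δ ≤ (K ^ m) i j) (hν0 : ν ∈ stdSimplex ℝ ι)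
    (hν : Matrix.vecMul ν K = ν) (t : ℕ) (i j : ι) :
    |ν j - (K ^ t) i j| ≤ (1 - δ) ^ (t / m) := by
  have hosc : ∀ i i', (K ^ t) i j - (K ^ t) i' j ≤ (1 - δ) ^ (t / m) := fun i i' => by
    simpa only [Nat.div_add_mod] using pow_apply_sub_pow_apply_le hK hδ (t / m) (t % m) i i' j
  have hmean : ν j - (K ^ t) i j = ∑ l, ν l * ((K ^ t) l j - (K ^ t) i j) := by
    simp only [mul_sub, Finset.sum_sub_distrib, sum_mul_pow_apply_of_vecMul_eq_self hν,
      sum_mul_const_of_mem_stdSimplex hν0]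
  rw [hmean]
  exact abs_sum_mul_le_of_mem_stdSimplex hν0 fun l =>
    abs_le.2 ⟨by linarith [hosc i l], hosc l i⟩

lemma pow_mul_pow_apply_le {B : Matrix ι ι ℝ} {c : ℝ} (hc : 0 ≤ c) (hB : ∀ i j, 0 ≤ B i j)
    (h : ∀ i j, c * B i j ≤ K i j) (m : ℕ) (i j : ι) :
    c ^ m * (B ^ m) i j ≤ (K ^ m) i j := by
  induction m generalizing i with
  | zero => simp
  | succ m ih =>
    rw [pow_succ' B, pow_succ' K, Matrix.mul_apply, Matrix.mul_apply, Finset.mul_sum]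
    refine Finset.sum_le_sum fun l _ => ?_
    calc c ^ (m + 1) * (B i l * (B ^ m) l j) = (c * B i l) * (c ^ m * (B ^ m) l j) := by ring
      _ ≤ _ := mul_le_mul (h i l) (ih l)
        (mul_nonneg (pow_nonneg hc m) (Matrix.pow_apply_nonneg hB m l j))
        ((mul_nonneg hc (hB i l)).trans (h i l))

lemma le_minEig_diagonal [Nonempty ι] {w : ι → ℝ} {b : ℝ} (h : ∀ i, b ≤ w i) :
    b ≤ minEig (Matrix.diagonal w) := by
  rw [minEig, spectrum_diagonal]
  exact le_csInf (Set.range_nonempty _) (Set.forall_mem_range.2 h)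

lemma maxEig_diagonal_le [Nonempty ι] {w : ι → ℝ} {b : ℝ} (h : ∀ i, w i ≤ b) :
    maxEig (Matrix.diagonal w) ≤ b := by
  rw [maxEig, spectrum_diagonal]
  exact csSup_le (Set.range_nonempty _) (Set.forall_mem_range.2 h)

lemma minEig_diagonal_le {w : ι → ℝ} (i : ι) : minEig (Matrix.diagonal w) ≤ w i := by
  rw [minEig, spectrum_diagonal]
  exact csInf_le (Set.finite_range w).bddBelow ⟨i, rfl⟩

end StochasticMatrix

lemma exists_forall_pow_div_le_mul_pow {a : ℝ} (h0 : 0 < a) (h1 : a < 1) {m : ℕ} (hm : m ≠ 0) :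
    ∃ C ρ : ℝ, 0 < C ∧ 0 < ρ ∧ ρ < 1 ∧ ∀ t : ℕ, a ^ (t / m) ≤ C * ρ ^ t := by
  obtain ⟨ρ, hρ0, rfl⟩ : ∃ ρ > 0, ρ ^ m = a :=
    ⟨a ^ (m⁻¹ : ℝ), Real.rpow_pos_of_pos h0 _, Real.rpow_inv_natCast_pow h0.le hm⟩
  have hρ1 : ρ < 1 := (pow_lt_one_iff_of_nonneg hρ0.le hm).1 h1
  refine ⟨(ρ ^ m)⁻¹, ρ, by positivity, hρ0, hρ1, fun t => ?_⟩
  rw [inv_mul_eq_div, le_div_iff₀ h0, ← pow_mul, ← pow_add]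
  refine pow_le_pow_of_le_one hρ0.le hρ1.le ?_
  have hdiv := Nat.div_add_mod t m
  have hmod := Nat.mod_lt t (Nat.pos_of_ne_zero hm)
  omega

namespace RegMDP

variable {S A : Type*} [Fintype S] [Fintype A] {M : RegMDP S A} {π : Policy S A}

lemma P_mem_stdSimplex (M : RegMDP S A) (s : S) (a : A) : M.P s a ∈ stdSimplex ℝ S :=
  ⟨M.P_nonneg s a, M.P_sum s a⟩

lemma statDist_isStationary [Nonempty S] (hπ : ∀ s, π s ∈ stdSimplex ℝ A) :
    M.IsStationary π (M.statDist π) := by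
  classical
  have h : ∃ ν, M.IsStationary π ν :=
    exists_mem_stdSimplex_vecMul_eq_self (stateMat_mem_rowStochastic hπ)
  rw [statDist, dif_pos h]
  exact h.choose_spec

/-- The stationary distribution of the state-action pairs, which is the diagonal of
`M.weight π`. -/
noncomputable def pairDist (M : RegMDP S A) (π : Policy S A) (z : S × A) : ℝ :=
  M.statDist π z.1 * π z.1 z.2

lemma pairDist_mem_stdSimplex [Nonempty S] (hπ : ∀ s, π s ∈ stdSimplex ℝ A) :
    M.pairDist π ∈ stdSimplex ℝ (S × A) := by
  have h := statDist_isStationary (M := M) hπ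
  refine ⟨fun z => mul_nonneg (h.1.1 _) ((hπ _).1 _), ?_⟩
  simp only [pairDist, Fintype.sum_prod_type, ← Finset.mul_sum, (hπ _).2, mul_one]
  exact h.1.2

lemma vecMul_pairDist [Nonempty S] (hπ : ∀ s, π s ∈ stdSimplex ℝ A) :
    Matrix.vecMul (M.pairDist π) (M.pairMat π) = M.pairDist π := by
  funext z
  have h := congrFun (statDist_isStationary (M := M) hπ).2 z.1
  simp only [Matrix.vecMul, dotProduct, stateMat, Matrix.of_apply, pairDist, pairMat,
    Fintype.sum_prod_type] at h ⊢
  simp only [← h, Finset.mul_sum, Finset.sum_mul]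
  exact Finset.sum_congr rfl fun s _ => Finset.sum_congr rfl fun a _ => by ring

variable [DecidableEq S] {Pol : Set (Policy S A)} {πlow : ℝ}

/-- Any two policies of the class have comparable transition matrices, so a positive power of one
of these matrices provides a common lower bound for all of them. -/
lemma exists_forall_le_stateMat_pow (hfeas : ∀ π ∈ Pol, M.Feasible π) (hlow : 0 < πlow)
    (hrand : ∀ π ∈ Pol, ∀ s a, πlow ≤ π s a)
    (herg : ∀ π ∈ Pol, (M.stateMat π).IsPrimitive) :
    ∃ δ > 0, ∃ m : ℕ, ∀ π ∈ Pol, ∀ s s', δ ≤ (M.stateMat π ^ m) s s' := by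
  rcases Pol.eq_empty_or_nonempty with rfl | ⟨π₀, h₀⟩
  · exact ⟨1, one_pos, 0, by simp⟩
  rcases isEmpty_or_nonempty S with hS | hS
  · exact ⟨1, one_pos, 0, fun _ _ s => hS.elim s⟩
  have hcompare : ∀ π ∈ Pol, ∀ s s', πlow * M.stateMat π₀ s s' ≤ M.stateMat π s s' := by
    intro π hπ s s'
    simp only [stateMat, Matrix.of_apply, Finset.mul_sum, ← mul_assoc]
    refine Finset.sum_le_sum fun a _ => mul_le_mul_of_nonneg_right ?_ (M.P_nonneg _ _ _)
    exact (mul_le_of_le_one_right hlow.le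
      (le_one_of_mem_stdSimplex ((hfeas π₀ h₀).mem_stdSimplex s) a)).trans (hrand π hπ s a)
  obtain ⟨m, -, hpos⟩ := (herg π₀ h₀).exists_pos_pow
  obtain ⟨⟨s₀, s₀'⟩, hmin⟩ := Finite.exists_min fun p : S × S => (M.stateMat π₀ ^ m) p.1 p.2
  refine ⟨πlow ^ m * (M.stateMat π₀ ^ m) s₀ s₀', mul_pos (by positivity) (hpos _ _), m,
    fun π hπ s s' => ?_⟩
  calc πlow ^ m * (M.stateMat π₀ ^ m) s₀ s₀' ≤ πlow ^ m * (M.stateMat π₀ ^ m) s s' :=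
        mul_le_mul_of_nonneg_left (hmin (s, s')) (by positivity)
    _ ≤ (M.stateMat π ^ m) s s' := pow_mul_pow_apply_le hlow.le
        (stateMat_mem_rowStochastic (hfeas π₀ h₀).mem_stdSimplex).1 (hcompare π hπ) m s s'

variable [DecidableEq A]

lemma weight_eq : M.weight π = Matrix.diagonal (M.pairDist π) := rfl

lemma pairMat_pow_succ_apply (m : ℕ) (z z' : S × A) :
    (M.pairMat π ^ (m + 1)) z z'
      = ∑ s, M.P z.1 z.2 s * ((M.stateMat π ^ m) s z'.1 * π z'.1 z'.2) := by
  induction m generalizing z with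
  | zero => simp [pairMat, Matrix.one_apply]
  | succ m ih =>
    rw [pow_succ', Matrix.mul_apply, sum_pairMat_mul]
    refine Finset.sum_congr rfl fun s _ => ?_
    rw [pow_succ' (M.stateMat π), Matrix.mul_apply]
    simp only [ih]
    simp only [Finset.sum_mul, mul_assoc]
    rw [sum_stateMat_mul]

lemma opF_apply (θ : S × A → ℝ) (z : S × A) :
    M.opF π θ z = M.pairDist π z * (θ - M.bellman π θ) z := by
  rw [opF, weight_eq, Matrix.mulVec_diagonal]

lemma meanOpFtilde_apply (hπ : ∀ s, π s ∈ stdSimplex ℝ A) (θ : S × A → ℝ) (α : ℕ)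
    (z₀ z : S × A) :
    M.meanOpFtilde π θ α z₀ z = (M.pairMat π ^ (α - 1)) z₀ z * (θ - M.bellman π θ) z := by
  have hrow := row_mem_stdSimplex (pairMat_mem_rowStochastic (M := M) hπ) z
  simp only [meanOpFtilde, opFtilde, Finset.sum_apply, Pi.smul_apply, smul_eq_mul]
  rw [Finset.sum_eq_single z (fun y _ hy => by simp [Pi.single_eq_of_ne' hy]) (by simp)]
  simp only [Pi.single_eq_same, mul_sub, Finset.sum_sub_distrib,
    sum_mul_const_of_mem_stdSimplex hrow, Pi.sub_apply, bellman, ← sum_pairMat_mul,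
    mul_left_comm _ M.γ, ← Finset.mul_sum]
  ring

lemma abs_sub_bellman_apply_le (hπ : ∀ s, π s ∈ stdSimplex ℝ A) (θ : S × A → ℝ) (z : S × A) :
    |(θ - M.bellman π θ) z| ≤ 2 * norm2 (θ - M.Q π) := by
  have happly := abs_apply_le_norm2 (θ - M.Q π)
  have hmean := abs_sum_mul_le_of_mem_stdSimplex
    (row_mem_stdSimplex (pairMat_mem_rowStochastic (M := M) hπ) z) happly
  rw [sub_bellman_apply hπ]
  refine (abs_sub _ _).trans ?_
  rw [abs_mul, abs_of_pos M.γ_pos, two_mul]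
  exact add_le_add (happly z)
    ((mul_le_of_le_one_left (abs_nonneg _) M.γ_lt_one.le).trans hmean)

lemma norm2_opF_sub_meanOpFtilde_le (hπ : ∀ s, π s ∈ stdSimplex ℝ A) {δ C ρ : ℝ} {m : ℕ}
    (hδ : ∀ z z', δ ≤ (M.pairMat π ^ m) z z') (hC : 0 ≤ C) (hρ : 0 < ρ)
    (hgeo : ∀ t : ℕ, (1 - δ) ^ (t / m) ≤ C * ρ ^ t) (θ : S × A → ℝ) (z₀ : S × A) {α : ℕ}
    (hα : 1 ≤ α) :
    norm2 (M.opF π θ - M.meanOpFtilde π θ α z₀)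
      ≤ √(Fintype.card (S × A)) * 2 * (C / ρ) * ρ ^ α * norm2 (θ - M.Q π) := by
  have : Nonempty S := ⟨z₀.1⟩
  have hnorm := norm2_nonneg (θ - M.Q π)
  refine (norm2_le_of_abs_le (b := C * ρ ^ (α - 1) * (2 * norm2 (θ - M.Q π))) (by positivity)
    fun z => ?_).trans_eq ?_
  · rw [Pi.sub_apply, opF_apply, meanOpFtilde_apply hπ, ← sub_mul, abs_mul]
    exact mul_le_mul ((abs_stationary_sub_pow_apply_le (pairMat_mem_rowStochastic hπ) hδ
      (pairDist_mem_stdSimplex hπ) (vecMul_pairDist hπ) (α - 1) z₀ z).trans (hgeo _))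
      (abs_sub_bellman_apply_le hπ θ z) (abs_nonneg _) (by positivity)
  · obtain ⟨b, rfl⟩ := Nat.exists_eq_add_of_le' hα
    simp only [Nat.add_sub_cancel, pow_succ]
    field_simp

lemma exists_forall_le_pairMat_pow (hfeas : ∀ π ∈ Pol, M.Feasible π) (hlow : 0 < πlow)
    (hrand : ∀ π ∈ Pol, ∀ s a, πlow ≤ π s a)
    (herg : ∀ π ∈ Pol, (M.stateMat π).IsPrimitive) :
    ∃ δ > 0, ∃ m : ℕ, m ≠ 0 ∧ ∀ π ∈ Pol, ∀ z z', δ ≤ (M.pairMat π ^ m) z z' := by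
  obtain ⟨δ, hδ, m, hle⟩ := exists_forall_le_stateMat_pow hfeas hlow hrand herg
  refine ⟨δ * πlow, mul_pos hδ hlow, m + 1, m.succ_ne_zero, fun π hπ z z' => ?_⟩
  rw [pairMat_pow_succ_apply,
    ← sum_mul_const_of_mem_stdSimplex (M.P_mem_stdSimplex z.1 z.2) (δ * _)]
  exact Finset.sum_le_sum fun s _ => mul_le_mul_of_nonneg_left
    (mul_le_mul (hle π hπ _ _) (hrand π hπ _ _) hlow.le (hδ.le.trans (hle π hπ _ _)))
    (M.P_nonneg _ _ _)

theorem exists_validConst [Nonempty S] [Nonempty A] {cbar hbar : ℝ}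
    (hc : ∀ s a, |M.c s a| ≤ cbar) (hh : ∀ s, ∀ p ∈ M.dom s, |M.h s p| ≤ hbar)
    (hfeas : ∀ π ∈ Pol, M.Feasible π) (hlow : 0 < πlow) (hrand : ∀ π ∈ Pol, ∀ s a, πlow ≤ π s a)
    (herg : ∀ π ∈ Pol, (M.stateMat π).IsPrimitive) : ∃ k : CTDConst, M.ValidConst Pol k := by
  have hγ1 : 0 < 1 - M.γ := by linarith [M.γ_lt_one]
  obtain ⟨δ', hδ', m, hm, hle⟩ := exists_forall_le_pairMat_pow hfeas hlow hrand herg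
  obtain ⟨δ, hδ0, hδ1, hδ⟩ :
      ∃ δ : ℝ, 0 < δ ∧ δ < 1 ∧ ∀ π ∈ Pol, ∀ z z', δ ≤ (M.pairMat π ^ m) z z' :=
    ⟨min δ' (1 / 2), lt_min hδ' (by norm_num), (min_le_right _ _).trans_lt (by norm_num),
      fun π hπ z z' => (min_le_left _ _).trans (hle π hπ z z')⟩
  obtain ⟨C, ρ, hC, hρ0, hρ1, hgeo⟩ :=
    exists_forall_pow_div_le_mul_pow (sub_pos.2 hδ1) (sub_lt_self 1 hδ0) hm
  have hsimplex := fun π hπ => (hfeas π hπ).mem_stdSimplex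
  exact ⟨⟨(1 - M.γ) * δ, 1 - M.γ, √(Fintype.card (S × A)) * 2 * (C / ρ), ρ, M.thetaBar cbar hbar⟩,
    { lamMin_pos := mul_pos hγ1 hδ0
      lamMin_le := fun π hπ => mul_le_mul_of_nonneg_left (le_minEig_diagonal
        (le_apply_of_vecMul_eq_self (pairDist_mem_stdSimplex (hsimplex π hπ))
          (vecMul_pairDist (hsimplex π hπ)) (hδ π hπ))) hγ1.le
      le_lamMax := fun π hπ => mul_le_of_le_one_right hγ1.le
        (maxEig_diagonal_le (le_one_of_mem_stdSimplex (pairDist_mem_stdSimplex (hsimplex π hπ))))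
      C_pos := by
        have := Fintype.card_pos (α := S × A)
        positivity
      ρ_pos := hρ0
      ρ_lt_one := hρ1
      mixing := fun π hπ θ z₀ α hα =>
        norm2_opF_sub_meanOpFtilde_le (hsimplex π hπ) (hδ π hπ) hC.le hρ0 hgeo θ z₀ hα
      norm_le := fun π hπ => norm2_Q_le_thetaBar hc hh (hfeas π hπ) }⟩

end RegMDP

namespace RegMDP

variable {S A : Type*} [Fintype S] [Fintype A] {M : RegMDP S A} {π : Policy S A}

/-- The linear part `diag(w) (I - γ P)` of the affine operator `F^π`, where `w` is the stationary
distribution and `P` the transition matrix of the state-action pairs. -/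
noncomputable def linF (M : RegMDP S A) (π : Policy S A) (x : S × A → ℝ) (z : S × A) : ℝ :=
  M.pairDist π z * (x z - M.γ * ∑ z', M.pairMat π z z' * x z')

/-- The adjoint of `M.linF π` for the standard inner product. -/
noncomputable def adjF (M : RegMDP S A) (π : Policy S A) (v : S × A → ℝ) (z : S × A) : ℝ :=
  M.pairDist π z * v z - M.γ * ∑ z', M.pairMat π z' z * (M.pairDist π z' * v z')

lemma opF_eq_linF [DecidableEq S] [DecidableEq A] (hπ : ∀ s, π s ∈ stdSimplex ℝ A)
    (θ : S × A → ℝ) : M.opF π θ = M.linF π (θ - M.Q π) := by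
  funext z
  rw [opF_apply, sub_bellman_apply hπ, linF]

lemma sum_linF_mul (x v : S × A → ℝ) :
    ∑ z, M.linF π x z * v z = ∑ z, x z * M.adjF π v z := by
  simp only [linF, adjF, mul_sub, sub_mul, Finset.sum_sub_distrib, Finset.mul_sum, Finset.sum_mul]
  rw [Finset.sum_comm (f := fun z z' => M.pairDist π z * (M.γ * (M.pairMat π z z' * x z')) * v z)]
  congr 1
  · exact Finset.sum_congr rfl fun _ _ => by ring
  · exact Finset.sum_congr rfl fun _ _ => Finset.sum_congr rfl fun _ _ => by ring

lemma sum_pairDist_mul_sq_le [Nonempty S] (hπ : ∀ s, π s ∈ stdSimplex ℝ A) (x : S × A → ℝ) :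
    ∑ z, M.pairDist π z * (∑ z', M.pairMat π z z' * x z') ^ 2
      ≤ ∑ z, M.pairDist π z * x z ^ 2 := by
  classical
  rw [← sum_mul_sum_mul_of_vecMul_eq_self (vecMul_pairDist hπ) fun z => x z ^ 2]
  exact Finset.sum_le_sum fun z _ => mul_le_mul_of_nonneg_left
    (sq_sum_mul_le_of_mem_stdSimplex (row_mem_stdSimplex (pairMat_mem_rowStochastic hπ) z) x)
    ((pairDist_mem_stdSimplex hπ).1 z)

lemma one_sub_mul_sum_pairDist_le_sum_linF_mul [Nonempty S] (hπ : ∀ s, π s ∈ stdSimplex ℝ A)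
    (x : S × A → ℝ) :
    (1 - M.γ) * ∑ z, M.pairDist π z * x z ^ 2 ≤ ∑ z, M.linF π x z * x z := by
  have hcontract := mul_le_mul_of_nonneg_left (sum_pairDist_mul_sq_le (M := M) hπ x)
    (half_pos M.γ_pos).le
  have hyoung : ∑ z, ((1 - M.γ / 2) * (M.pairDist π z * x z ^ 2)
      - M.γ / 2 * (M.pairDist π z * (∑ z', M.pairMat π z z' * x z') ^ 2))
      ≤ ∑ z, M.linF π x z * x z := by
    refine Finset.sum_le_sum fun z _ => ?_
    rw [linF]
    have hsq := mul_nonneg (mul_nonneg M.γ_pos.le ((pairDist_mem_stdSimplex (M := M) hπ).1 z))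
      (sq_nonneg (x z - ∑ z', M.pairMat π z z' * x z'))
    linear_combination hsq / 2
  rw [Finset.sum_sub_distrib, ← Finset.mul_sum, ← Finset.mul_sum] at hyoung
  linarith

lemma norm2_linF_le [Nonempty S] (hπ : ∀ s, π s ∈ stdSimplex ℝ A) (x : S × A → ℝ) :
    norm2 (M.linF π x) ≤ 2 * norm2 x := by
  have hw := pairDist_mem_stdSimplex (M := M) hπ
  have hpointwise : ∀ z, M.linF π x z ^ 2 ≤ 2 * (M.pairDist π z * x z ^ 2)
      + 2 * (M.pairDist π z * (∑ z', M.pairMat π z z' * x z') ^ 2) := fun z => by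
    set y := ∑ z', M.pairMat π z z' * x z'
    have hweight : M.pairDist π z ^ 2 ≤ M.pairDist π z :=
      pow_le_of_le_one (hw.1 z) (le_one_of_mem_stdSimplex hw z) two_ne_zero
    have hdisc : (M.γ * y) ^ 2 ≤ y ^ 2 := by
      rw [mul_pow]
      exact mul_le_of_le_one_left (sq_nonneg y) (pow_le_one₀ M.γ_pos.le M.γ_lt_one.le)
    have hdiff : (x z - M.γ * y) ^ 2 ≤ 2 * x z ^ 2 + 2 * y ^ 2 := by
      linarith [sq_nonneg (x z + M.γ * y)]
    calc M.linF π x z ^ 2 = M.pairDist π z ^ 2 * (x z - M.γ * y) ^ 2 := by rw [linF, mul_pow]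
      _ ≤ M.pairDist π z * (2 * x z ^ 2 + 2 * y ^ 2) :=
          mul_le_mul hweight hdiff (sq_nonneg _) (hw.1 z)
      _ = _ := by ring
  rw [norm2_le_iff (mul_nonneg zero_le_two (norm2_nonneg x))]
  calc ∑ z, M.linF π x z ^ 2
      ≤ 2 * ∑ z, M.pairDist π z * x z ^ 2
        + 2 * ∑ z, M.pairDist π z * (∑ z', M.pairMat π z z' * x z') ^ 2 := by
        rw [Finset.mul_sum, Finset.mul_sum, ← Finset.sum_add_distrib]
        exact Finset.sum_le_sum fun z _ => hpointwise z
    _ ≤ 4 * ∑ z, M.pairDist π z * x z ^ 2 := by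
        linarith [sum_pairDist_mul_sq_le (M := M) hπ x]
    _ ≤ 4 * norm2 x ^ 2 := mul_le_mul_of_nonneg_left
        (sum_mul_sq_le_norm2_sq_of_mem_stdSimplex hw x) (by norm_num)
    _ = _ := by ring

lemma norm2_adjF_le [Nonempty S] (hπ : ∀ s, π s ∈ stdSimplex ℝ A) (v : S × A → ℝ) :
    norm2 (M.adjF π v) ≤ 2 * norm2 v := by
  have hsq : norm2 (M.adjF π v) * norm2 (M.adjF π v)
      ≤ 2 * norm2 v * norm2 (M.adjF π v) :=
    calc norm2 (M.adjF π v) * norm2 (M.adjF π v)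
        = ∑ z, M.adjF π v z * M.adjF π v z := by simp only [← sq, norm2_sq]
      _ = ∑ z, M.linF π (M.adjF π v) z * v z := (sum_linF_mul _ _).symm
      _ ≤ norm2 (M.linF π (M.adjF π v)) * norm2 v := sum_mul_le_norm2_mul_norm2 _ _
      _ ≤ 2 * norm2 (M.adjF π v) * norm2 v :=
          mul_le_mul_of_nonneg_right (norm2_linF_le hπ _) (norm2_nonneg v)
      _ = _ := by ring
  rcases (norm2_nonneg (M.adjF π v)).eq_or_lt with hzero | hpos
  · rw [← hzero]
    exact mul_nonneg zero_le_two (norm2_nonneg v)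
  · exact le_of_mul_le_mul_right hsq hpos

/-- The expectation of a function of the last of `α ≥ 1` transitions started at `z₀`. -/
noncomputable def blockMean [DecidableEq S] [DecidableEq A] (M : RegMDP S A) (π : Policy S A)
    (α : ℕ) (z₀ : S × A) (G : S × A → S × A → ℝ) : ℝ :=
  ∑ z, (M.pairMat π ^ (α - 1)) z₀ z * ∑ z', M.pairMat π z z' * G z z'

lemma sum_pairMat_mul_norm2_opFtilde_sq_le [DecidableEq S] [DecidableEq A]
    (hπ : ∀ s, π s ∈ stdSimplex ℝ A) (θ : S × A → ℝ) (z : S × A) :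
    ∑ z', M.pairMat π z z' * norm2 (M.opFtilde π θ z z') ^ 2
      ≤ 2 * (1 + M.γ) ^ 2 * norm2 (θ - M.Q π) ^ 2 + 2 * norm2 (M.Q π) ^ 2 := by
  have hrow := row_mem_stdSimplex (pairMat_mem_rowStochastic (M := M) hπ) z
  set m := ∑ z', M.pairMat π z z' * M.Q π z'
  have hpointwise : ∀ z', norm2 (M.opFtilde π θ z z') ^ 2
      ≤ 2 * (1 + M.γ) ^ 2 * norm2 (θ - M.Q π) ^ 2 + 2 * (m - M.Q π z') ^ 2 := fun z' => by
    set e := (θ - M.Q π) z - M.γ * (θ - M.Q π) z' with he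
    have herr : θ z - M.runCost π z - M.γ * θ z' = e + M.γ * (m - M.Q π z') := by
      have hbellman := Q_eq_add (M := M) hπ z
      simp only [he, Pi.sub_apply]
      linarith
    have hbias : |e| ≤ (1 + M.γ) * norm2 (θ - M.Q π) := by
      refine (abs_sub _ _).trans ?_
      rw [abs_mul, abs_of_pos M.γ_pos, add_mul, one_mul]
      exact add_le_add (abs_apply_le_norm2 _ z)
        (mul_le_mul_of_nonneg_left (abs_apply_le_norm2 _ z') M.γ_pos.le)
    have hbias_sq := pow_le_pow_left₀ (abs_nonneg _) hbias 2
    have hdisc : (M.γ * (m - M.Q π z')) ^ 2 ≤ (m - M.Q π z') ^ 2 := by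
      rw [mul_pow]
      exact mul_le_of_le_one_left (sq_nonneg _) (pow_le_one₀ M.γ_pos.le M.γ_lt_one.le)
    rw [sq_abs, mul_pow] at hbias_sq
    rw [opFtilde, norm2_single, sq_abs, herr]
    linarith [sq_nonneg (e - M.γ * (m - M.Q π z'))]
  calc ∑ z', M.pairMat π z z' * norm2 (M.opFtilde π θ z z') ^ 2
      ≤ ∑ z', M.pairMat π z z' * (2 * (1 + M.γ) ^ 2 * norm2 (θ - M.Q π) ^ 2
          + 2 * (m - M.Q π z') ^ 2) :=
        Finset.sum_le_sum fun z' _ => mul_le_mul_of_nonneg_left (hpointwise z') (hrow.1 z')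
    _ = 2 * (1 + M.γ) ^ 2 * norm2 (θ - M.Q π) ^ 2
          + 2 * ∑ z', M.pairMat π z z' * (m - M.Q π z') ^ 2 := by
        simp only [mul_add _ (_ * _ : ℝ), Finset.sum_add_distrib,
          sum_mul_const_of_mem_stdSimplex hrow, mul_left_comm _ (2 : ℝ), ← Finset.mul_sum]
    _ ≤ _ := by
        linarith [sum_mul_sub_mean_sq_le_of_mem_stdSimplex hrow (M.Q π),
          sum_mul_sq_le_norm2_sq_of_mem_stdSimplex hrow (M.Q π)]

section BlockMean

variable [DecidableEq S] [DecidableEq A] (α : ℕ) (z₀ : S × A)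

lemma blockMean_const (hπ : ∀ s, π s ∈ stdSimplex ℝ A) (c : ℝ) :
    M.blockMean π α z₀ (fun _ _ => c) = c := by
  have hP := pairMat_mem_rowStochastic (M := M) hπ
  simp only [blockMean, sum_mul_const_of_mem_stdSimplex (row_mem_stdSimplex hP _),
    sum_mul_const_of_mem_stdSimplex (row_mem_stdSimplex (pow_mem hP _) _)]

lemma blockMean_add (G H : S × A → S × A → ℝ) :
    M.blockMean π α z₀ (fun z z' => G z z' + H z z')
      = M.blockMean π α z₀ G + M.blockMean π α z₀ H := by
  simp only [blockMean, mul_add, Finset.sum_add_distrib]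

lemma blockMean_const_mul (c : ℝ) (G : S × A → S × A → ℝ) :
    M.blockMean π α z₀ (fun z z' => c * G z z') = c * M.blockMean π α z₀ G := by
  simp only [blockMean, Finset.mul_sum, mul_left_comm]

lemma blockMean_opFtilde (θ v : S × A → ℝ) :
    M.blockMean π α z₀ (fun z z' => ∑ i, v i * M.opFtilde π θ z z' i)
      = ∑ i, v i * M.meanOpFtilde π θ α z₀ i := by
  simp only [blockMean, meanOpFtilde, Finset.sum_apply, Pi.smul_apply, smul_eq_mul,
    Finset.mul_sum]
  rw [Finset.sum_comm (s := Finset.univ (α := S × A)) (t := Finset.univ (α := S × A))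
    (f := fun i z => ∑ z', v i * ((M.pairMat π ^ (α - 1)) z₀ z *
      (M.pairMat π z z' * M.opFtilde π θ z z' i)))]
  refine Finset.sum_congr rfl fun z _ => ?_
  rw [Finset.sum_comm]
  exact Finset.sum_congr rfl fun _ _ => Finset.sum_congr rfl fun _ _ => by ring

variable {α z₀} {Pol : Set (Policy S A)} {k : CTDConst}

lemma ValidConst.lamMin_le_pairDist (hk : M.ValidConst Pol k) (hπ : π ∈ Pol) (z : S × A) :
    k.lamMin ≤ (1 - M.γ) * M.pairDist π z :=
  (hk.lamMin_le π hπ).trans (mul_le_mul_of_nonneg_left (minEig_diagonal_le z)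
    (by linarith [M.γ_lt_one]))

lemma ValidConst.lamMin_mul_norm2_sq_le [Nonempty S] (hk : M.ValidConst Pol k)
    (hPol : π ∈ Pol) (hπ : ∀ s, π s ∈ stdSimplex ℝ A) (x : S × A → ℝ) :
    k.lamMin * norm2 x ^ 2 ≤ ∑ z, M.linF π x z * x z := by
  refine le_trans ?_ (one_sub_mul_sum_pairDist_le_sum_linF_mul hπ x)
  rw [norm2_sq, Finset.mul_sum, Finset.mul_sum]
  refine Finset.sum_le_sum fun z _ => ?_
  rw [← mul_assoc]
  exact mul_le_mul_of_nonneg_right (hk.lamMin_le_pairDist hPol z) (sq_nonneg _)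

lemma ValidConst.norm2_sub_smul_adjF_sq_le [Nonempty S] (hk : M.ValidConst Pol k)
    (hPol : π ∈ Pol) (hπ : ∀ s, π s ∈ stdSimplex ℝ A) {β : ℝ} (hβ0 : 0 ≤ β) (hβ : 8 * β ≤ k.lamMin)
    (v : S × A → ℝ) :
    norm2 (v - β • M.adjF π v) ^ 2 ≤ (1 - 3 / 2 * (β * k.lamMin)) * norm2 v ^ 2 := by
  have hmono := hk.lamMin_mul_norm2_sq_le hPol hπ v
  have hbound := pow_le_pow_left₀ (norm2_nonneg _) (norm2_adjF_le (M := M) hπ v) 2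
  rw [sum_linF_mul] at hmono
  rw [norm2_sub_smul_sq]
  linear_combination 2 * β * hmono + β ^ 2 * hbound + β / 2 * norm2 v ^ 2 * hβ

lemma ValidConst.abs_bias_le (hk : M.ValidConst Pol k) (hPol : π ∈ Pol)
    (hπ : ∀ s, π s ∈ stdSimplex ℝ A) (hα : 1 ≤ α) (θ v : S × A → ℝ) :
    |∑ z, M.linF π (θ - M.Q π) z * v z
      - M.blockMean π α z₀ (fun z z' => ∑ i, v i * M.opFtilde π θ z z' i)|
      ≤ k.C * k.ρ ^ α * norm2 (θ - M.Q π) * norm2 v := by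
  have hcauchy := abs_sum_mul_le_norm2_mul_norm2 (M.opF π θ - M.meanOpFtilde π θ α z₀) v
  simp only [Pi.sub_apply, sub_mul, Finset.sum_sub_distrib] at hcauchy
  rw [blockMean_opFtilde, ← opF_eq_linF hπ]
  simp only [mul_comm (v _)]
  exact hcauchy.trans
    (mul_le_mul_of_nonneg_right (hk.mixing π hPol θ z₀ α hα) (norm2_nonneg v))

lemma ValidConst.blockMean_step_le (hk : M.ValidConst Pol k) (hPol : π ∈ Pol)
    (hπ : ∀ s, π s ∈ stdSimplex ℝ A) (hα : 1 ≤ α) {β : ℝ} (hβ : 0 ≤ β) (θ v : S × A → ℝ) :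
    M.blockMean π α z₀ (fun z z' => ∑ i, (θ - β • M.opFtilde π θ z z' - M.Q π) i * v i)
      ≤ ∑ i, (θ - M.Q π) i * (v - β • M.adjF π v) i
        + β * (k.C * k.ρ ^ α) * norm2 (θ - M.Q π) * norm2 v := by
  have hbias := (abs_le.1 (hk.abs_bias_le hPol hπ hα (z₀ := z₀) θ v)).2
  have hstep : (fun z z' => ∑ i, (θ - β • M.opFtilde π θ z z' - M.Q π) i * v i)
      = fun z z' => ∑ i, (θ - M.Q π) i * v i
        + -β * ∑ i, v i * M.opFtilde π θ z z' i := by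
    funext z z'
    rw [Finset.mul_sum, ← Finset.sum_add_distrib]
    exact Finset.sum_congr rfl fun i _ => by
      simp only [Pi.sub_apply, Pi.smul_apply, smul_eq_mul]; ring
  have hadj : ∑ i, (θ - M.Q π) i * (v - β • M.adjF π v) i
      = ∑ i, (θ - M.Q π) i * v i - β * ∑ i, M.linF π (θ - M.Q π) i * v i := by
    simp only [sum_linF_mul, Pi.sub_apply, Pi.smul_apply, smul_eq_mul, mul_sub,
      Finset.sum_sub_distrib, Finset.mul_sum, mul_left_comm β]
  rw [hstep, blockMean_add, blockMean_const _ _ hπ, blockMean_const_mul, hadj]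
  linear_combination β * hbias

lemma blockMean_norm2_opFtilde_sq_le (hπ : ∀ s, π s ∈ stdSimplex ℝ A) (θ : S × A → ℝ) :
    M.blockMean π α z₀ (fun z z' => norm2 (M.opFtilde π θ z z') ^ 2)
      ≤ 2 * (1 + M.γ) ^ 2 * norm2 (θ - M.Q π) ^ 2 + 2 * norm2 (M.Q π) ^ 2 :=
  sum_mul_le_of_mem_stdSimplex
    (row_mem_stdSimplex (pow_mem (pairMat_mem_rowStochastic hπ) _) z₀)
    (sum_pairMat_mul_norm2_opFtilde_sq_le hπ θ)

lemma ValidConst.blockMean_norm2_step_sq_le (hk : M.ValidConst Pol k) (hPol : π ∈ Pol)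
    (hπ : ∀ s, π s ∈ stdSimplex ℝ A) (hα : 1 ≤ α) (hmix : k.C * k.ρ ^ α ≤ k.lamMin / 9) {β : ℝ}
    (hβ0 : 0 ≤ β) (hβ : 8 * (1 + M.γ) ^ 2 * β ≤ k.lamMin) (θ : S × A → ℝ) :
    M.blockMean π α z₀ (fun z z' => norm2 (θ - β • M.opFtilde π θ z z' - M.Q π) ^ 2)
      ≤ (1 - 3 / 2 * (β * k.lamMin)) * norm2 (θ - M.Q π) ^ 2 + 2 * β ^ 2 * k.B ^ 2 := by
  have : Nonempty S := ⟨z₀.1⟩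
  set x := θ - M.Q π
  have hstep : (fun z z' => norm2 (θ - β • M.opFtilde π θ z z' - M.Q π) ^ 2)
      = fun z z' => (norm2 x ^ 2 + -(2 * β) * ∑ i, x i * M.opFtilde π θ z z' i)
        + β ^ 2 * norm2 (M.opFtilde π θ z z') ^ 2 := by
    funext z z'
    rw [sub_right_comm, norm2_sub_smul_sq]
    ring
  have hdrift : (k.lamMin - k.lamMin / 9) * norm2 x ^ 2
      ≤ M.blockMean π α z₀ (fun z z' => ∑ i, x i * M.opFtilde π θ z z' i) := by
    have hbias := (abs_le.1 (hk.abs_bias_le hPol hπ hα (z₀ := z₀) θ x)).2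
    have hmono := hk.lamMin_mul_norm2_sq_le hPol hπ x
    linear_combination hbias + hmono + norm2 x ^ 2 * hmix
  have hvar := blockMean_norm2_opFtilde_sq_le (M := M) (α := α) (z₀ := z₀) hπ θ
  have hB := pow_le_pow_left₀ (norm2_nonneg _) (hk.norm_le π hPol) 2
  have hslack := mul_nonneg (mul_nonneg hβ0 hk.lamMin_pos.le) (sq_nonneg (norm2 x))
  rw [hstep, blockMean_add, blockMean_add, blockMean_const _ _ hπ, blockMean_const_mul,
    blockMean_const_mul]
  linear_combination 2 * β * hdrift + β ^ 2 * hvar + 2 * β ^ 2 * hB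
    + β / 4 * norm2 x ^ 2 * hβ + hslack / 36

end BlockMean

end RegMDP

section Path

lemma exists_bound_of_dependsOn {E : Type*} [Finite E] {n : ℕ} {G : (ℕ → E) → ℝ}
    (hG : DependsOn G (Set.Iic n)) : ∃ C, ∀ p, ‖G p‖ ≤ C := by
  obtain ⟨g, rfl⟩ := dependsOn_iff_exists_comp.1 hG
  obtain ⟨C, hC⟩ := (Set.finite_range fun q => ‖g q‖).bddAbove
  exact ⟨C, fun p => hC ⟨_, rfl⟩⟩

lemma integral_mul_indicator_of_condExp_ae_eq {Ω : Type*} {m mΩ : MeasurableSpace Ω}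
    {Pr : Measure Ω} [IsFiniteMeasure Pr] (hm : m ≤ mΩ) {G κ : Ω → ℝ}
    (hG : StronglyMeasurable[m] G) {C : ℝ} (hC : ∀ ω, ‖G ω‖ ≤ C) {s : Set Ω}
    (hs : MeasurableSet s) (hκ : Pr⟦s | m⟧ =ᵐ[Pr] κ) :
    ∫ ω, G ω * s.indicator (fun _ => 1) ω ∂Pr = ∫ ω, G ω * κ ω ∂Pr := by
  have hint : Integrable (s.indicator fun _ => (1 : ℝ)) Pr := (integrable_const _).indicator hs
  have hpull := condExp_stronglyMeasurable_mul_of_bound hm hG hint C (ae_of_all _ hC)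
  refine (integral_condExp hm).symm.trans (integral_congr_ae ?_)
  filter_upwards [hpull, hκ] with ω hpullω hκω
  exact hpullω.trans (congrArg (G ω * ·) hκω)

variable {S A Ω : Type*} {mΩ : MeasurableSpace Ω} {Pr : Measure Ω} {Z : ℕ → Ω → S × A} {n : ℕ}

lemma history_le (hZ : ∀ n, @Measurable Ω (S × A) _ ⊤ (Z n)) (n : ℕ) :
    RegMDP.history Z n ≤ mΩ :=
  iSup₂_le fun i _ => (hZ i).comap_le

variable [Finite S] [Finite A]

lemma measurable_history_of_dependsOn {G : (ℕ → S × A) → ℝ} (hG : DependsOn G (Set.Iic n)) :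
    Measurable[RegMDP.history Z n] fun ω => G fun i => Z i ω := by
  let _ : MeasurableSpace (S × A) := ⊤
  have : DiscreteMeasurableSpace (S × A) := ⟨fun _ => trivial⟩
  obtain ⟨g, rfl⟩ := dependsOn_iff_exists_comp.1 hG
  refine @Measurable.comp Ω _ ℝ (RegMDP.history Z n) _ _ g _ (measurable_of_finite g)
    (@measurable_pi_lambda _ _ _ (RegMDP.history Z n) _ _ fun i => ?_)
  exact (comap_measurable (Z i.1)).mono
    (le_iSup₂_of_le (f := fun i (_ : i ∈ Finset.range (n + 1)) => MeasurableSpace.comap (Z i) ⊤)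
      i.1 (Finset.mem_range.2 (Nat.lt_succ_of_le i.2)) le_rfl) le_rfl

lemma integrable_of_dependsOn [IsFiniteMeasure Pr]
    (hZ : ∀ n, @Measurable Ω (S × A) _ ⊤ (Z n)) {G : (ℕ → S × A) → ℝ}
    (hG : DependsOn G (Set.Iic n)) : Integrable (fun ω => G fun i => Z i ω) Pr := by
  obtain ⟨C, hC⟩ := exists_bound_of_dependsOn hG
  exact Integrable.of_bound
    ((measurable_history_of_dependsOn hG).mono (history_le hZ n) le_rfl).aestronglyMeasurable
    C (ae_of_all _ fun ω => hC _)

end Path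

namespace RegMDP

variable {S A : Type*} [Fintype S] [Fintype A] {M : RegMDP S A} {Ω : Type*}
  {mΩ : MeasurableSpace Ω} {Pr : Measure Ω} {Z : ℕ → Ω → S × A}
  {Φ : (ℕ → S × A) → Policy S A} {n₀ n₁ : ℕ}

/-- From time `n₀` to time `n₁` the trajectory `Z` follows the policy `Φ`, which is a function
of the trajectory up to time `n₀`. -/
structure Follows (M : RegMDP S A) {Ω : Type*} {mΩ : MeasurableSpace Ω} (Pr : Measure Ω)
    (Z : ℕ → Ω → S × A) (Φ : (ℕ → S × A) → Policy S A) (n₀ n₁ : ℕ) : Prop where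
  meas : ∀ n, @Measurable Ω (S × A) _ ⊤ (Z n)
  past : DependsOn Φ (Set.Iic n₀)
  markov : ∀ n, n₀ ≤ n → n < n₁ → ∀ z' : S × A, Pr⟦Z (n + 1) ⁻¹' {z'} | history Z n⟧ =ᵐ[Pr]
    fun ω => M.pairMat (Φ fun i => Z i ω) (Z n ω) z'

lemma Follows.integral_step [IsFiniteMeasure Pr] (h : M.Follows Pr Z Φ n₀ n₁) {n : ℕ}
    (h₀ : n₀ ≤ n) (h₁ : n < n₁) {G : S × A → (ℕ → S × A) → ℝ}
    (hG : ∀ z, DependsOn (G z) (Set.Iic n)) :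
    ∫ ω, G (Z (n + 1) ω) (fun i => Z i ω) ∂Pr
      = ∫ ω, ∑ z, M.pairMat (Φ fun i => Z i ω) (Z n ω) z * G z (fun i => Z i ω) ∂Pr := by
  have hsplit : ∀ ω, G (Z (n + 1) ω) (fun i => Z i ω)
      = ∑ z, G z (fun i => Z i ω) * (Z (n + 1) ⁻¹' {z}).indicator (fun _ => 1) ω := fun ω => by
    classical
    simp [Set.indicator_apply]
  have hmean : ∀ z, ∫ ω, G z (fun i => Z i ω) * (Z (n + 1) ⁻¹' {z}).indicator (fun _ => 1) ω ∂Pr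
      = ∫ ω, M.pairMat (Φ fun i => Z i ω) (Z n ω) z * G z (fun i => Z i ω) ∂Pr := fun z => by
    obtain ⟨C, hC⟩ := exists_bound_of_dependsOn (hG z)
    simp only [mul_comm (M.pairMat _ _ _)]
    exact integral_mul_indicator_of_condExp_ae_eq (history_le h.meas n)
      (measurable_history_of_dependsOn (hG z)).stronglyMeasurable (fun ω => hC _)
      (h.meas (n + 1) trivial) (h.markov n h₀ h₁ z)
  simp only [hsplit]
  rw [integral_finsetSum, integral_finsetSum]
  · exact Finset.sum_congr rfl fun z _ => hmean z
  · intro z _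
    refine integrable_of_dependsOn (n := n) (G := fun p => M.pairMat (Φ p) (p n) z * G z p) h.meas
      fun p q hpq => ?_
    simp only [hG z hpq, hpq n (Set.mem_Iic.2 le_rfl), h.past fun i hi => hpq i (le_trans hi h₀)]
  · intro z _
    refine integrable_of_dependsOn (n := n + 1)
      (G := fun p => G z p * ({z} : Set (S × A)).indicator (fun _ => 1) (p (n + 1))) h.meas
      fun p q hpq => ?_
    simp only [hpq (n + 1) (Set.mem_Iic.2 le_rfl),
      hG z fun i hi => hpq i (le_trans hi (Nat.le_succ n))]

variable [DecidableEq S] [DecidableEq A]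

lemma Follows.integral_steps [IsFiniteMeasure Pr] (h : M.Follows Pr Z Φ n₀ n₁) {n m : ℕ}
    (h₀ : n₀ ≤ n) (h₁ : n + m ≤ n₁) {G : S × A → (ℕ → S × A) → ℝ}
    (hG : ∀ z, DependsOn (G z) (Set.Iic n)) :
    ∫ ω, G (Z (n + m) ω) (fun i => Z i ω) ∂Pr
      = ∫ ω, ∑ z, (M.pairMat (Φ fun i => Z i ω) ^ m) (Z n ω) z * G z (fun i => Z i ω) ∂Pr := by
  induction m generalizing G with
  | zero => simp [Matrix.one_apply]
  | succ m ih =>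
    rw [← add_assoc, h.integral_step (n := n + m) (by omega) (by omega)
      (fun z p q hpq => hG z fun i hi => hpq i (le_trans hi (Nat.le_add_right n m)))]
    rw [ih (G := fun z p => ∑ z', M.pairMat (Φ p) z z' * G z' p) (by omega) (fun z p q hpq => by
      simp only [hG _ hpq, h.past fun i hi => hpq i (le_trans hi h₀)])]
    refine integral_congr_ae (ae_of_all _ fun ω => ?_)
    simp only [pow_succ, Matrix.mul_apply, Finset.sum_mul, Finset.mul_sum]
    rw [Finset.sum_comm]
    exact Finset.sum_congr rfl fun _ _ => Finset.sum_congr rfl fun _ _ => by ring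

lemma Follows.integral_block [IsFiniteMeasure Pr] (h : M.Follows Pr Z Φ n₀ n₁) {n α : ℕ}
    (hα : 1 ≤ α) (h₀ : n₀ ≤ n) (h₁ : n + α ≤ n₁) {G : S × A → S × A → (ℕ → S × A) → ℝ}
    (hG : ∀ z z', DependsOn (G z z') (Set.Iic n)) :
    ∫ ω, G (Z (n + α - 1) ω) (Z (n + α) ω) (fun i => Z i ω) ∂Pr
      = ∫ ω, M.blockMean (Φ fun i => Z i ω) α (Z n ω) (fun z z' => G z z' fun i => Z i ω) ∂Pr := by
  obtain ⟨b, rfl⟩ := Nat.exists_eq_add_of_le' hα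
  simp only [← add_assoc, Nat.add_sub_cancel]
  rw [h.integral_step (n := n + b) (G := fun z' p => G (p (n + b)) z' p) (by omega) (by omega)
    (fun z p q hpq => by
      simp only [hpq (n + b) (Set.mem_Iic.2 le_rfl)]
      exact hG _ _ fun i hi => hpq i (le_trans hi (Nat.le_add_right n b)))]
  rw [h.integral_steps (n := n) (m := b)
    (G := fun z p => ∑ z', M.pairMat (Φ p) z z' * G z z' p) h₀ (by omega) (fun z p q hpq => by
      simp only [hG _ _ hpq, h.past fun i hi => hpq i (le_trans hi h₀)])]
  rfl

/-- The error of the conditional temporal difference iterate `θ_{t+1}`, as a function of the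
trajectory. -/
noncomputable def ctdErr (M : RegMDP S A) (Φ : (ℕ → S × A) → Policy S A) (α : ℕ) (β : ℕ → ℝ)
    (n₀ t : ℕ) (p : ℕ → S × A) : S × A → ℝ :=
  M.ctd (Φ p) α β p n₀ t - M.Q (Φ p)

lemma dependsOn_ctd (hΦ : DependsOn Φ (Set.Iic n₀)) (α : ℕ) (β : ℕ → ℝ) (t : ℕ) :
    DependsOn (fun p => M.ctd (Φ p) α β p n₀ t) (Set.Iic (n₀ + t * α)) := by
  induction t with
  | zero => exact fun _ _ _ => rfl
  | succ t ih =>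
    intro p q hpq
    have hle : n₀ + t * α ≤ n₀ + (t + 1) * α := by gcongr; exact Nat.le_succ t
    have hstep : M.ctd (Φ p) α β p n₀ t = M.ctd (Φ q) α β q n₀ t :=
      ih fun i hi => hpq i (le_trans hi hle)
    have hpol : Φ p = Φ q := hΦ fun i hi => hpq i (le_trans hi (Nat.le_add_right _ _))
    simp only [ctd, hstep]
    rw [hpol, hpq _ (Set.mem_Iic.2 le_rfl), hpq _ (Set.mem_Iic.2 (Nat.sub_le _ _))]

lemma dependsOn_ctdErr (hΦ : DependsOn Φ (Set.Iic n₀)) (α : ℕ) (β : ℕ → ℝ) (t : ℕ) :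
    DependsOn (M.ctdErr Φ α β n₀ t) (Set.Iic (n₀ + t * α)) := fun _ _ h =>
  congrArg₂ (· - ·) (dependsOn_ctd hΦ α β t h)
    (congrArg M.Q (hΦ fun i hi => h i (le_trans hi (Nat.le_add_right _ _))))

lemma Follows.integral_ctdErr_succ_le [IsFiniteMeasure Pr] (h : M.Follows Pr Z Φ n₀ n₁) {α : ℕ}
    (hα : 1 ≤ α) {β : ℕ → ℝ} {t : ℕ} (ht : n₀ + (t + 1) * α ≤ n₁)
    {Ψ : (ℕ → S × A) → (S × A → ℝ) → ℝ} (hΨ : DependsOn Ψ (Set.Iic n₀)) {b : (ℕ → S × A) → ℝ}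
    (hb : DependsOn b (Set.Iic (n₀ + t * α)))
    (hle : ∀ p, M.blockMean (Φ p) α (p (n₀ + t * α)) (fun z z' => Ψ p (M.ctd (Φ p) α β p n₀ t
      - β (t + 1) • M.opFtilde (Φ p) (M.ctd (Φ p) α β p n₀ t) z z' - M.Q (Φ p))) ≤ b p) :
    ∫ ω, Ψ (fun i => Z i ω) (M.ctdErr Φ α β n₀ (t + 1) fun i => Z i ω) ∂Pr
      ≤ ∫ ω, b (fun i => Z i ω) ∂Pr := by
  have hadd : n₀ + (t + 1) * α = n₀ + t * α + α := by ring
  set G : S × A → S × A → (ℕ → S × A) → ℝ := fun z z' p => Ψ p (M.ctd (Φ p) α β p n₀ t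
      - β (t + 1) • M.opFtilde (Φ p) (M.ctd (Φ p) α β p n₀ t) z z' - M.Q (Φ p)) with hGdef
  have hG : ∀ z z', DependsOn (G z z') (Set.Iic (n₀ + t * α)) := fun z z' p q hpq => by
    have hiter : M.ctd (Φ p) α β p n₀ t = M.ctd (Φ q) α β q n₀ t := dependsOn_ctd h.past α β t hpq
    have hpast : ∀ i ∈ Set.Iic n₀, p i = q i := fun i hi =>
      hpq i (le_trans hi (Nat.le_add_right _ _))
    simp only [hGdef, hiter]
    rw [h.past hpast, hΨ hpast]
  calc ∫ ω, Ψ (fun i => Z i ω) (M.ctdErr Φ α β n₀ (t + 1) fun i => Z i ω) ∂Pr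
      = ∫ ω, G (Z (n₀ + t * α + α - 1) ω) (Z (n₀ + t * α + α) ω) (fun i => Z i ω) ∂Pr := by
        simp only [ctdErr, ctd, hadd, hGdef]
    _ = ∫ ω, M.blockMean (Φ fun i => Z i ω) α (Z (n₀ + t * α) ω)
          (fun z z' => G z z' fun i => Z i ω) ∂Pr :=
        h.integral_block hα (Nat.le_add_right _ _) (hadd ▸ ht) hG
    _ ≤ _ := by
        refine integral_mono ?_ (integrable_of_dependsOn h.meas hb) fun ω => hle _
        refine integrable_of_dependsOn (n := n₀ + t * α) (G := fun p => M.blockMean (Φ p) α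
          (p (n₀ + t * α)) fun z z' => G z z' p) h.meas fun p q hpq => ?_
        simp only [hG _ _ hpq, hpq (n₀ + t * α) (Set.mem_Iic.2 le_rfl),
          h.past fun i hi => hpq i (le_trans hi (Nat.le_add_right _ _))]

variable {Pol : Set (Policy S A)} {k : CTDConst}

lemma Follows.integral_norm2_ctdErr_succ_sq_le [IsProbabilityMeasure Pr]
    (h : M.Follows Pr Z Φ n₀ n₁) (hk : M.ValidConst Pol k) (hΦ : ∀ p, Φ p ∈ Pol)
    (hfeas : ∀ π ∈ Pol, M.Feasible π) {α : ℕ} (hα : 1 ≤ α) (hmix : k.C * k.ρ ^ α ≤ k.lamMin / 9)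
    {β : ℕ → ℝ} {t : ℕ} (hβ0 : 0 ≤ β (t + 1)) (hβ : 8 * (1 + M.γ) ^ 2 * β (t + 1) ≤ k.lamMin)
    (ht : n₀ + (t + 1) * α ≤ n₁) :
    ∫ ω, norm2 (M.ctdErr Φ α β n₀ (t + 1) fun i => Z i ω) ^ 2 ∂Pr
      ≤ (1 - 3 / 2 * (β (t + 1) * k.lamMin))
        * ∫ ω, norm2 (M.ctdErr Φ α β n₀ t fun i => Z i ω) ^ 2 ∂Pr
        + 2 * β (t + 1) ^ 2 * k.B ^ 2 := by
  have hsq : DependsOn (fun p => norm2 (M.ctdErr Φ α β n₀ t p) ^ 2) (Set.Iic (n₀ + t * α)) :=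
    fun p q hpq => by simp only [dependsOn_ctdErr h.past α β t hpq]
  refine (h.integral_ctdErr_succ_le hα ht (Ψ := fun _ x => norm2 x ^ 2) (fun _ _ _ => rfl)
    (b := fun p => (1 - 3 / 2 * (β (t + 1) * k.lamMin)) * norm2 (M.ctdErr Φ α β n₀ t p) ^ 2
      + 2 * β (t + 1) ^ 2 * k.B ^ 2) (fun p q hpq => by simp only [hsq hpq]) fun p =>
    hk.blockMean_norm2_step_sq_le (hΦ p) (hfeas _ (hΦ p)).mem_stdSimplex hα hmix hβ0 hβ _).trans_eq
    ?_
  rw [integral_add ((integrable_of_dependsOn h.meas hsq).const_mul _) (integrable_const _),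
    integral_const_mul, integral_const, probReal_univ, one_smul]

lemma Follows.integral_sum_ctdErr_succ_mul_le [IsFiniteMeasure Pr]
    (h : M.Follows Pr Z Φ n₀ n₁) (hk : M.ValidConst Pol k) (hΦ : ∀ p, Φ p ∈ Pol)
    (hfeas : ∀ π ∈ Pol, M.Feasible π) {α : ℕ} (hα : 1 ≤ α) {β : ℕ → ℝ} {t : ℕ}
    (hβ0 : 0 ≤ β (t + 1)) (ht : n₀ + (t + 1) * α ≤ n₁) {u : (ℕ → S × A) → S × A → ℝ}
    (hu : DependsOn u (Set.Iic n₀)) {c : ℝ} (hc : ∀ p, norm2 (u p) ≤ c) :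
    ∫ ω, ∑ i, (M.ctdErr Φ α β n₀ (t + 1) fun i => Z i ω) i * u (fun i => Z i ω) i ∂Pr
      ≤ ∫ ω, ∑ i, (M.ctdErr Φ α β n₀ t fun i => Z i ω) i
          * (u (fun i => Z i ω) - β (t + 1) • M.adjF (Φ fun i => Z i ω) (u fun i => Z i ω)) i ∂Pr
        + β (t + 1) * (k.C * k.ρ ^ α) * c
          * ∫ ω, norm2 (M.ctdErr Φ α β n₀ t fun i => Z i ω) ∂Pr := by
  have herr := dependsOn_ctdErr (M := M) h.past α β t
  have hnorm : DependsOn (fun p => norm2 (M.ctdErr Φ α β n₀ t p)) (Set.Iic (n₀ + t * α)) :=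
    fun p q hpq => by simp only [herr hpq]
  have hlin : DependsOn (fun p => ∑ i, M.ctdErr Φ α β n₀ t p i
      * (u p - β (t + 1) • M.adjF (Φ p) (u p)) i) (Set.Iic (n₀ + t * α)) := fun p q hpq => by
    have hpast : ∀ i ∈ Set.Iic n₀, p i = q i := fun i hi =>
      hpq i (le_trans hi (Nat.le_add_right _ _))
    simp only [herr hpq, h.past hpast, hu hpast]
  have hcoef := mul_nonneg hβ0 (mul_nonneg hk.C_pos.le (pow_nonneg hk.ρ_pos.le α))
  refine (h.integral_ctdErr_succ_le hα ht (Ψ := fun p x => ∑ i, x i * u p i)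
    (fun p q hpq => by simp only [hu hpq]) (b := fun p => ∑ i, M.ctdErr Φ α β n₀ t p i
      * (u p - β (t + 1) • M.adjF (Φ p) (u p)) i
      + β (t + 1) * (k.C * k.ρ ^ α) * c * norm2 (M.ctdErr Φ α β n₀ t p))
    (fun p q hpq => congrArg₂ (· + ·) (hlin hpq) (congrArg _ (hnorm hpq))) fun p => ?_).trans_eq ?_
  · refine (hk.blockMean_step_le (hΦ p) (hfeas _ (hΦ p)).mem_stdSimplex hα hβ0 _ _).trans
      (add_le_add le_rfl ?_)
    rw [mul_right_comm]
    exact mul_le_mul_of_nonneg_right (mul_le_mul_of_nonneg_left (hc p) hcoef) (norm2_nonneg _)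
  · rw [integral_add (integrable_of_dependsOn h.meas hlin)
      ((integrable_of_dependsOn h.meas hnorm).const_mul _), integral_const_mul]

end RegMDP

section Recursion

lemma mul_mul_le_of_recursion_le {a : ℕ → ℝ} {t₀ D : ℝ} {T : ℕ} (ht₀ : 1 ≤ t₀) (hD : 0 ≤ D)
    (ha : ∀ t, 0 ≤ a t)
    (h : ∀ t < T, a (t + 1) ≤ (1 - 3 / (t + t₀)) * a t + D / (t + t₀) ^ 2) {t : ℕ} (ht : t ≤ T) :
    (t + t₀ - 1) * (t + t₀ - 2) * a t ≤ (t₀ - 1) * (t₀ - 2) * a 0 + D * t := by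
  induction t with
  | zero => simp
  | succ t ih =>
    have hτ : 1 ≤ t + t₀ := le_add_of_nonneg_of_le t.cast_nonneg ht₀
    set τ : ℝ := t + t₀
    have hτ0 : τ ≠ 0 := by linarith
    have hratio : (τ - 1) / τ ≤ 1 := by rw [div_le_one (by linarith)]; linarith
    have hstep : τ * (τ - 1) * a (t + 1) ≤ (τ - 1) * (τ - 3) * a t + D * ((τ - 1) / τ) := calc
      _ ≤ τ * (τ - 1) * ((1 - 3 / τ) * a t + D / τ ^ 2) :=
        mul_le_mul_of_nonneg_left (h t ht) (mul_nonneg (by linarith) (by linarith))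
      _ = _ := by field_simp
    push_cast
    linear_combination hstep + ih (by omega) + D * hratio + (τ - 1) * ha t

lemma le_of_recursion_le {a : ℕ → ℝ} {t₀ D R : ℝ} {T : ℕ} (ht₀ : 3 ≤ t₀) (hD : D ≤ 3 * t₀ * R)
    (hR : 0 ≤ R) (h0 : a 0 ≤ R)
    (h : ∀ t < T, a (t + 1) ≤ (1 - 3 / (t + t₀)) * a t + D / (t + t₀) ^ 2) {t : ℕ} (ht : t ≤ T) :
    a t ≤ R := by
  induction t with
  | zero => exact h0
  | succ t ih =>
    have hτ : t₀ ≤ t + t₀ := le_add_of_nonneg_left t.cast_nonneg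
    set τ : ℝ := t + t₀
    have hcontract : 0 ≤ 1 - 3 / τ := by rw [sub_nonneg, div_le_one] <;> linarith
    have hD' : D / τ ^ 2 ≤ 3 / τ * R := by
      rw [div_mul_eq_mul_div, div_le_div_iff₀ (by positivity) (by linarith)]
      linear_combination τ * hD + 3 * R * τ * hτ
    linear_combination h t ht + hD' + (1 - 3 / τ) * ih (by omega)

/-- The decay factor `∏_{i < t} √(1 - 3 / (i + t₀))` of the norm of the test vector when the
adjoint of conditional temporal difference is iterated. -/
noncomputable def decay (t₀ : ℝ) (t : ℕ) : ℝ := ∏ i ∈ Finset.range t, √(1 - 3 / (i + t₀))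

lemma decay_zero (t₀ : ℝ) : decay t₀ 0 = 1 := Finset.prod_range_zero _

lemma decay_succ (t₀ : ℝ) (t : ℕ) : decay t₀ (t + 1) = decay t₀ t * √(1 - 3 / (t + t₀)) :=
  Finset.prod_range_succ _ _

lemma decay_sq_mul {t₀ : ℝ} (ht₀ : 3 ≤ t₀) (t : ℕ) :
    decay t₀ t ^ 2 * ((t + t₀ - 1) * (t + t₀ - 2) * (t + t₀ - 3))
      = (t₀ - 1) * (t₀ - 2) * (t₀ - 3) := by
  induction t with
  | zero => simp [decay_zero]
  | succ t ih =>
    have : 3 ≤ t + t₀ := le_add_of_nonneg_of_le t.cast_nonneg ht₀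
    have : t + t₀ ≠ 0 := by linarith
    have hcontract : 0 ≤ 1 - 3 / (t + t₀) := by rw [sub_nonneg, div_le_one] <;> linarith
    rw [← ih, decay_succ, mul_pow, Real.sq_sqrt hcontract]
    push_cast
    field_simp
    ring

lemma decay_mul_le_one {t₀ x : ℝ} (ht₀ : 3 < t₀) {t : ℕ} (hx : t₀ ^ 3 * x ^ 2 ≤ t ^ 3) :
    decay t₀ t * x ≤ 1 := by
  have : (0 : ℝ) ≤ t := t.cast_nonneg
  have h1 : 0 < t + t₀ - 1 := by linarith
  have h2 : 0 < t + t₀ - 2 := by linarith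
  have h3 : 0 < t + t₀ - 3 := by linarith
  refine le_of_sq_le_sq (le_of_mul_le_mul_left ?_ (mul_pos (mul_pos h1 h2) h3)) zero_le_one
  calc (t + t₀ - 1) * (t + t₀ - 2) * (t + t₀ - 3) * (decay t₀ t * x) ^ 2
      = (t₀ - 1) * (t₀ - 2) * (t₀ - 3) * x ^ 2 := by rw [← decay_sq_mul ht₀.le t]; ring
    _ ≤ t₀ * t₀ * t₀ * x ^ 2 := by gcongr <;> linarith
    _ ≤ t * t * t := by linear_combination hx
    _ ≤ (t + t₀ - 1) * (t + t₀ - 2) * (t + t₀ - 3) * 1 ^ 2 := by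
        rw [one_pow, mul_one]
        gcongr <;> linarith

lemma sqrt_mul_add_le {u c d r : ℝ} (hu : u ≤ 1) (hc : 0 ≤ c) (hr : 0 ≤ r) :
    √(1 - u) * c * (d + 4 / 3 * r) + c * (2 / 3 * u * r) ≤ c * (d * √(1 - u) + 4 / 3 * r) := by
  have hsqrt : √(1 - u) ≤ 1 - u / 2 := by
    simpa only [← sub_eq_add_neg, neg_div] using Real.sqrt_one_add_le (neg_le_neg hu)
  linear_combination 4 / 3 * c * r * hsqrt

end Recursion

namespace RegMDP

variable {S A : Type*} [Fintype S] [Fintype A] {M : RegMDP S A}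

lemma tZero_nonneg (k : CTDConst) : 0 ≤ M.tZero k := by
  unfold tZero
  positivity

lemma stepSize_succ (k : CTDConst) (t : ℕ) :
    M.stepSize k (t + 1) = 2 / (k.lamMin * (t + M.tZero k)) := by
  rw [stepSize]
  push_cast
  ring_nf

variable [DecidableEq S] [DecidableEq A] {Pol : Set (Policy S A)} {k : CTDConst}

lemma ValidConst.le_tZero_mul (hk : M.ValidConst Pol k) :
    64 * (1 + M.γ) ^ 2 ≤ M.tZero k * k.lamMin ^ 2 := by
  rw [tZero, div_mul_cancel₀ _ (pow_ne_zero 2 hk.lamMin_pos.ne')]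
  linear_combination 8 * le_max_right (k.lamMax ^ 2) (8 * (1 + M.γ) ^ 2)

lemma ValidConst.tZero_pos (hk : M.ValidConst Pol k) : 0 < M.tZero k := by
  refine pos_of_mul_pos_left (lt_of_lt_of_le ?_ hk.le_tZero_mul) (sq_nonneg _)
  have := M.γ_pos
  positivity

lemma ValidConst.lamMin_le_one [Nonempty S] [Nonempty A] (hk : M.ValidConst Pol k)
    {π : Policy S A} (hPol : π ∈ Pol) (hπ : ∀ s, π s ∈ stdSimplex ℝ A) : k.lamMin ≤ 1 := by
  obtain ⟨z⟩ : Nonempty (S × A) := inferInstance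
  have hd := pairDist_mem_stdSimplex (M := M) hπ
  calc k.lamMin ≤ (1 - M.γ) * M.pairDist π z := hk.lamMin_le_pairDist hPol z
    _ ≤ 1 := mul_le_one₀ (by linarith [M.γ_pos]) (hd.1 z) (le_one_of_mem_stdSimplex hd z)

lemma ValidConst.le_tZero [Nonempty S] [Nonempty A] (hk : M.ValidConst Pol k)
    {π : Policy S A} (hPol : π ∈ Pol) (hπ : ∀ s, π s ∈ stdSimplex ℝ A) : 64 ≤ M.tZero k := calc
  64 ≤ 64 * (1 + M.γ) ^ 2 := by nlinarith [M.γ_pos]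
  _ ≤ M.tZero k * k.lamMin ^ 2 := hk.le_tZero_mul
  _ ≤ M.tZero k := mul_le_of_le_one_right (tZero_nonneg k)
    (pow_le_one₀ hk.lamMin_pos.le (hk.lamMin_le_one hPol hπ))

lemma ValidConst.stepSize_nonneg (hk : M.ValidConst Pol k) (t : ℕ) :
    0 ≤ M.stepSize k (t + 1) := by
  have := hk.lamMin_pos
  have := hk.tZero_pos
  rw [stepSize_succ]
  positivity

lemma ValidConst.stepSize_mul_lamMin (hk : M.ValidConst Pol k) (t : ℕ) :
    3 / 2 * (M.stepSize k (t + 1) * k.lamMin) = 3 / (t + M.tZero k) := by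
  have := hk.lamMin_pos
  have := hk.tZero_pos
  rw [stepSize_succ]
  field_simp

lemma ValidConst.mul_stepSize_le (hk : M.ValidConst Pol k) (t : ℕ) :
    8 * (1 + M.γ) ^ 2 * M.stepSize k (t + 1) ≤ k.lamMin := by
  have hΛ := hk.lamMin_pos
  have ht₀ := hk.tZero_pos
  have ht : (0 : ℝ) ≤ t * k.lamMin ^ 2 := by positivity
  rw [stepSize_succ, mul_div_assoc', div_le_iff₀ (by positivity)]
  linear_combination 1 / 4 * hk.le_tZero_mul + 3 / 4 * M.tZero k * sq_nonneg k.lamMin + ht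

lemma ValidConst.norm2_sub_stepSize_smul_adjF_le [Nonempty S] [Nonempty A]
    (hk : M.ValidConst Pol k) {π : Policy S A} (hPol : π ∈ Pol)
    (hπ : ∀ s, π s ∈ stdSimplex ℝ A) (t : ℕ) (v : S × A → ℝ) :
    norm2 (v - M.stepSize k (t + 1) • M.adjF π v) ≤ √(1 - 3 / (t + M.tZero k)) * norm2 v := by
  have hτ : 64 ≤ t + M.tZero k := le_add_of_nonneg_of_le t.cast_nonneg (hk.le_tZero hPol hπ)
  have hcontract : 0 ≤ 1 - 3 / (t + M.tZero k) := by rw [sub_nonneg, div_le_one] <;> linarith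
  have hβ0 := hk.stepSize_nonneg t
  have hγ : 1 ≤ (1 + M.γ) ^ 2 := one_le_pow₀ (by linarith [M.γ_pos])
  have hsq := hk.norm2_sub_smul_adjF_sq_le hPol hπ hβ0
    (by linear_combination hk.mul_stepSize_le t + 8 * M.stepSize k (t + 1) * hγ) v
  rw [hk.stepSize_mul_lamMin] at hsq
  refine (Real.le_sqrt_of_sq_le hsq).trans_eq ?_
  rw [Real.sqrt_mul hcontract, Real.sqrt_sq (norm2_nonneg _)]

variable {Ω : Type*} {mΩ : MeasurableSpace Ω} {Pr : Measure Ω} [IsProbabilityMeasure Pr]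
  {Z : ℕ → Ω → S × A} {Φ : (ℕ → S × A) → Policy S A} {n₀ n₁ : ℕ}

lemma Follows.integral_norm2_ctdErr_le_sqrt (h : M.Follows Pr Z Φ n₀ n₁) (α : ℕ) (β : ℕ → ℝ)
    (t : ℕ) : ∫ ω, norm2 (M.ctdErr Φ α β n₀ t fun i => Z i ω) ∂Pr
      ≤ √(∫ ω, norm2 (M.ctdErr Φ α β n₀ t fun i => Z i ω) ^ 2 ∂Pr) := by
  have herr := dependsOn_ctdErr (M := M) h.past α β t
  have hint : Integrable (fun ω => norm2 (M.ctdErr Φ α β n₀ t fun i => Z i ω)) Pr :=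
    integrable_of_dependsOn (n := n₀ + t * α) (G := fun p => norm2 (M.ctdErr Φ α β n₀ t p)) h.meas
      fun p q hpq => by simp only [herr hpq]
  have hint2 : Integrable (fun ω => norm2 (M.ctdErr Φ α β n₀ t fun i => Z i ω) ^ 2) Pr :=
    integrable_of_dependsOn (n := n₀ + t * α) (G := fun p => norm2 (M.ctdErr Φ α β n₀ t p) ^ 2)
      h.meas fun p q hpq => by simp only [herr hpq]
  refine Real.le_sqrt_of_sq_le (sub_nonneg.1 ?_)
  exact (variance_nonneg _ Pr).trans_eq
    (variance_eq_sub ((memLp_two_iff_integrable_sq hint.1).2 hint2))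

lemma Follows.integral_norm2_ctdErr_sq_recursion (h : M.Follows Pr Z Φ n₀ n₁)
    (hk : M.ValidConst Pol k) (hΦ : ∀ p, Φ p ∈ Pol) (hfeas : ∀ π ∈ Pol, M.Feasible π) {α : ℕ}
    (hα : 1 ≤ α) (hmix : k.C * k.ρ ^ α ≤ k.lamMin / 9) {t : ℕ} (ht : n₀ + (t + 1) * α ≤ n₁) :
    ∫ ω, norm2 (M.ctdErr Φ α (M.stepSize k) n₀ (t + 1) fun i => Z i ω) ^ 2 ∂Pr
      ≤ (1 - 3 / (t + M.tZero k))
        * ∫ ω, norm2 (M.ctdErr Φ α (M.stepSize k) n₀ t fun i => Z i ω) ^ 2 ∂Pr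
        + 8 * k.B ^ 2 / k.lamMin ^ 2 / (t + M.tZero k) ^ 2 := by
  have hstep := h.integral_norm2_ctdErr_succ_sq_le hk hΦ hfeas hα hmix (hk.stepSize_nonneg t)
    (hk.mul_stepSize_le t) ht
  rw [hk.stepSize_mul_lamMin] at hstep
  refine hstep.trans_eq (congrArg _ ?_)
  rw [stepSize_succ, div_pow, mul_pow, div_div]
  ring

lemma Follows.integral_sum_ctdErr_zero_mul_le (h : M.Follows Pr Z Φ n₀ n₁) (α : ℕ) (β : ℕ → ℝ)
    {b : ℝ} (hb : ∀ p, norm2 (M.Q (Φ p)) ≤ b) {u : (ℕ → S × A) → S × A → ℝ}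
    (hu : DependsOn u (Set.Iic n₀)) {c : ℝ} (hc : ∀ p, norm2 (u p) ≤ c) :
    ∫ ω, ∑ i, (M.ctdErr Φ α β n₀ 0 fun i => Z i ω) i * u (fun i => Z i ω) i ∂Pr ≤ c * b := by
  have hle : ∀ p, ∑ i, M.ctdErr Φ α β n₀ 0 p i * u p i ≤ c * b := fun p => by
    refine (sum_mul_le_norm2_mul_norm2 _ _).trans ?_
    rw [ctdErr, ctd, zero_sub, norm2_neg, mul_comm c]
    exact mul_le_mul (hb p) (hc p) (norm2_nonneg _) ((norm2_nonneg _).trans (hb p))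
  have hint := integrable_of_dependsOn (Pr := Pr) (n := n₀ + 0 * α)
    (G := fun p => ∑ i, M.ctdErr Φ α β n₀ 0 p i * u p i) h.meas fun p q hpq => by
      simp only [dependsOn_ctdErr h.past α β 0 hpq,
        hu fun i hi => hpq i (le_trans hi (Nat.le_add_right _ _))]
  exact (integral_mono hint (integrable_const _) fun ω => hle _).trans_eq (by simp)

lemma Follows.integral_sum_ctdErr_mul_le [Nonempty S] [Nonempty A] (h : M.Follows Pr Z Φ n₀ n₁)
    (hk : M.ValidConst Pol k) (hΦ : ∀ p, Φ p ∈ Pol) (hfeas : ∀ π ∈ Pol, M.Feasible π) {α : ℕ}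
    (hα : 1 ≤ α) {T : ℕ} (hT : n₀ + T * α ≤ n₁) {R b : ℝ} (hR0 : 0 ≤ R)
    (hb : ∀ π ∈ Pol, norm2 (M.Q π) ≤ b)
    (hR : ∀ t < T, ∫ ω, norm2 (M.ctdErr Φ α (M.stepSize k) n₀ t fun i => Z i ω) ∂Pr ≤ R)
    {t : ℕ} (ht : t ≤ T) {u : (ℕ → S × A) → S × A → ℝ} (hu : DependsOn u (Set.Iic n₀)) {c : ℝ}
    (hc : ∀ p, norm2 (u p) ≤ c) :
    ∫ ω, ∑ i, (M.ctdErr Φ α (M.stepSize k) n₀ t fun i => Z i ω) i * u (fun i => Z i ω) i ∂Pr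
      ≤ c * (decay (M.tZero k) t * b + 4 / 3 * (k.C * k.ρ ^ α * R / k.lamMin)) := by
  have hC := mul_nonneg hk.C_pos.le (pow_nonneg hk.ρ_pos.le α)
  have hr : 0 ≤ k.C * k.ρ ^ α * R / k.lamMin := div_nonneg (mul_nonneg hC hR0) hk.lamMin_pos.le
  have hc0 : 0 ≤ c := (norm2_nonneg _).trans (hc fun _ => Classical.arbitrary _)
  have hp := hΦ fun _ => Classical.arbitrary _
  have hπ := (hfeas _ hp).mem_stdSimplex
  induction t generalizing u c with
  | zero =>
    refine (h.integral_sum_ctdErr_zero_mul_le α _ (fun p => hb _ (hΦ p)) hu hc).trans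
      (mul_le_mul_of_nonneg_left ?_ hc0)
    rw [decay_zero, one_mul]
    exact le_add_of_nonneg_right (by positivity)
  | succ t ih =>
    have hβ0 := hk.stepSize_nonneg t
    have hτ : 64 ≤ t + M.tZero k := le_add_of_nonneg_of_le t.cast_nonneg (hk.le_tZero hp hπ)
    have hu1 : 3 / (t + M.tZero k) ≤ 1 := by rw [div_le_one] <;> linarith
    have hdir : ∀ p, norm2 (u p - M.stepSize k (t + 1) • M.adjF (Φ p) (u p))
        ≤ √(1 - 3 / (t + M.tZero k)) * c := fun p =>
      (hk.norm2_sub_stepSize_smul_adjF_le (hΦ p) (hfeas _ (hΦ p)).mem_stdSimplex t (u p)).trans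
        (mul_le_mul_of_nonneg_left (hc p) (Real.sqrt_nonneg _))
    have hbias : M.stepSize k (t + 1) * (k.C * k.ρ ^ α) * c * R
        = c * (2 / 3 * (3 / (t + M.tZero k)) * (k.C * k.ρ ^ α * R / k.lamMin)) := by
      rw [stepSize_succ, ← div_div]
      ring
    calc _ ≤ _ := h.integral_sum_ctdErr_succ_mul_le hk hΦ hfeas hα hβ0
          (hT.trans' (Nat.add_le_add_left (Nat.mul_le_mul_right α ht) n₀)) hu hc
      _ ≤ _ := add_le_add (ih (by omega) (fun p q hpq => by simp only [hu hpq, h.past hpq]) hdir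
          (mul_nonneg (Real.sqrt_nonneg _) hc0))
          (mul_le_mul_of_nonneg_left (hR t ht) (mul_nonneg (mul_nonneg hβ0 hC) hc0))
      _ ≤ _ := by
          rw [hbias, decay_succ, mul_right_comm (decay _ _)]
          exact sqrt_mul_add_le hu1 hc0 hr

end RegMDP

section Sequences

lemma pow_le_of_logb_le {ρ y : ℝ} (hρ0 : 0 < ρ) (hρ1 : ρ < 1) (hy : 0 < y) {α : ℕ}
    (h : Real.logb ρ y ≤ α) : ρ ^ α ≤ y := by
  rwa [← Real.rpow_natCast, ← Real.logb_le_iff_le_rpow_of_base_lt_one hρ0 hρ1 hy]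

lemma le_of_affine_recursion {X : ℕ → ℝ} {γ b : ℝ} (hγ : 0 ≤ γ) {n : ℕ}
    (h : ∀ i < n, X (i + 1) ≤ γ * X i + (1 - γ) * b) : X n ≤ γ ^ n * X 0 + (1 - γ ^ n) * b := by
  induction n with
  | zero => simp
  | succ n ih =>
    rw [pow_succ]
    linear_combination h n (Nat.lt_succ_self n) + γ * ih fun i hi => h i (Nat.lt_succ_of_lt hi)

lemma le_pow_div_mul_of_recursion {X : ℕ → ℝ} {γ Δ : ℝ} (hγ0 : 0 ≤ γ) (hγ1 : γ ≤ 1) (hΔ : 0 ≤ Δ)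
    {l : ℕ} (hl : γ ^ l ≤ 1 / 4) (hX0 : X 0 ≤ Δ)
    (h : ∀ j, X (j + 1) ≤ γ * X j + (1 - γ) * ((1 / 2) ^ (j / l) * Δ / 4)) (j : ℕ) :
    X j ≤ (1 / 2) ^ (j / l) * Δ := by
  have hl0 : 0 < l := Nat.pos_of_ne_zero fun hl0 => by norm_num [hl0] at hl
  have within : ∀ q, ∀ i ≤ l, X (l * q + i)
      ≤ γ ^ i * X (l * q) + (1 - γ ^ i) * ((1 / 2) ^ q * Δ / 4) := fun q i hi => by
    refine le_of_affine_recursion (X := fun i => X (l * q + i)) hγ0 fun i' hi' => ?_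
    simpa only [Nat.mul_add_div hl0, Nat.div_eq_of_lt (hi'.trans_le hi), add_zero, add_assoc]
      using h (l * q + i')
  have across : ∀ q, X (l * q) ≤ (1 / 2) ^ q * Δ := fun q => by
    induction q with
    | zero => simpa using hX0
    | succ q ih =>
      have hpos : 0 ≤ (1 / 2 : ℝ) ^ q * Δ := by positivity
      have : 0 ≤ γ ^ l := by positivity
      rw [Nat.mul_succ, pow_succ]
      linear_combination within q l le_rfl + γ ^ l * ih + 3 / 4 * ((1 / 2) ^ q * Δ) * hl
        + 1 / 16 * hpos
  have : 0 ≤ (1 / 2 : ℝ) ^ (j / l) * Δ := by positivity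
  have : 0 ≤ γ ^ (j % l) := by positivity
  have hpow1 : γ ^ (j % l) ≤ 1 := pow_le_one₀ hγ0 hγ1
  have hj := within (j / l) (j % l) (Nat.mod_lt j hl0).le
  rw [Nat.div_add_mod] at hj
  linear_combination hj + γ ^ (j % l) * across (j / l) + 3 / 4 * ((1 / 2) ^ (j / l) * Δ) * hpow1

lemma le_div_of_weighted_decay {a₀ a D N T t₀ θ : ℝ} (hN : 0 < N) (hT : 0 ≤ T) (ht₀ : 2 < t₀)
    (h : (T + t₀ - 1) * (T + t₀ - 2) * a ≤ (t₀ - 1) * (t₀ - 2) * a₀ + D * T)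
    (ha₀ : a₀ ≤ θ ^ 2) (hθ : 4 * t₀ ^ 2 * θ ^ 2 * N ≤ T ^ 2) (hD : 3 * D * N ≤ T) :
    a ≤ 7 / 12 / N := by
  have hw : T ^ 2 ≤ (T + t₀ - 1) * (T + t₀ - 2) := by nlinarith
  have hinit : (t₀ - 1) * (t₀ - 2) * a₀ ≤ t₀ ^ 2 * θ ^ 2 :=
    mul_le_mul_of_nonneg (by nlinarith) ha₀ (by nlinarith) (sq_nonneg θ)
  rw [le_div_iff₀ hN]
  refine le_of_mul_le_mul_left ?_ (show 0 < (T + t₀ - 1) * (T + t₀ - 2) by nlinarith)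
  linear_combination N * h + N * hinit + hθ / 4 + T * hD / 3 + 7 / 12 * hw

end Sequences

namespace RegMDP

variable {S A : Type*} [Fintype S] [Fintype A] {M : RegMDP S A} {cbar hbar : ℝ} {k : CTDConst}

lemma epochLen_pos (M : RegMDP S A) : 0 < M.epochLen :=
  Nat.ceil_pos.2 (Real.logb_pos_of_base_lt_one M.γ_pos M.γ_lt_one (by norm_num) (by norm_num))

lemma pow_epochLen_le (M : RegMDP S A) : M.γ ^ M.epochLen ≤ 1 / 4 :=
  pow_le_of_logb_le M.γ_pos M.γ_lt_one (by norm_num) (Nat.le_ceil _)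

lemma Rsq_nonneg : 0 ≤ M.Rsq cbar hbar k := by unfold Rsq; positivity

lemma sq_B_le_Rsq : k.B ^ 2 ≤ M.Rsq cbar hbar k := by
  have hpos : 0 ≤ 3 * (k.B ^ 2 + 2 * (cbar + hbar) ^ 2) / (4 * (1 + M.γ) ^ 2) := by positivity
  unfold Rsq
  linear_combination 7 * sq_nonneg k.B + hpos

lemma sq_B_le_sigmaFsq : k.B ^ 2 ≤ M.sigmaFsq cbar hbar k := by
  have hpos : 0 ≤ 4 * (1 + M.γ) ^ 2 * M.Rsq cbar hbar k := mul_nonneg (by positivity) Rsq_nonneg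
  unfold sigmaFsq
  linear_combination hpos + 2 * sq_nonneg (cbar + hbar)

lemma thetaBar_nonneg [Nonempty S] [Nonempty A] (hc : ∀ s a, |M.c s a| ≤ cbar)
    (hh : ∀ s, ∀ p ∈ M.dom s, |M.h s p| ≤ hbar) {π : Policy S A} (hπ : M.Feasible π) :
    0 ≤ M.thetaBar cbar hbar := by
  classical exact (norm2_nonneg _).trans (norm2_Q_le_thetaBar hc hh hπ)

lemma one_le_skip (j : ℕ) : 1 ≤ M.skip cbar hbar k j := le_max_left _ _

lemma sigmaFsq_nonneg : 0 ≤ M.sigmaFsq cbar hbar k := (sq_nonneg _).trans sq_B_le_sigmaFsq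

lemma tZero_pow_mul_le_numSteps_pow (hθ : 0 ≤ M.thetaBar cbar hbar) (j : ℕ) :
    M.tZero k ^ 3 * (3 * M.thetaBar cbar hbar * 2 ^ (j / M.epochLen + 2)) ^ 2
      ≤ (M.numSteps cbar hbar k j : ℝ) ^ 3 := by
  have hx : 0 ≤ 3 * M.thetaBar cbar hbar * 2 ^ (j / M.epochLen + 2) := by positivity
  have hrate : 0 ≤ 24 * M.sigmaFsq cbar hbar k / k.lamMin ^ 2 * 2 ^ (j / M.epochLen + 2) := by
    have := sigmaFsq_nonneg (M := M) (cbar := cbar) (hbar := hbar) (k := k)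
    positivity
  have hle : M.tZero k * (3 * M.thetaBar cbar hbar * 2 ^ (j / M.epochLen + 2)) ^ (2 / 3 : ℝ)
      ≤ M.numSteps cbar hbar k j :=
    (le_add_of_nonneg_right (Real.sqrt_nonneg _)).trans
      ((le_add_of_nonneg_right hrate).trans (Nat.le_ceil _))
  generalize 3 * M.thetaBar cbar hbar * 2 ^ (j / M.epochLen + 2) = x at hx hle
  calc M.tZero k ^ 3 * x ^ 2 = (M.tZero k * x ^ (2 / 3 : ℝ)) ^ 3 := by
        rw [mul_pow, ← Real.rpow_mul_natCast hx]
        norm_num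
    _ ≤ _ := pow_le_pow_left₀ (mul_nonneg (tZero_nonneg k) (Real.rpow_nonneg hx _)) hle 3

lemma tZero_sq_mul_le_numSteps_sq (hθ : 0 ≤ M.thetaBar cbar hbar) (j : ℕ) :
    4 * M.tZero k ^ 2 * M.thetaBar cbar hbar ^ 2 * 2 ^ (j / M.epochLen + 2)
      ≤ (M.numSteps cbar hbar k j : ℝ) ^ 2 := by
  have ht₀ := tZero_nonneg (M := M) k
  have hσ := sigmaFsq_nonneg (M := M) (cbar := cbar) (hbar := hbar) (k := k)
  refine (Real.sqrt_le_left (Nat.cast_nonneg _)).1 (le_trans ?_ (Nat.le_ceil _))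
  rw [add_right_comm]
  exact le_add_of_nonneg_left (by positivity)

lemma sigmaFsq_mul_le_numSteps (hθ : 0 ≤ M.thetaBar cbar hbar) (j : ℕ) :
    24 * M.sigmaFsq cbar hbar k / k.lamMin ^ 2 * 2 ^ (j / M.epochLen + 2)
      ≤ M.numSteps cbar hbar k j := by
  have ht₀ := tZero_nonneg (M := M) k
  exact (le_add_of_nonneg_left (by positivity)).trans (Nat.le_ceil _)

variable [DecidableEq S] [DecidableEq A] {Pol : Set (Policy S A)}

lemma ValidConst.mul_pow_skip_le (hk : M.ValidConst Pol k) (cbar hbar : ℝ) (j : ℕ) :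
    k.C * k.ρ ^ M.skip cbar hbar k j ≤ k.lamMin / 9 := by
  have hC := hk.C_pos
  have hΛ := hk.lamMin_pos
  have hlog : Real.logb k.ρ (k.lamMin / (9 * k.C)) ≤ M.skip cbar hbar k j :=
    ((le_max_right _ _).trans (Nat.le_ceil _)).trans (Nat.cast_le.2 (le_max_right _ _))
  calc k.C * k.ρ ^ M.skip cbar hbar k j ≤ k.C * (k.lamMin / (9 * k.C)) :=
        mul_le_mul_of_nonneg_left
          (pow_le_of_logb_le hk.ρ_pos hk.ρ_lt_one (by positivity) hlog) hC.le
    _ = k.lamMin / 9 := by field_simp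

lemma ValidConst.mul_pow_skip_mul_Rsq_le (hk : M.ValidConst Pol k) (cbar hbar : ℝ) (j : ℕ) :
    k.C * k.ρ ^ M.skip cbar hbar k j * M.Rsq cbar hbar k
      ≤ k.lamMin / 24 / (2 ^ (j / M.epochLen + 2)) ^ 2 := by
  have hC := hk.C_pos
  have hΛ := hk.lamMin_pos
  rcases (Rsq_nonneg (M := M) (cbar := cbar) (hbar := hbar) (k := k)).eq_or_lt with hR | hR
  · rw [← hR, mul_zero]
    positivity
  set q := j / M.epochLen
  have hlog : Real.logb k.ρ ((1 / 2) ^ (2 * (q + 2)) * (k.lamMin / (24 * k.C * M.Rsq cbar hbar k)))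
      ≤ M.skip cbar hbar k j := by
    rw [Real.logb_mul (by positivity) (by positivity), Real.logb_pow]
    refine le_of_eq_of_le ?_ ((((le_max_left _ _).trans (le_max_left _ _)).trans
      (Nat.le_ceil _)).trans (Nat.cast_le.2 (le_max_right _ _)))
    push_cast
    rfl
  calc _ = k.C * M.Rsq cbar hbar k * k.ρ ^ M.skip cbar hbar k j := by ring
    _ ≤ k.C * M.Rsq cbar hbar k
        * ((1 / 2) ^ (2 * (q + 2)) * (k.lamMin / (24 * k.C * M.Rsq cbar hbar k))) :=
      mul_le_mul_of_nonneg_left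
        (pow_le_of_logb_le hk.ρ_pos hk.ρ_lt_one (by positivity) hlog) (mul_pos hC hR).le
    _ = _ := by
      rw [← pow_mul, mul_comm (q + 2) 2, one_div, inv_pow]
      field_simp

lemma ValidConst.mixing_bias_le (hk : M.ValidConst Pol k) (cbar hbar : ℝ) (j : ℕ) :
    4 / 3 * (k.C * k.ρ ^ M.skip cbar hbar k j * √(M.Rsq cbar hbar k) / k.lamMin)
      ≤ 1 / 10 / 2 ^ (j / M.epochLen + 2) := by
  have hΛ := hk.lamMin_pos
  have hR := Rsq_nonneg (M := M) (cbar := cbar) (hbar := hbar) (k := k)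
  have hmix := hk.mul_pow_skip_le cbar hbar j
  have hmixR := hk.mul_pow_skip_mul_Rsq_le cbar hbar j
  set N : ℝ := 2 ^ (j / M.epochLen + 2)
  set y := k.C * k.ρ ^ M.skip cbar hbar k j
  have hN : 0 < N := by positivity
  have hy : 0 ≤ y := mul_nonneg hk.C_pos.le (pow_nonneg hk.ρ_pos.le _)
  have hsq : (y * √(M.Rsq cbar hbar k)) ^ 2 ≤ (3 / 40 * k.lamMin / N) ^ 2 := calc
    _ = y * (y * M.Rsq cbar hbar k) := by rw [mul_pow, Real.sq_sqrt hR]; ring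
    _ ≤ k.lamMin / 9 * (k.lamMin / 24 / N ^ 2) :=
      mul_le_mul hmix hmixR (mul_nonneg hy hR) (by positivity)
    _ = 1 / 216 * (k.lamMin / N) ^ 2 := by ring
    _ ≤ 9 / 1600 * (k.lamMin / N) ^ 2 := mul_le_mul_of_nonneg_right (by norm_num) (sq_nonneg _)
    _ = _ := by ring
  calc _ ≤ 4 / 3 * (3 / 40 * k.lamMin / N / k.lamMin) := by
        gcongr
        exact le_of_sq_le_sq hsq (by positivity)
    _ = _ := by field_simp; norm_num

variable {Ω : Type*} {mΩ : MeasurableSpace Ω} {Pr : Measure Ω} [IsProbabilityMeasure Pr]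
  {Z : ℕ → Ω → S × A} {Φ : (ℕ → S × A) → Policy S A} {n₀ n₁ : ℕ}

lemma Follows.integral_norm2_ctdErr_zero_sq_le (h : M.Follows Pr Z Φ n₀ n₁) (α : ℕ) (β : ℕ → ℝ)
    {b : ℝ} (hb : ∀ p, norm2 (M.Q (Φ p)) ≤ b) :
    ∫ ω, norm2 (M.ctdErr Φ α β n₀ 0 fun i => Z i ω) ^ 2 ∂Pr ≤ b ^ 2 := by
  have hle : ∀ p, norm2 (M.ctdErr Φ α β n₀ 0 p) ^ 2 ≤ b ^ 2 := fun p => by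
    rw [ctdErr, ctd, zero_sub, norm2_neg]
    exact pow_le_pow_left₀ (norm2_nonneg _) (hb p) 2
  have hint := integrable_of_dependsOn (Pr := Pr) (n := n₀ + 0 * α)
    (G := fun p => norm2 (M.ctdErr Φ α β n₀ 0 p) ^ 2) h.meas
    fun p q hpq => by simp only [dependsOn_ctdErr h.past α β 0 hpq]
  exact (integral_mono hint (integrable_const _) fun ω => hle _).trans_eq (by simp)

variable [Nonempty S] [Nonempty A] {j : ℕ}

lemma Follows.integral_norm2_ctdErr_sq_le_Rsq (h : M.Follows Pr Z Φ n₀ n₁)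
    (hk : M.ValidConst Pol k) (hΦ : ∀ p, Φ p ∈ Pol) (hfeas : ∀ π ∈ Pol, M.Feasible π)
    {α : ℕ} (hα : 1 ≤ α) (hmix : k.C * k.ρ ^ α ≤ k.lamMin / 9) {T : ℕ} (hT : n₀ + T * α ≤ n₁)
    {t : ℕ} (ht : t ≤ T) :
    ∫ ω, norm2 (M.ctdErr Φ α (M.stepSize k) n₀ t fun i => Z i ω) ^ 2 ∂Pr
      ≤ M.Rsq cbar hbar k := by
  have hp := hΦ fun _ => Classical.arbitrary _
  have ht₀ := hk.le_tZero hp (hfeas _ hp).mem_stdSimplex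
  have hΛ := hk.lamMin_pos
  refine le_of_recursion_le (T := T) (D := 8 * k.B ^ 2 / k.lamMin ^ 2)
    (a := fun t => ∫ ω, norm2 (M.ctdErr Φ α (M.stepSize k) n₀ t fun i => Z i ω) ^ 2 ∂Pr)
    (by linarith) ?_ Rsq_nonneg ?_ (fun t ht => h.integral_norm2_ctdErr_sq_recursion hk hΦ hfeas
      hα hmix (hT.trans' (Nat.add_le_add_left (Nat.mul_le_mul_right α ht) n₀))) ht
  · have hγ : 64 ≤ M.tZero k * k.lamMin ^ 2 := by
      nlinarith [hk.le_tZero_mul, M.γ_pos]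
    have hR := Rsq_nonneg (M := M) (cbar := cbar) (hbar := hbar) (k := k)
    rw [div_le_iff₀ (by positivity)]
    linear_combination 8 * sq_B_le_Rsq (M := M) (cbar := cbar) (hbar := hbar) (k := k)
      + 3 * M.Rsq cbar hbar k * hγ + 184 * hR
  · exact (h.integral_norm2_ctdErr_zero_sq_le α _ fun p => hk.norm_le _ (hΦ p)).trans sq_B_le_Rsq

lemma Follows.integral_norm2_ctdErr_numSteps_sq_le (h : M.Follows Pr Z Φ n₀ n₁)
    (hk : M.ValidConst Pol k) (hΦ : ∀ p, Φ p ∈ Pol) (hfeas : ∀ π ∈ Pol, M.Feasible π)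
    (hc : ∀ s a, |M.c s a| ≤ cbar) (hh : ∀ s, ∀ p ∈ M.dom s, |M.h s p| ≤ hbar)
    (hT : n₀ + M.numSteps cbar hbar k j * M.skip cbar hbar k j ≤ n₁) :
    ∫ ω, norm2 (M.ctdErr Φ (M.skip cbar hbar k j) (M.stepSize k) n₀ (M.numSteps cbar hbar k j)
      fun i => Z i ω) ^ 2 ∂Pr ≤ 7 / 12 / 2 ^ (j / M.epochLen + 2) := by
  have hp := hΦ fun _ => Classical.arbitrary _
  have ht₀ := hk.le_tZero hp (hfeas _ hp).mem_stdSimplex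
  have hθ := thetaBar_nonneg hc hh (hfeas _ hp)
  have hΛ := hk.lamMin_pos
  have hB := sq_B_le_sigmaFsq (M := M) (cbar := cbar) (hbar := hbar) (k := k)
  have hrate : 3 * (8 * k.B ^ 2 / k.lamMin ^ 2) * 2 ^ (j / M.epochLen + 2)
      ≤ M.numSteps cbar hbar k j := calc
    _ = 24 * k.B ^ 2 / k.lamMin ^ 2 * 2 ^ (j / M.epochLen + 2) := by ring
    _ ≤ 24 * M.sigmaFsq cbar hbar k / k.lamMin ^ 2 * 2 ^ (j / M.epochLen + 2) := by gcongr
    _ ≤ _ := sigmaFsq_mul_le_numSteps hθ j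
  have hinit := h.integral_norm2_ctdErr_zero_sq_le (M.skip cbar hbar k j) (M.stepSize k)
    fun p => norm2_Q_le_thetaBar hc hh (hfeas _ (hΦ p))
  have hdecay := mul_mul_le_of_recursion_le (T := M.numSteps cbar hbar k j) (t₀ := M.tZero k)
    (a := fun t => ∫ ω, norm2 (M.ctdErr Φ (M.skip cbar hbar k j) (M.stepSize k) n₀ t
      fun i => Z i ω) ^ 2 ∂Pr) (D := 8 * k.B ^ 2 / k.lamMin ^ 2) (by linarith) (by positivity)
    (fun t => integral_nonneg fun _ => sq_nonneg _) (fun t ht =>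
      h.integral_norm2_ctdErr_sq_recursion hk hΦ hfeas (one_le_skip j) (hk.mul_pow_skip_le _ _ j)
      (hT.trans' (Nat.add_le_add_left (Nat.mul_le_mul_right _ ht) n₀))) le_rfl
  exact le_div_of_weighted_decay (by positivity) (Nat.cast_nonneg _) (by linarith) hdecay
    hinit (tZero_sq_mul_le_numSteps_sq hθ j) hrate

lemma Follows.integral_sum_ctdErr_numSteps_mul_le (h : M.Follows Pr Z Φ n₀ n₁)
    (hk : M.ValidConst Pol k) (hΦ : ∀ p, Φ p ∈ Pol) (hfeas : ∀ π ∈ Pol, M.Feasible π)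
    (hc : ∀ s a, |M.c s a| ≤ cbar) (hh : ∀ s, ∀ p ∈ M.dom s, |M.h s p| ≤ hbar)
    (hT : n₀ + M.numSteps cbar hbar k j * M.skip cbar hbar k j ≤ n₁)
    {u : (ℕ → S × A) → S × A → ℝ} (hu : DependsOn u (Set.Iic n₀)) {c : ℝ}
    (hcu : ∀ p, norm2 (u p) ≤ c) :
    ∫ ω, ∑ i, (M.ctdErr Φ (M.skip cbar hbar k j) (M.stepSize k) n₀ (M.numSteps cbar hbar k j)
        fun i => Z i ω) i * u (fun i => Z i ω) i ∂Pr
      ≤ c * (13 / 30 / 2 ^ (j / M.epochLen + 2)) := by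
  have hp := hΦ fun _ => Classical.arbitrary _
  have ht₀ := hk.le_tZero hp (hfeas _ hp).mem_stdSimplex
  have hθ := thetaBar_nonneg hc hh (hfeas _ hp)
  have hmix := hk.mul_pow_skip_le cbar hbar j
  have hc0 : 0 ≤ c := (norm2_nonneg _).trans (hcu fun _ => Classical.arbitrary _)
  have hdecay := decay_mul_le_one (by linarith) (tZero_pow_mul_le_numSteps_pow (k := k) hθ j)
  refine (h.integral_sum_ctdErr_mul_le hk hΦ hfeas (one_le_skip j) hT (Real.sqrt_nonneg _)
    (fun π hπ => norm2_Q_le_thetaBar hc hh (hfeas π hπ)) (fun t ht =>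
      (h.integral_norm2_ctdErr_le_sqrt _ _ t).trans (Real.sqrt_le_sqrt
        (h.integral_norm2_ctdErr_sq_le_Rsq (cbar := cbar) (hbar := hbar) hk hΦ hfeas
          (one_le_skip j) hmix hT ht.le)))
    le_rfl hu hcu).trans (mul_le_mul_of_nonneg_left ?_ hc0)
  have hbias := hk.mixing_bias_le cbar hbar j
  have hinit : decay (M.tZero k) (M.numSteps cbar hbar k j) * M.thetaBar cbar hbar
      ≤ 1 / 3 / 2 ^ (j / M.epochLen + 2) := by
    rw [div_div, le_div_iff₀ (by positivity)]
    linear_combination hdecay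
  linear_combination hbias + hinit

end RegMDP

namespace RegMDP

section PolicyOf

variable {S A : Type*} [Fintype S] [Fintype A] {M : RegMDP S A} {Pol : Set (Policy S A)}

open Classical in
/-- A choice, within the class `Pol`, of a result of the prox-mapping at `π`; it is the uniform
policy if the class contains no such result. -/
noncomputable def proxOf (M : RegMDP S A) (η : ℝ) (Pol : Set (Policy S A)) (G : S × A → ℝ)
    (π : Policy S A) : Policy S A :=
  if h : ∃ πp ∈ Pol, M.IsProx η G π πp then h.choose else uniformPolicy S A

lemma proxOf_mem (hu : uniformPolicy S A ∈ Pol) (η : ℝ) (G : S × A → ℝ) (π : Policy S A) :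
    M.proxOf η Pol G π ∈ Pol := by
  rw [proxOf]
  split_ifs with h
  exacts [h.choose_spec.1, hu]

lemma isProx_proxOf {η : ℝ} {G : S × A → ℝ} {π πp : Policy S A} (hp : πp ∈ Pol)
    (h : M.IsProx η G π πp) : M.IsProx η G π (M.proxOf η Pol G π) := by
  have hex : ∃ πp ∈ Pol, M.IsProx η G π πp := ⟨πp, hp, h⟩
  rw [proxOf, dif_pos hex]
  exact hex.choose_spec.2

variable {k : CTDConst} {μ cbar hbar : ℝ}

lemma numSamples_succ (j : ℕ) : M.numSamples cbar hbar k (j + 1)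
    = M.numSamples cbar hbar k j + M.numSteps cbar hbar k j * M.skip cbar hbar k j :=
  Finset.sum_range_succ _ _

variable [DecidableEq S] [DecidableEq A]

/-- The policies of stochastic policy mirror descent as functions of the trajectory. On almost every
trajectory they are the iterates of any run within the class `Pol`, and choosing them by `proxOf`
keeps them in that class on all trajectories. -/
noncomputable def policyOf (M : RegMDP S A) (μ cbar hbar : ℝ) (k : CTDConst)
    (Pol : Set (Policy S A)) : ℕ → (ℕ → S × A) → Policy S A
  | 0, _ => uniformPolicy S A
  | j + 1, p => M.proxOf ((1 - M.γ) / (M.γ * μ)) Pol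
      (M.ctd (M.policyOf μ cbar hbar k Pol j p) (M.skip cbar hbar k j) (M.stepSize k) p
        (M.numSamples cbar hbar k j) (M.numSteps cbar hbar k j))
      (M.policyOf μ cbar hbar k Pol j p)

lemma policyOf_mem (hu : uniformPolicy S A ∈ Pol) (j : ℕ) (p : ℕ → S × A) :
    M.policyOf μ cbar hbar k Pol j p ∈ Pol := by
  cases j with
  | zero => exact hu
  | succ j => exact proxOf_mem hu _ _ _

lemma dependsOn_policyOf (j : ℕ) :
    DependsOn (M.policyOf μ cbar hbar k Pol j) (Set.Iic (M.numSamples cbar hbar k j)) := by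
  induction j with
  | zero => exact fun _ _ _ => rfl
  | succ j ih =>
    intro p q hpq
    rw [numSamples_succ] at hpq
    have hctd := dependsOn_ctd (M := M) ih (M.skip cbar hbar k j) (M.stepSize k)
      (M.numSteps cbar hbar k j) hpq
    have hpast : M.policyOf μ cbar hbar k Pol j p = M.policyOf μ cbar hbar k Pol j q :=
      ih fun i hi => hpq i (le_trans hi (Nat.le_add_right _ _))
    rw [policyOf, policyOf, ← hpast]
    simp only [← hpast] at hctd
    rw [hctd]

/-- The error, as a function of the trajectory, of the action-value estimate which the iteration `j`
of stochastic policy mirror descent uses. -/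
noncomputable def iterErr (M : RegMDP S A) (μ cbar hbar : ℝ) (k : CTDConst)
    (Pol : Set (Policy S A)) (j : ℕ) : (ℕ → S × A) → S × A → ℝ :=
  M.ctdErr (M.policyOf μ cbar hbar k Pol j) (M.skip cbar hbar k j) (M.stepSize k)
    (M.numSamples cbar hbar k j) (M.numSteps cbar hbar k j)

lemma dependsOn_iterErr (j : ℕ) :
    DependsOn (M.iterErr μ cbar hbar k Pol j) (Set.Iic (M.numSamples cbar hbar k (j + 1))) := by
  rw [numSamples_succ]
  exact dependsOn_ctdErr (dependsOn_policyOf j) _ _ _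

variable {Ω : Type*} {mΩ : MeasurableSpace Ω} {Pr : Measure Ω} {Z : ℕ → Ω → S × A}
  {π : ℕ → Ω → Policy S A}

lemma IsRun.uniform_mem [NeZero Pr] (hrun : M.IsRun μ cbar hbar k Pr Z π)
    (hPol : ∀ᵐ ω ∂Pr, ∀ j, π j ω ∈ Pol) : uniformPolicy S A ∈ Pol := by
  obtain ⟨ω, hω⟩ := hPol.exists
  exact hrun.init ω ▸ hω 0

lemma IsRun.ae_eq_policyOf (hrun : M.IsRun μ cbar hbar k Pr Z π)
    (hPol : ∀ᵐ ω ∂Pr, ∀ j, π j ω ∈ Pol) (hμ : 0 < μ) (hsc : M.StronglyConvex μ)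
    (hpos : ∀ π ∈ Pol, ∀ s a, 0 < π s a) :
    ∀ᵐ ω ∂Pr, ∀ j, π j ω = M.policyOf μ cbar hbar k Pol j fun i => Z i ω := by
  have hη : 0 < (1 - M.γ) / (M.γ * μ) :=
    div_pos (sub_pos.2 M.γ_lt_one) (mul_pos M.γ_pos hμ)
  filter_upwards [hrun.step, hPol] with ω hstep hω j
  induction j with
  | zero => exact hrun.init ω
  | succ j ih =>
    rw [policyOf, ← ih]
    exact ((hstep j).unique (isProx_proxOf (hω (j + 1)) (hstep j)) hsc hμ hη (hpos _ (hω j))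
      (hpos _ (hω (j + 1)))).symm

lemma IsRun.follows (hrun : M.IsRun μ cbar hbar k Pr Z π)
    (hae : ∀ᵐ ω ∂Pr, ∀ j, π j ω = M.policyOf μ cbar hbar k Pol j fun i => Z i ω) (j : ℕ) :
    M.Follows Pr Z (M.policyOf μ cbar hbar k Pol j) (M.numSamples cbar hbar k j)
      (M.numSamples cbar hbar k (j + 1)) where
  meas := hrun.meas
  past := dependsOn_policyOf j
  markov n h0 h1 z' := by
    filter_upwards [hrun.markov j n h0 h1 z', hae] with ω hmarkov hω
    rw [hmarkov, hω j]
    rfl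

end PolicyOf

section Gap

variable {S A : Type*} [Fintype S] [Fintype A] {M : RegMDP S A} {πs π : Policy S A} {ν : S → ℝ}

lemma norm2_mul_sub_le_of_mem_stdSimplex (hν : ν ∈ stdSimplex ℝ S)
    (hs : ∀ s, πs s ∈ stdSimplex ℝ A) (hπ : ∀ s, π s ∈ stdSimplex ℝ A) :
    norm2 (fun z : S × A => ν z.1 * (πs z.1 z.2 - π z.1 z.2)) ≤ 2 := by
  have hterm (s : S) (a : A) : (ν s * (πs s a - π s a)) ^ 2 ≤ ν s * (πs s a + π s a) := by
    have hν1 := le_one_of_mem_stdSimplex hν s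
    have hs1 := le_one_of_mem_stdSimplex (hs s) a
    have hπ1 := le_one_of_mem_stdSimplex (hπ s) a
    have hs0 := (hs s).1 a
    have hπ0 := (hπ s).1 a
    rw [mul_pow]
    refine mul_le_mul ?_ ?_ (sq_nonneg _) (hν.1 s)
    · exact pow_le_of_le_one (hν.1 s) hν1 two_ne_zero
    · linear_combination πs s a * hs1 + π s a * hπ1 + 2 * mul_nonneg hs0 hπ0
  refine (norm2_le_iff two_pos.le).2 ?_
  rw [Fintype.sum_prod_type]
  calc ∑ s, ∑ a, (ν s * (πs s a - π s a)) ^ 2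
      ≤ ∑ s, ν s * ∑ a, (πs s a + π s a) :=
        Finset.sum_le_sum fun s _ =>
          (Finset.sum_le_sum fun a _ => hterm s a).trans_eq (Finset.mul_sum _ _ _).symm
    _ = ∑ s, ν s * 2 := by
        simp only [Finset.sum_add_distrib, (hs _).2, (hπ _).2, one_add_one_eq_two]
    _ ≤ 2 ^ 2 := by
        rw [sum_mul_const_of_mem_stdSimplex hν]
        norm_num

variable [DecidableEq S] {μ : ℝ}

lemma f_le_of_isOptimal (hopt : M.IsOptimal πs) (hν : ∀ s, 0 ≤ ν s) (hπ : M.Feasible π) :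
    M.f ν πs ≤ M.f ν π :=
  Finset.sum_le_sum fun s _ => mul_le_mul_of_nonneg_left (hopt.2 π hπ s) (hν s)

lemma le_gapConst (hμ : 0 ≤ μ) (hf : M.f ν πs ≤ M.f ν (uniformPolicy S A)) :
    5 / 2 + 5 / (8 * M.γ * μ) ≤ (1 - M.γ) * M.gapConst μ ν πs := by
  have hγ : 0 < 1 - M.γ := sub_pos.2 M.γ_lt_one
  have hlog : 0 ≤ μ * Real.log (Fintype.card A) := mul_nonneg hμ (Real.log_natCast_nonneg _)
  rw [gapConst, mul_add, ← mul_assoc, mul_one_div_cancel hγ.ne', one_mul]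
  linear_combination (1 - M.γ) * hf + hlog

lemma gapConst_pos (hμ : 0 ≤ μ) (hf : M.f ν πs ≤ M.f ν (uniformPolicy S A)) :
    0 < M.gapConst μ ν πs := by
  have hγ := M.γ_pos
  refine pos_of_mul_pos_right ?_ (sub_pos.2 M.γ_lt_one).le
  exact lt_of_lt_of_le (by positivity) (le_gapConst hμ hf)

lemma gap_uniform_le (hμ : 0 ≤ μ) (hν : ν ∈ stdSimplex ℝ S)
    (hs : ∀ s, πs s ∈ stdSimplex ℝ A) :
    M.gap μ ν πs (uniformPolicy S A) ≤ M.gapConst μ ν πs := by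
  have hγ : 0 < 1 - M.γ := sub_pos.2 M.γ_lt_one
  have := M.γ_pos
  have hdist : M.dist ν (uniformPolicy S A) πs ≤ Real.log (Fintype.card A) :=
    sum_mul_le_of_mem_stdSimplex hν fun s => klDist_uniform_le (hs s)
  have hnonneg : 0 ≤ 1 / (1 - M.γ) * (5 / 2 + 5 / (8 * M.γ * μ)) := by positivity
  rw [gap, gapConst]
  linear_combination μ / (1 - M.γ) * hdist + hnonneg

end Gap

section LinearRate

variable {S A : Type*} [Fintype S] [Fintype A] [DecidableEq S] [DecidableEq A]
  {M : RegMDP S A} {Ω : Type*} {mΩ : MeasurableSpace Ω} {Pr : Measure Ω}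
  {Z : ℕ → Ω → S × A} {π : ℕ → Ω → Policy S A} {Pol : Set (Policy S A)} {k : CTDConst}
  {μ cbar hbar : ℝ} {πs : Policy S A} {ν : S → ℝ}

lemma integrable_gap_policyOf [IsFiniteMeasure Pr] (hZ : ∀ n, @Measurable Ω (S × A) _ ⊤ (Z n))
    (j : ℕ) :
    Integrable (fun ω => M.gap μ ν πs (M.policyOf μ cbar hbar k Pol j fun i => Z i ω)) Pr :=
  integrable_of_dependsOn (n := M.numSamples cbar hbar k j)
    (G := fun p => M.gap μ ν πs (M.policyOf μ cbar hbar k Pol j p)) hZ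
    fun p q hpq => by simp only [dependsOn_policyOf j hpq]

lemma integrable_norm2_iterErr_sq [IsFiniteMeasure Pr]
    (hZ : ∀ n, @Measurable Ω (S × A) _ ⊤ (Z n)) (j : ℕ) :
    Integrable (fun ω => norm2 (M.iterErr μ cbar hbar k Pol j fun i => Z i ω) ^ 2) Pr :=
  integrable_of_dependsOn (n := M.numSamples cbar hbar k (j + 1))
    (G := fun p => norm2 (M.iterErr μ cbar hbar k Pol j p) ^ 2) hZ
    fun p q hpq => by simp only [dependsOn_iterErr j hpq]

lemma integrable_sum_iterErr_mul [IsFiniteMeasure Pr]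
    (hZ : ∀ n, @Measurable Ω (S × A) _ ⊤ (Z n)) (j : ℕ) :
    Integrable (fun ω => ∑ z : S × A, M.iterErr μ cbar hbar k Pol j (fun i => Z i ω) z
      * (ν z.1 * (πs z.1 z.2 - M.policyOf μ cbar hbar k Pol j (fun i => Z i ω) z.1 z.2))) Pr :=
  integrable_of_dependsOn (n := M.numSamples cbar hbar k (j + 1))
    (G := fun p => ∑ z : S × A, M.iterErr μ cbar hbar k Pol j p z
      * (ν z.1 * (πs z.1 z.2 - M.policyOf μ cbar hbar k Pol j p z.1 z.2))) hZ fun p q hpq => by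
        have hpast : ∀ i ∈ Set.Iic (M.numSamples cbar hbar k j), p i = q i := fun i hi =>
          hpq i (le_trans hi ((Nat.le_add_right _ _).trans_eq (numSamples_succ j).symm))
        simp only [dependsOn_iterErr j hpq, dependsOn_policyOf j hpast]

lemma IsRun.ae_gap_succ_le (hrun : M.IsRun μ cbar hbar k Pr Z π)
    (hPol : ∀ᵐ ω ∂Pr, ∀ j, π j ω ∈ Pol) (hμ : 0 < μ) (hsc : M.StronglyConvex μ)
    (hfeas : ∀ π ∈ Pol, M.Feasible π) (hpos : ∀ π ∈ Pol, ∀ s a, 0 < π s a)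
    (hs : M.Feasible πs) (hν : M.IsStationary πs ν) (j : ℕ) :
    ∀ᵐ ω ∂Pr, M.gap μ ν πs (M.policyOf μ cbar hbar k Pol (j + 1) fun i => Z i ω)
      ≤ M.gap μ ν πs (M.policyOf μ cbar hbar k Pol j fun i => Z i ω) * M.γ
        + 1 / (M.γ * μ) * norm2 (M.iterErr μ cbar hbar k Pol j fun i => Z i ω) ^ 2
        + ∑ z : S × A, M.iterErr μ cbar hbar k Pol j (fun i => Z i ω) z
          * (ν z.1 * (πs z.1 z.2 - M.policyOf μ cbar hbar k Pol j (fun i => Z i ω) z.1 z.2)) := by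
  filter_upwards [hrun.step, hrun.ae_eq_policyOf hPol hμ hsc hpos, hPol] with ω hstep hω hmem
  have hprox := hstep j
  rw [hω j, hω (j + 1)] at hprox
  exact hprox.gap_le hμ hsc hν (hω j ▸ hfeas _ (hmem j)) hs (hω j ▸ hpos _ (hmem j))
    (hω (j + 1) ▸ hpos _ (hmem (j + 1)))

variable [IsProbabilityMeasure Pr] [Nonempty S] [Nonempty A]

lemma IsRun.integral_gap_policyOf_succ_le (hrun : M.IsRun μ cbar hbar k Pr Z π)
    (hPol : ∀ᵐ ω ∂Pr, ∀ j, π j ω ∈ Pol) (hk : M.ValidConst Pol k) (hμ : 0 < μ)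
    (hsc : M.StronglyConvex μ) (hc : ∀ s a, |M.c s a| ≤ cbar)
    (hh : ∀ s, ∀ p ∈ M.dom s, |M.h s p| ≤ hbar) (hfeas : ∀ π ∈ Pol, M.Feasible π)
    (hpos : ∀ π ∈ Pol, ∀ s a, 0 < π s a) (hs : M.Feasible πs) (hν : M.IsStationary πs ν)
    (j : ℕ) :
    ∫ ω, M.gap μ ν πs (M.policyOf μ cbar hbar k Pol (j + 1) fun i => Z i ω) ∂Pr
      ≤ (∫ ω, M.gap μ ν πs (M.policyOf μ cbar hbar k Pol j fun i => Z i ω) ∂Pr) * M.γ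
        + 1 / (M.γ * μ) * (7 / 12 / 2 ^ (j / M.epochLen + 2))
        + 2 * (13 / 30 / 2 ^ (j / M.epochLen + 2)) := by
  have hF := hrun.follows (hrun.ae_eq_policyOf hPol hμ hsc hpos) j
  have hΦ := policyOf_mem (M := M) (k := k) (μ := μ) (cbar := cbar) (hbar := hbar)
    (hrun.uniform_mem hPol) j
  have hvar := hF.integral_norm2_ctdErr_numSteps_sq_le hk hΦ hfeas hc hh (numSamples_succ j).ge
  have hbias := hF.integral_sum_ctdErr_numSteps_mul_le hk hΦ hfeas hc hh (numSamples_succ j).ge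
    (u := fun p z => ν z.1 * (πs z.1 z.2 - M.policyOf μ cbar hbar k Pol j p z.1 z.2))
    (fun p q hpq => by simp only [dependsOn_policyOf j hpq]) fun p =>
      norm2_mul_sub_le_of_mem_stdSimplex hν.1 hs.mem_stdSimplex (hfeas _ (hΦ p)).mem_stdSimplex
  have hgap (i : ℕ) := integrable_gap_policyOf (M := M) (Pr := Pr) (Pol := Pol) (k := k)
    (cbar := cbar) (hbar := hbar) (μ := μ) (ν := ν) (πs := πs) hrun.meas i
  have hsq := integrable_norm2_iterErr_sq (M := M) (Pr := Pr) (Pol := Pol) (k := k)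
    (cbar := cbar) (hbar := hbar) (μ := μ) hrun.meas j
  have hsum := integrable_sum_iterErr_mul (M := M) (Pr := Pr) (Pol := Pol) (k := k)
    (cbar := cbar) (hbar := hbar) (μ := μ) (ν := ν) (πs := πs) hrun.meas j
  have hmain := ((hgap j).mul_const M.γ).add (hsq.const_mul (1 / (M.γ * μ)))
  refine (integral_mono_ae (hgap (j + 1)) (hmain.add hsum)
    (hrun.ae_gap_succ_le hPol hμ hsc hfeas hpos hs hν j)).trans ?_
  rw [integral_add' hmain hsum, integral_add' ((hgap j).mul_const M.γ) (hsq.const_mul _),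
    integral_mul_const, integral_const_mul]
  have := M.γ_pos
  exact add_le_add (add_le_add le_rfl (mul_le_mul_of_nonneg_left hvar (by positivity))) hbias

theorem IsRun.integral_gap_le (hrun : M.IsRun μ cbar hbar k Pr Z π)
    (hPol : ∀ᵐ ω ∂Pr, ∀ j, π j ω ∈ Pol) (hk : M.ValidConst Pol k) (hμ : 0 < μ)
    (hsc : M.StronglyConvex μ) (hc : ∀ s a, |M.c s a| ≤ cbar)
    (hh : ∀ s, ∀ p ∈ M.dom s, |M.h s p| ≤ hbar) (hfeas : ∀ π ∈ Pol, M.Feasible π)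
    (hpos : ∀ π ∈ Pol, ∀ s a, 0 < π s a) (hs : M.Feasible πs) (hν : M.IsStationary πs ν)
    (hf : M.f ν πs ≤ M.f ν (uniformPolicy S A)) (j : ℕ) :
    Integrable (fun ω => M.gap μ ν πs (π j ω)) Pr ∧
      ∫ ω, M.gap μ ν πs (π j ω) ∂Pr ≤ (1 / 2) ^ (j / M.epochLen) * M.gapConst μ ν πs := by
  have hcongr : ∀ᵐ ω ∂Pr, M.gap μ ν πs (π j ω)
      = M.gap μ ν πs (M.policyOf μ cbar hbar k Pol j fun i => Z i ω) := by
    filter_upwards [hrun.ae_eq_policyOf hPol hμ hsc hpos] with ω hω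
    rw [hω j]
  refine ⟨(integrable_congr hcongr).2 (integrable_gap_policyOf hrun.meas j), ?_⟩
  rw [integral_congr_ae hcongr]
  have hΔ := le_gapConst hμ.le hf
  refine le_pow_div_mul_of_recursion
    (X := fun j => ∫ ω, M.gap μ ν πs (M.policyOf μ cbar hbar k Pol j fun i => Z i ω) ∂Pr)
    M.γ_pos.le M.γ_lt_one.le (gapConst_pos hμ.le hf).le M.pow_epochLen_le ?_ (fun i => ?_) j
  · simpa only [policyOf, integral_const, probReal_univ, one_smul]
      using gap_uniform_le hμ.le hν.1 hs.mem_stdSimplex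
  · have hγ := M.γ_pos
    have hstep := hrun.integral_gap_policyOf_succ_le hPol hk hμ hsc hc hh hfeas hpos hs hν i
    have hvar : 1 / (M.γ * μ) * (7 / 12 / 2 ^ (i / M.epochLen + 2))
        ≤ 5 / (8 * M.γ * μ) * ((1 / 2) ^ (i / M.epochLen) / 4) := by
      calc _ = 7 / 48 * (1 / (M.γ * μ * 2 ^ (i / M.epochLen))) := by rw [pow_add]; field
        _ ≤ 5 / 32 * (1 / (M.γ * μ * 2 ^ (i / M.epochLen))) :=
          mul_le_mul_of_nonneg_right (by norm_num) (by positivity)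
        _ = _ := by rw [one_div_pow]; field
    have hbias : 2 * (13 / 30 / (2 : ℝ) ^ (i / M.epochLen + 2))
        ≤ 5 / 2 * ((1 / 2) ^ (i / M.epochLen) / 4) := by
      calc _ = 13 / 60 * (1 / (2 : ℝ) ^ (i / M.epochLen)) := by rw [pow_add]; field
        _ ≤ 5 / 8 * (1 / (2 : ℝ) ^ (i / M.epochLen)) :=
          mul_le_mul_of_nonneg_right (by norm_num) (by positivity)
        _ = _ := by rw [one_div_pow]; field
    linear_combination hstep + hvar + hbias + (1 / 2) ^ (i / M.epochLen) / 4 * hΔ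

end LinearRate

end RegMDP

section Asymptotics

open Filter Topology

lemma le_two_pow_ceil_logb {x : ℝ} (hx : 0 < x) : x ≤ 2 ^ ⌈Real.logb 2 x⌉₊ := by
  rw [← Real.rpow_natCast, ← Real.logb_le_iff_le_rpow one_lt_two hx]
  exact Nat.le_ceil _

lemma natCast_ceil_le_of_le_sub_one {a b : ℝ} (hb : 0 ≤ b) (h : a ≤ b - 1) : (⌈a⌉₊ : ℝ) ≤ b := by
  rcases le_or_gt a 0 with ha | ha
  · rwa [Nat.ceil_eq_zero.2 ha, Nat.cast_zero]
  · linear_combination (Nat.ceil_lt_add_one ha.le).le + h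

lemma two_pow_ceil_logb_le {x : ℝ} (hx : 1 ≤ x) : 2 ^ ⌈Real.logb 2 x⌉₊ ≤ 2 * x := by
  have hx0 : 0 < x := one_pos.trans_le hx
  calc (2 : ℝ) ^ ⌈Real.logb 2 x⌉₊ ≤ 2 ^ (Real.logb 2 x + 1) := by
        rw [← Real.rpow_natCast]
        exact Real.rpow_le_rpow_of_exponent_le one_le_two
          (Nat.ceil_lt_add_one (Real.logb_nonneg one_lt_two hx)).le
    _ = 2 * x := by
        rw [Real.rpow_add two_pos, Real.rpow_logb two_pos (by norm_num) hx0, Real.rpow_one,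
          mul_comm]

lemma tendsto_logb_two_one_div :
    Tendsto (fun ε : ℝ => Real.logb 2 (1 / ε)) (𝓝[>] 0) atTop := by
  simp only [one_div]
  exact (Real.tendsto_logb_atTop one_lt_two).comp tendsto_inv_nhdsGT_zero

lemma eventually_logb_two_one_div_le {c : ℝ} (hc : 0 < c) :
    ∀ᶠ ε : ℝ in 𝓝[>] 0, Real.logb 2 (1 / ε) ≤ c / ε := by
  have hlog2 : 0 < Real.log 2 := Real.log_pos one_lt_two
  filter_upwards [tendsto_inv_nhdsGT_zero.eventually
    (Real.isLittleO_log_id_atTop.def (mul_pos hc hlog2)), self_mem_nhdsWithin] with ε hlog hε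
  rw [id, Real.norm_of_nonneg (inv_nonneg.2 hε.le)] at hlog
  rw [Real.logb, div_le_iff₀ hlog2, one_div]
  linear_combination (Real.le_norm_self _).trans hlog

lemma exists_forall_le_of_eventually_nhdsGT_zero {p : ℝ → Prop} (h : ∀ᶠ ε in 𝓝[>] 0, p ε) :
    ∃ ε₀ : ℝ, 0 < ε₀ ∧ ∀ ε, 0 < ε → ε ≤ ε₀ → p ε := by
  obtain ⟨ε₀, hε₀, hp⟩ := mem_nhdsGT_iff_exists_Ioc_subset.1 h
  exact ⟨ε₀, hε₀, fun ε hε hle => hp ⟨hε, hle⟩⟩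

lemma sum_range_pow_le {r : ℝ} (hr : 5 / 4 ≤ r) (m : ℕ) :
    ∑ q ∈ Finset.range m, r ^ q ≤ 4 * r ^ m := by
  induction m with
  | zero => norm_num
  | succ m ih =>
    have : 0 ≤ r ^ m := by positivity
    rw [Finset.sum_range_succ, pow_succ]
    linear_combination ih + 4 * r ^ m * hr

lemma sum_range_mul_div {l : ℕ} (hl : 0 < l) (F : ℕ → ℝ) (m : ℕ) :
    ∑ i ∈ Finset.range (l * m), F (i / l) = l * ∑ q ∈ Finset.range m, F q := by
  induction m with
  | zero => simp
  | succ m ih =>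
    have hlast : ∑ i ∈ Finset.range l, F ((l * m + i) / l) = ∑ _i ∈ Finset.range l, F m :=
      Finset.sum_congr rfl fun i hi => by
        rw [Nat.mul_add_div hl, Nat.div_eq_of_lt (Finset.mem_range.1 hi), add_zero]
    rw [Nat.mul_succ, Finset.sum_range_add, ih, hlast, Finset.sum_range_succ, mul_add,
      Finset.sum_const, Finset.card_range, nsmul_eq_mul]

lemma five_quarters_le_two_rpow {s : ℝ} (hs : 1 / 2 ≤ s) : 5 / 4 ≤ (2 : ℝ) ^ s :=
  calc (5 / 4 : ℝ) ≤ √2 := Real.le_sqrt_of_sq_le (by norm_num)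
    _ = 2 ^ (1 / 2 : ℝ) := Real.sqrt_eq_rpow 2
    _ ≤ 2 ^ s := Real.rpow_le_rpow_of_exponent_le one_le_two hs

lemma sum_two_pow_rpow_le {s x : ℝ} (hs : 1 / 2 ≤ s) {m : ℕ} (hm : (2 : ℝ) ^ m ≤ x) :
    ∑ q ∈ Finset.range m, ((2 : ℝ) ^ q) ^ s ≤ 4 * x ^ s := by
  have hcomm (q : ℕ) : ((2 : ℝ) ^ q) ^ s = ((2 : ℝ) ^ s) ^ q :=
    (Real.rpow_pow_comm two_pos.le s q).symm
  calc ∑ q ∈ Finset.range m, ((2 : ℝ) ^ q) ^ s ≤ 4 * ((2 : ℝ) ^ m) ^ s := by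
        simp only [hcomm]
        exact sum_range_pow_le (five_quarters_le_two_rpow hs) m
    _ ≤ 4 * x ^ s := by gcongr

lemma mul_sum_two_pow_rpow_le {c κ y s : ℝ} (hc : 0 ≤ c) (hκ : 1 ≤ κ) (hy : 0 < y)
    (hs : 1 / 2 ≤ s) (hs1 : s ≤ 1) {m : ℕ} (hm : (2 : ℝ) ^ m ≤ κ / y) :
    c * ∑ q ∈ Finset.range m, ((2 : ℝ) ^ q) ^ s ≤ 4 * κ * (c / y ^ s) :=
  calc c * ∑ q ∈ Finset.range m, ((2 : ℝ) ^ q) ^ s ≤ c * (4 * (κ / y) ^ s) :=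
        mul_le_mul_of_nonneg_left (sum_two_pow_rpow_le hs hm) hc
    _ = 4 * κ ^ s * (c / y ^ s) := by
        rw [Real.div_rpow (zero_le_one.trans hκ) hy.le]
        ring
    _ ≤ 4 * κ * (c / y ^ s) := by
        gcongr
        exact Real.rpow_le_self_of_one_le hκ hs1

end Asymptotics

namespace RegMDP

open Filter Topology

section Rates

variable {S A : Type*} [Fintype S] [Fintype A] {M : RegMDP S A} {k : CTDConst}
  {μ cbar hbar κ Δ ε : ℝ}

/-- The number of iterations which reduces the optimality gap from `Δ` to `ε` at the linear rate:
the gap is halved in every epoch. -/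
noncomputable def numIter (M : RegMDP S A) (Δ ε : ℝ) : ℕ :=
  if Δ ≤ ε then 0 else M.epochLen * ⌈Real.logb 2 (Δ / ε)⌉₊

lemma pow_numIter_mul_le (M : RegMDP S A) (Δ : ℝ) (hε : 0 < ε) :
    (1 / 2) ^ (M.numIter Δ ε / M.epochLen) * Δ ≤ ε := by
  unfold numIter
  split_ifs with h
  · simpa using h
  · have hle := le_two_pow_ceil_logb (div_pos (hε.trans (not_le.1 h)) hε)
    rw [div_le_iff₀ hε] at hle
    rwa [Nat.mul_div_cancel_left _ M.epochLen_pos, one_div_pow, one_div_mul_eq_div,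
      div_le_iff₀' (by positivity)]

lemma eventually_numIter (M : RegMDP S A) (hΔ : 0 < Δ) :
    ∀ᶠ ε in 𝓝[>] 0, ∃ m : ℕ, M.numIter Δ ε = M.epochLen * m ∧
      (m : ℝ) ≤ 2 * Real.logb 2 (1 / ε) ∧ (2 : ℝ) ^ m ≤ 2 * (Δ / ε) := by
  filter_upwards [Ioo_mem_nhdsGT hΔ,
    tendsto_logb_two_one_div.eventually_ge_atTop (Real.logb 2 Δ + 1)] with ε ⟨hε, hεΔ⟩ hE
  have hone : 1 ≤ Δ / ε := (one_le_div hε).2 hεΔ.le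
  refine ⟨_, if_neg (not_le.2 hεΔ), ?_, two_pow_ceil_logb_le hone⟩
  have hceil := Nat.ceil_lt_add_one (Real.logb_nonneg one_lt_two hone)
  have hsplit : Real.logb 2 (Δ / ε) = Real.logb 2 Δ + Real.logb 2 (1 / ε) := by
    rw [← Real.logb_mul hΔ.ne' (one_div_pos.2 hε).ne', mul_one_div]
  linear_combination hceil + hsplit + hE

lemma logb_half_pos (M : RegMDP S A) : 0 < Real.logb M.γ (1 / 2) :=
  Real.logb_pos_of_base_lt_one M.γ_pos M.γ_lt_one (by norm_num) (by norm_num)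

lemma logb_eq_logb_half_mul (M : RegMDP S A) (ε : ℝ) :
    Real.logb M.γ ε = Real.logb M.γ (1 / 2) * Real.logb 2 (1 / ε) := by
  have hlog2 : Real.log 2 ≠ 0 := (Real.log_pos one_lt_two).ne'
  simp only [Real.logb, one_div, Real.log_inv]
  field

lemma eventually_logb_nonneg (M : RegMDP S A) : ∀ᶠ ε in 𝓝[>] 0, 0 ≤ Real.logb M.γ ε := by
  filter_upwards [tendsto_logb_two_one_div.eventually_ge_atTop 0] with ε hE
  rw [logb_eq_logb_half_mul]
  exact mul_nonneg M.logb_half_pos.le hE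

lemma epochLen_le (h : 1 ≤ 2 * κ * M.γ) :
    (M.epochLen : ℝ) ≤ (2 + Real.logb 2 (2 * κ)) * Real.logb M.γ (1 / 2) := by
  have hγ := M.γ_pos
  have hκ : 0 < 2 * κ := pos_of_mul_pos_left (one_pos.trans_le h) hγ.le
  have hone : 1 ≤ Real.logb 2 (2 * κ) * Real.logb M.γ (1 / 2) := by
    calc 1 = Real.logb M.γ M.γ :=
          (Real.logb_self_eq_one_iff.2 ⟨hγ.ne', M.γ_lt_one.ne, by linarith⟩).symm
      _ ≤ Real.logb M.γ (1 / (2 * κ)) :=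
        (Real.logb_le_logb_of_base_lt_one hγ M.γ_lt_one hγ (one_div_pos.2 hκ)).2
          ((div_le_iff₀' hκ).2 h)
      _ = Real.logb 2 (2 * κ) * Real.logb M.γ (1 / 2) := by
        rw [logb_eq_logb_half_mul, one_div_one_div, mul_comm]
  have hquarter : Real.logb M.γ (1 / 4) = 2 * Real.logb M.γ (1 / 2) := by
    rw [show (1 / 4 : ℝ) = (1 / 2) ^ 2 by norm_num, Real.logb_pow, Nat.cast_two]
  have hceil : (M.epochLen : ℝ) < Real.logb M.γ (1 / 4) + 1 :=
    Nat.ceil_lt_add_one (hquarter ▸ (mul_pos two_pos M.logb_half_pos).le)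
  linear_combination hceil + hquarter + hone

/-- The number of temporal difference steps in each iteration of the epoch `q`, before rounding. -/
noncomputable def rawSteps (M : RegMDP S A) (cbar hbar : ℝ) (k : CTDConst) (q : ℕ) : ℝ :=
  M.tZero k * (3 * M.thetaBar cbar hbar * 2 ^ (q + 2)) ^ (2 / 3 : ℝ)
    + Real.sqrt (4 * M.tZero k ^ 2 * M.thetaBar cbar hbar ^ 2 * 2 ^ (q + 2))
    + 24 * M.sigmaFsq cbar hbar k / k.lamMin ^ 2 * 2 ^ (q + 2)

lemma numSteps_eq_ceil_rawSteps (j : ℕ) :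
    M.numSteps cbar hbar k j = ⌈M.rawSteps cbar hbar k (j / M.epochLen)⌉₊ := rfl

lemma rawSteps_nonneg (hθ : 0 ≤ M.thetaBar cbar hbar) (q : ℕ) :
    0 ≤ M.rawSteps cbar hbar k q := by
  have := tZero_nonneg (M := M) k
  have := sigmaFsq_nonneg (M := M) (cbar := cbar) (hbar := hbar) (k := k)
  unfold rawSteps
  positivity

lemma rawSteps_le (hθ : 0 ≤ M.thetaBar cbar hbar) (q : ℕ) :
    M.rawSteps cbar hbar k q
      ≤ 12 * (M.tZero k * M.thetaBar cbar hbar ^ (2 / 3 : ℝ)) * ((2 : ℝ) ^ q) ^ (2 / 3 : ℝ)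
        + 4 * (M.tZero k * M.thetaBar cbar hbar) * ((2 : ℝ) ^ q) ^ (1 / 2 : ℝ)
        + 96 * (M.sigmaFsq cbar hbar k / k.lamMin ^ 2) * ((2 : ℝ) ^ q) ^ (1 : ℝ) := by
  have ht₀ := tZero_nonneg (M := M) k
  rw [rawSteps]
  set θ := M.thetaBar cbar hbar
  have hrpow : (3 * θ * 2 ^ (q + 2)) ^ (2 / 3 : ℝ)
      ≤ 12 * θ ^ (2 / 3 : ℝ) * ((2 : ℝ) ^ q) ^ (2 / 3 : ℝ) := by
    calc (3 * θ * 2 ^ (q + 2)) ^ (2 / 3 : ℝ) = (12 * θ * 2 ^ q) ^ (2 / 3 : ℝ) := by ring_nf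
      _ = 12 ^ (2 / 3 : ℝ) * θ ^ (2 / 3 : ℝ) * ((2 : ℝ) ^ q) ^ (2 / 3 : ℝ) := by
        rw [Real.mul_rpow (by positivity) (by positivity), Real.mul_rpow (by norm_num) hθ]
      _ ≤ _ := by
        gcongr
        exact Real.rpow_le_self_of_one_le (by norm_num) (by norm_num)
  have hsqrt : √(4 * M.tZero k ^ 2 * θ ^ 2 * 2 ^ (q + 2))
      = 4 * (M.tZero k * θ) * ((2 : ℝ) ^ q) ^ (1 / 2 : ℝ) := by
    rw [show 4 * M.tZero k ^ 2 * θ ^ 2 * 2 ^ (q + 2) = (4 * (M.tZero k * θ)) ^ 2 * 2 ^ q by ring,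
      Real.sqrt_mul (by positivity), Real.sqrt_sq (by positivity), Real.sqrt_eq_rpow]
  rw [hsqrt, Real.rpow_one]
  linear_combination M.tZero k * hrpow

lemma sampleRate_nonneg (hθ : 0 ≤ M.thetaBar cbar hbar) (hμ : 0 ≤ μ) (hε : 0 ≤ ε) :
    0 ≤ M.sampleRate μ cbar hbar k ε := by
  have := sub_pos.2 M.γ_lt_one
  have := tZero_nonneg (M := M) k
  have := sigmaFsq_nonneg (M := M) (cbar := cbar) (hbar := hbar) (k := k)
  unfold sampleRate
  positivity

lemma sampleRate_eq : M.sampleRate μ cbar hbar k ε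
    = M.tZero k * M.thetaBar cbar hbar ^ (2 / 3 : ℝ) / (μ * (1 - M.γ) * ε) ^ (2 / 3 : ℝ)
      + M.tZero k * M.thetaBar cbar hbar / (μ * (1 - M.γ) * ε) ^ (1 / 2 : ℝ)
      + M.sigmaFsq cbar hbar k / k.lamMin ^ 2 / (μ * (1 - M.γ) * ε) ^ (1 : ℝ) := by
  rw [sampleRate, Real.rpow_one, ← Real.sqrt_eq_rpow, div_div]
  congr 2
  ring

lemma sum_rawSteps_le (hθ : 0 ≤ M.thetaBar cbar hbar) (hμ : 0 < μ) (hκ : 1 ≤ κ) (hε : 0 < ε)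
    {m : ℕ} (hm : (2 : ℝ) ^ m ≤ κ / (μ * (1 - M.γ) * ε)) :
    ∑ q ∈ Finset.range m, M.rawSteps cbar hbar k q ≤ 384 * κ * M.sampleRate μ cbar hbar k ε := by
  have hγ := sub_pos.2 M.γ_lt_one
  have hy : 0 < μ * (1 - M.γ) * ε := by positivity
  have ht₀ := tZero_nonneg (M := M) k
  have hσ := sigmaFsq_nonneg (M := M) (cbar := cbar) (hbar := hbar) (k := k)
  have hsum := Finset.sum_le_sum (s := Finset.range m) fun q _ => rawSteps_le (k := k) hθ q
  rw [Finset.sum_add_distrib, Finset.sum_add_distrib, ← Finset.mul_sum, ← Finset.mul_sum,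
    ← Finset.mul_sum] at hsum
  rw [sampleRate_eq]
  set a := M.tZero k * M.thetaBar cbar hbar ^ (2 / 3 : ℝ)
  set b := M.tZero k * M.thetaBar cbar hbar
  have ha : 0 ≤ κ * (a / (μ * (1 - M.γ) * ε) ^ (2 / 3 : ℝ)) := by positivity
  have hb : 0 ≤ κ * (b / (μ * (1 - M.γ) * ε) ^ (1 / 2 : ℝ)) := by positivity
  linear_combination hsum
    + 12 * mul_sum_two_pow_rpow_le (c := a) (s := 2 / 3) (by positivity) hκ hy (by norm_num)
      (by norm_num) hm
    + 4 * mul_sum_two_pow_rpow_le (c := b) (s := 1 / 2) (by positivity) hκ hy le_rfl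
      (by norm_num) hm
    + 96 * mul_sum_two_pow_rpow_le (s := 1) (div_nonneg hσ (sq_nonneg k.lamMin)) hκ hy
      (by norm_num) le_rfl hm
    + 336 * ha + 368 * hb

lemma thetaBar_eq_zero_of_sigmaFsq_eq_zero (h : M.sigmaFsq cbar hbar k = 0) :
    M.thetaBar cbar hbar = 0 := by
  have hR : 0 ≤ 4 * (1 + M.γ) ^ 2 * M.Rsq cbar hbar k := mul_nonneg (by positivity) Rsq_nonneg
  have hsq : (cbar + hbar) ^ 2 = 0 := by
    unfold sigmaFsq at h
    refine le_antisymm ?_ (sq_nonneg _)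
    linear_combination h / 2 + hR / 2 + sq_nonneg k.B / 2
  rw [thetaBar, pow_eq_zero_iff two_ne_zero |>.1 hsq, zero_div, mul_zero]

lemma rawSteps_eq_zero_of_sigmaFsq_eq_zero (h : M.sigmaFsq cbar hbar k = 0) (q : ℕ) :
    M.rawSteps cbar hbar k q = 0 := by
  rw [rawSteps, thetaBar_eq_zero_of_sigmaFsq_eq_zero h, h]
  norm_num

lemma sum_ceil_rawSteps_le (hθ : 0 ≤ M.thetaBar cbar hbar) (hμ : 0 < μ) (hκ : 1 ≤ κ) (hε : 0 < ε)
    {m : ℕ} (hm : (2 : ℝ) ^ m ≤ κ / (μ * (1 - M.γ) * ε)) (hmσ : 0 < M.sigmaFsq cbar hbar k →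
      (m : ℝ) ≤ M.sigmaFsq cbar hbar k / (μ * (1 - M.γ) * k.lamMin ^ 2 * ε)) :
    ∑ q ∈ Finset.range m, (⌈M.rawSteps cbar hbar k q⌉₊ : ℝ)
      ≤ (384 * κ + 1) * M.sampleRate μ cbar hbar k ε := by
  have hrate := sampleRate_nonneg (k := k) hθ hμ.le hε.le
  rcases (sigmaFsq_nonneg (M := M) (cbar := cbar) (hbar := hbar) (k := k)).eq_or_lt with hσ | hσ
  · simp only [rawSteps_eq_zero_of_sigmaFsq_eq_zero hσ.symm, Nat.ceil_zero, Nat.cast_zero,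
      Finset.sum_const_zero]
    positivity
  · have hm_le : (m : ℝ) ≤ M.sampleRate μ cbar hbar k ε := by
      have := sub_pos.2 M.γ_lt_one
      have := tZero_nonneg (M := M) k
      exact (hmσ hσ).trans (le_add_of_nonneg_left (by positivity))
    calc ∑ q ∈ Finset.range m, (⌈M.rawSteps cbar hbar k q⌉₊ : ℝ)
        ≤ ∑ q ∈ Finset.range m, (M.rawSteps cbar hbar k q + 1) :=
          Finset.sum_le_sum fun q _ => (Nat.ceil_lt_add_one (rawSteps_nonneg hθ q)).le
      _ = ∑ q ∈ Finset.range m, M.rawSteps cbar hbar k q + m := by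
          rw [Finset.sum_add_distrib, Finset.sum_const, Finset.card_range, nsmul_eq_mul, mul_one]
      _ ≤ (384 * κ + 1) * M.sampleRate μ cbar hbar k ε := by
          linear_combination sum_rawSteps_le (k := k) hθ hμ hκ hε hm + hm_le

lemma numSamples_epochLen_mul_le {m : ℕ} {α : ℝ}
    (hα : ∀ j < M.epochLen * m, (M.skip cbar hbar k j : ℝ) ≤ α) :
    (M.numSamples cbar hbar k (M.epochLen * m) : ℝ)
      ≤ M.epochLen * (α * ∑ q ∈ Finset.range m, (⌈M.rawSteps cbar hbar k q⌉₊ : ℝ)) := by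
  rw [Finset.mul_sum, ← sum_range_mul_div M.epochLen_pos, numSamples, Nat.cast_sum]
  refine Finset.sum_le_sum fun i hi => ?_
  rw [numSteps_eq_ceil_rawSteps, Nat.cast_mul, mul_comm]
  exact mul_le_mul_of_nonneg_right (hα i (Finset.mem_range.1 hi)) (Nat.cast_nonneg _)

/-- The constant of the complexity bounds, where `κ` bounds `μ (1 - γ) Δ` for the initial gap
`Δ`. -/
noncomputable def complexityConst (κ : ℝ) : ℝ :=
  5 * (2 + Real.logb 2 (2 * κ)) * (768 * κ + 1)

lemma logb_two_two_mul_nonneg (hκ : 1 ≤ κ) : 0 ≤ Real.logb 2 (2 * κ) :=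
  Real.logb_nonneg one_lt_two (by linarith)

lemma complexityConst_pos (hκ : 1 ≤ κ) : 0 < complexityConst κ := by
  have := logb_two_two_mul_nonneg hκ
  unfold complexityConst
  positivity

lemma eventually_numIter_le (hκ : 1 ≤ κ) (hκγ : 1 ≤ 2 * κ * M.γ) (hΔ : 0 < Δ) :
    ∀ᶠ ε in 𝓝[>] 0, (M.numIter Δ ε : ℝ) ≤ complexityConst κ * Real.logb M.γ ε := by
  filter_upwards [M.eventually_numIter hΔ, tendsto_logb_two_one_div.eventually_ge_atTop 0]
    with ε ⟨m, hJ, hmE, _⟩ hE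
  have hg := M.logb_half_pos
  have hlogb := logb_two_two_mul_nonneg hκ
  rw [hJ, Nat.cast_mul, logb_eq_logb_half_mul]
  calc (M.epochLen : ℝ) * m
      ≤ (2 + Real.logb 2 (2 * κ)) * Real.logb M.γ (1 / 2) * (2 * Real.logb 2 (1 / ε)) := by
        gcongr
        exact epochLen_le hκγ
    _ = 2 * (2 + Real.logb 2 (2 * κ)) * (Real.logb M.γ (1 / 2) * Real.logb 2 (1 / ε)) := by ring
    _ ≤ complexityConst κ * (Real.logb M.γ (1 / 2) * Real.logb 2 (1 / ε)) := by
        refine mul_le_mul_of_nonneg_right ?_ (by positivity)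
        rw [complexityConst]
        nlinarith

lemma eventually_two_mul_logb_le (hΛ : 0 < k.lamMin) (hμ : 0 < μ) :
    ∀ᶠ ε in 𝓝[>] 0, 0 < M.sigmaFsq cbar hbar k →
      2 * Real.logb 2 (1 / ε)
        ≤ M.sigmaFsq cbar hbar k / (μ * (1 - M.γ) * k.lamMin ^ 2 * ε) := by
  refine eventually_imp_distrib_left.2 fun hσ => ?_
  have hγ := sub_pos.2 M.γ_lt_one
  filter_upwards [eventually_logb_two_one_div_le
    (c := M.sigmaFsq cbar hbar k / (μ * (1 - M.γ) * k.lamMin ^ 2) / 2) (by positivity)] with ε h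
  rw [← div_div _ _ ε]
  linear_combination 2 * h

end Rates

section Complexity

variable {S A : Type*} [Fintype S] [Fintype A] [DecidableEq S] {M : RegMDP S A}
  {Pol : Set (Policy S A)} {k : CTDConst} {μ cbar hbar κ Δ : ℝ}

lemma one_le_two_mul_mul_γ {πs : Policy S A} {ν : S → ℝ} (hμ : 0 < μ)
    (hf : M.f ν πs ≤ M.f ν (uniformPolicy S A)) (h : μ * (1 - M.γ) * M.gapConst μ ν πs ≤ κ) :
    1 ≤ 2 * κ * M.γ := by
  have hγ := M.γ_pos
  have hκ : 5 / (8 * M.γ) ≤ κ :=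
    calc 5 / (8 * M.γ) ≤ μ * (5 / 2 + 5 / (8 * M.γ * μ)) := by
          rw [mul_add, ← div_div 5 (8 * M.γ), mul_div_cancel₀ _ hμ.ne']
          exact le_add_of_nonneg_left (by positivity)
      _ ≤ μ * ((1 - M.γ) * M.gapConst μ ν πs) :=
          mul_le_mul_of_nonneg_left (le_gapConst hμ.le hf) hμ.le
      _ ≤ κ := by rwa [← mul_assoc]
  rw [div_le_iff₀ (by positivity)] at hκ
  linarith

variable [DecidableEq A]

lemma ValidConst.logb_half_pos (hk : M.ValidConst Pol k) : 0 < Real.logb k.ρ (1 / 2) :=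
  Real.logb_pos_of_base_lt_one hk.ρ_pos hk.ρ_lt_one (by norm_num) (by norm_num)

lemma ValidConst.logb_half_le (hk : M.ValidConst Pol k)
    (h : 2 * k.lamMin ≤ k.C * M.Rsq cbar hbar k) :
    Real.logb k.ρ (1 / 2) ≤ Real.logb k.ρ (k.lamMin / (k.C * M.Rsq cbar hbar k)) := by
  have hΛ := hk.lamMin_pos
  have hCR : 0 < k.C * M.Rsq cbar hbar k := by linarith
  rw [Real.logb_le_logb_of_base_lt_one hk.ρ_pos hk.ρ_lt_one (by norm_num) (by positivity),
    div_le_div_iff₀ hCR two_pos]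
  linarith

lemma ValidConst.eventually_skip_le (hk : M.ValidConst Pol k) (cbar hbar : ℝ) :
    ∀ᶠ E : ℝ in atTop, ∀ j : ℕ, ((j / M.epochLen : ℕ) : ℝ) + 1 ≤ 2 * E →
      (M.skip cbar hbar k j : ℝ) ≤ 5 * (E * Real.logb k.ρ (1 / 2)) := by
  have hL := hk.logb_half_pos
  simp only [skip]
  set L := Real.logb k.ρ (1 / 2)
  set x := Real.logb k.ρ (k.lamMin / (24 * k.C * M.Rsq cbar hbar k))
  set y := Real.logb k.ρ (k.lamMin / (3 * k.C * M.Rsq cbar hbar k))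
  set z := Real.logb k.ρ (k.lamMin / (9 * k.C))
  filter_upwards [(tendsto_id.atTop_mul_const hL).eventually_ge_atTop
    (2 * L + |x| + |y| + |z| + 1)] with E hE j hj
  simp only [id] at hE
  have hjL := mul_le_mul_of_nonneg_right hj hL.le
  have := abs_nonneg x
  have := abs_nonneg y
  have := abs_nonneg z
  have := le_abs_self x
  have := le_abs_self y
  have := le_abs_self z
  have hone : 1 ≤ 5 * (E * L) := by linarith
  have hmax : max (max (2 * ((j / M.epochLen : ℕ) + 2 : ℝ) * L + x)
      (((j / M.epochLen : ℕ) + 2 : ℝ) * L + y)) z ≤ 5 * (E * L) - 1 := by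
    refine max_le (max_le ?_ ?_) ?_ <;> linarith
  rw [Nat.cast_max, Nat.cast_one]
  exact max_le hone (natCast_ceil_le_of_le_sub_one (zero_le_one.trans hone) hmax)

lemma ValidConst.eventually_numSamples_le (hk : M.ValidConst Pol k)
    (hθ : 0 ≤ M.thetaBar cbar hbar) (hμ : 0 < μ) (hκ : 1 ≤ κ) (hκγ : 1 ≤ 2 * κ * M.γ) (hΔ : 0 < Δ)
    (hΔκ : μ * (1 - M.γ) * Δ ≤ κ) :
    ∀ᶠ ε in 𝓝[>] 0, (M.numSamples cbar hbar k (M.numIter Δ ε) : ℝ)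
      ≤ complexityConst κ * (Real.logb M.γ (1 / 2)
        * (Real.logb 2 (1 / ε) * Real.logb k.ρ (1 / 2)) * M.sampleRate μ cbar hbar k ε) := by
  have hγ := sub_pos.2 M.γ_lt_one
  filter_upwards [self_mem_nhdsWithin, M.eventually_numIter hΔ,
    eventually_two_mul_logb_le (M := M) (cbar := cbar) (hbar := hbar) hk.lamMin_pos hμ,
    tendsto_logb_two_one_div.eventually_ge_atTop 0,
    tendsto_logb_two_one_div.eventually (hk.eventually_skip_le cbar hbar)]
    with ε hε ⟨m, hJ, hmE, hm⟩ hσ hE hskip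
  have hε : 0 < ε := hε
  have hL := hk.logb_half_pos
  have hg := M.logb_half_pos
  have hlogb := logb_two_two_mul_nonneg hκ
  have hm' : (2 : ℝ) ^ m ≤ 2 * κ / (μ * (1 - M.γ) * ε) := by
    refine hm.trans ?_
    rw [← mul_div_assoc, div_le_div_iff₀ hε (by positivity)]
    linear_combination 2 * ε * hΔκ
  have hα (j : ℕ) (hj : j < M.epochLen * m) : (M.skip cbar hbar k j : ℝ)
      ≤ 5 * (Real.logb 2 (1 / ε) * Real.logb k.ρ (1 / 2)) :=
    hskip j (hmE.trans' (by exact_mod_cast Nat.div_lt_of_lt_mul hj))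
  rw [hJ]
  calc (M.numSamples cbar hbar k (M.epochLen * m) : ℝ)
      ≤ M.epochLen * (5 * (Real.logb 2 (1 / ε) * Real.logb k.ρ (1 / 2))
        * ∑ q ∈ Finset.range m, (⌈M.rawSteps cbar hbar k q⌉₊ : ℝ)) := numSamples_epochLen_mul_le hα
    _ ≤ (2 + Real.logb 2 (2 * κ)) * Real.logb M.γ (1 / 2)
        * (5 * (Real.logb 2 (1 / ε) * Real.logb k.ρ (1 / 2))
          * ((384 * (2 * κ) + 1) * M.sampleRate μ cbar hbar k ε)) := by
        have hlen := epochLen_le hκγ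
        gcongr
        exact sum_ceil_rawSteps_le hθ hμ (by linarith) hε hm' fun h => hmE.trans (hσ h)
    _ = _ := by
        rw [complexityConst]
        ring

lemma ValidConst.eventually_sampleBound_nonneg (hk : M.ValidConst Pol k)
    (hθ : 0 ≤ M.thetaBar cbar hbar) (hμ : 0 ≤ μ) :
    ∀ᶠ ε in 𝓝[>] 0, 0 ≤ Real.logb M.γ (1 / 2)
      * (Real.logb 2 (1 / ε) * Real.logb k.ρ (1 / 2)) * M.sampleRate μ cbar hbar k ε := by
  filter_upwards [self_mem_nhdsWithin, tendsto_logb_two_one_div.eventually_ge_atTop 0]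
    with ε hε hE
  exact mul_nonneg (mul_nonneg M.logb_half_pos.le (mul_nonneg hE hk.logb_half_pos.le))
    (sampleRate_nonneg hθ hμ (le_of_lt hε))

lemma ValidConst.exists_forall_complexity_le (hk : M.ValidConst Pol k)
    (hθ : 0 ≤ M.thetaBar cbar hbar) (hμ : 0 ≤ μ) {K : ℝ} (hK : 0 ≤ K) {J : ℝ → ℕ}
    (hJ : ∀ᶠ ε in 𝓝[>] 0, (J ε : ℝ) ≤ K * Real.logb M.γ ε)
    (hN : ∀ᶠ ε in 𝓝[>] 0, (M.numSamples cbar hbar k (J ε) : ℝ) ≤ K * (Real.logb M.γ (1 / 2)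
      * (Real.logb 2 (1 / ε) * Real.logb k.ρ (1 / 2)) * M.sampleRate μ cbar hbar k ε)) :
    ∃ ε₀ : ℝ, 0 < ε₀ ∧ ∀ ε : ℝ, 0 < ε → ε ≤ ε₀ →
      (J ε : ℝ) ≤ 2 * K * Real.logb M.γ ε ∧
      (M.numSamples cbar hbar k (J ε) : ℝ) ≤ 2 * K * (Real.logb M.γ (1 / 2)
        * (Real.logb 2 (1 / ε) * Real.logb k.ρ (1 / 2)
          + Real.logb k.ρ (k.lamMin / (k.C * M.Rsq cbar hbar k)))
        * M.sampleRate μ cbar hbar k ε) ∧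
      (2 * k.lamMin ≤ k.C * M.Rsq cbar hbar k →
        (M.numSamples cbar hbar k (J ε) : ℝ) ≤ 2 * K * (Real.logb M.γ (1 / 2)
          * Real.logb 2 (1 / ε) * Real.logb k.ρ (k.lamMin / (k.C * M.Rsq cbar hbar k))
          * M.sampleRate μ cbar hbar k ε)) := by
  have hg := M.logb_half_pos
  have hL := hk.logb_half_pos
  refine exists_forall_le_of_eventually_nhdsGT_zero ?_
  filter_upwards [self_mem_nhdsWithin, hJ, hN, M.eventually_logb_nonneg,
    tendsto_logb_two_one_div.eventually_ge_atTop 0,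
    (tendsto_logb_two_one_div.atTop_mul_const hL).eventually_ge_atTop
      (-2 * Real.logb k.ρ (k.lamMin / (k.C * M.Rsq cbar hbar k)))] with ε hε hJε hNε hγε hE hX
  have hrate := sampleRate_nonneg (k := k) hθ hμ (le_of_lt hε)
  refine ⟨hJε.trans ?_, hNε.trans ?_, fun h => hNε.trans ?_⟩
  · linear_combination K * hγε
  · linear_combination K * Real.logb M.γ (1 / 2) * M.sampleRate μ cbar hbar k ε * hX
  · rw [mul_assoc (Real.logb M.γ (1 / 2)) (Real.logb 2 (1 / ε))]
    have hX := hk.logb_half_le h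
    gcongr
    linarith

end Complexity

end RegMDP

open RegMDP in
theorem mainTheorem9_general (κ : ℝ) :
    ∃ K : ℝ, 0 < K ∧
      ∀ (S : Type u) (A : Type v) [Fintype S] [Fintype A] [DecidableEq S] [DecidableEq A]
        [Nonempty S] [Nonempty A] (M : RegMDP S A) (μ cbar hbar : ℝ)
        (πs : Policy S A) (νs : S → ℝ) (Pol : Set (Policy S A)) (πlow : ℝ),
        0 < μ → M.StronglyConvex μ →
        (∀ s a, |M.c s a| ≤ cbar) → (∀ s, ∀ p ∈ M.dom s, |M.h s p| ≤ hbar) →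
        M.Feasible πs → M.IsStationary πs νs →
        (M.Feasible (uniformPolicy S A) → M.f νs πs ≤ M.f νs (uniformPolicy S A)) →
        (∀ π ∈ Pol, M.Feasible π) → 0 < πlow → (∀ π ∈ Pol, ∀ s a, πlow ≤ π s a) →
        (∀ π ∈ Pol, (M.stateMat π).IsPrimitive) →
        (∃ k : CTDConst, M.ValidConst Pol k) ∧
        ∀ k : CTDConst, M.ValidConst Pol k →
          ∃ J : ℝ → ℕ,
            (∀ (Ω : Type w) [MeasurableSpace Ω] (Pr : Measure Ω) [IsProbabilityMeasure Pr]
              (Z : ℕ → Ω → S × A) (π : ℕ → Ω → Policy S A),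
              M.IsRun μ cbar hbar k Pr Z π → (∀ᵐ ω ∂Pr, ∀ j, π j ω ∈ Pol) →
              (∀ j : ℕ, Integrable (fun ω => M.gap μ νs πs (π j ω)) Pr ∧
                ∫ ω, M.gap μ νs πs (π j ω) ∂Pr
                  ≤ (1 / 2) ^ (j / M.epochLen) * M.gapConst μ νs πs) ∧
              (∀ ε : ℝ, 0 < ε → ∫ ω, M.gap μ νs πs (π (J ε) ω) ∂Pr ≤ ε)) ∧
            (μ * (1 - M.γ) * M.gapConst μ νs πs ≤ κ →
              ∃ ε₀ : ℝ, 0 < ε₀ ∧ ∀ ε : ℝ, 0 < ε → ε ≤ ε₀ →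
                (J ε : ℝ) ≤ K * Real.logb M.γ ε ∧
                (M.numSamples cbar hbar k (J ε) : ℝ) ≤
                  K * (Real.logb M.γ (1 / 2) *
                    (Real.logb 2 (1 / ε) * Real.logb k.ρ (1 / 2)
                      + Real.logb k.ρ (k.lamMin / (k.C * M.Rsq cbar hbar k))) *
                    M.sampleRate μ cbar hbar k ε) ∧
                (2 * k.lamMin ≤ k.C * M.Rsq cbar hbar k →
                  (M.numSamples cbar hbar k (J ε) : ℝ) ≤
                    K * (Real.logb M.γ (1 / 2) * Real.logb 2 (1 / ε) *
                      Real.logb k.ρ (k.lamMin / (k.C * M.Rsq cbar hbar k)) *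
                      M.sampleRate μ cbar hbar k ε))) := by
  refine ⟨2 * complexityConst (max κ 1),
    mul_pos two_pos (complexityConst_pos (le_max_right _ _)), ?_⟩
  intro S A _ _ _ _ _ _ M μ cbar hbar πs νs Pol πlow hμ hsc hc hh hs hνs hf hfeas hlow hrand herg
  refine ⟨exists_validConst hc hh hfeas hlow hrand herg, fun k hk => ?_⟩
  have hθ := thetaBar_nonneg hc hh hs
  have hK := (complexityConst_pos (le_max_right κ 1)).le
  by_cases hu : uniformPolicy S A ∈ Pol
  · replace hf := hf (hfeas _ hu)
    refine ⟨M.numIter (M.gapConst μ νs πs), fun Ω _ Pr _ Z π hrun hPol => ?_, fun hκ => ?_⟩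
    · have hrate := hrun.integral_gap_le hPol hk hμ hsc hc hh hfeas
        (fun π hπ s a => hlow.trans_le (hrand π hπ s a)) hs hνs hf
      exact ⟨hrate, fun ε hε => (hrate _).2.trans (M.pow_numIter_mul_le _ hε)⟩
    · replace hκ := hκ.trans (le_max_left κ 1)
      have hκγ := one_le_two_mul_mul_γ hμ hf hκ
      have hΔ := gapConst_pos hμ.le hf
      exact hk.exists_forall_complexity_le hθ hμ.le hK
        (eventually_numIter_le (le_max_right _ _) hκγ hΔ)
        (hk.eventually_numSamples_le hθ hμ (le_max_right _ _) hκγ hΔ hκ)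
  · refine ⟨fun _ => 0, fun _ _ _ _ _ _ hrun hPol => absurd (hrun.uniform_mem hPol) hu,
      fun _ => ?_⟩
    refine hk.exists_forall_complexity_le hθ hμ.le hK ?_ ?_
    · exact M.eventually_logb_nonneg.mono fun ε h => Nat.cast_zero.trans_le (mul_nonneg hK h)
    · exact (hk.eventually_sampleBound_nonneg hθ hμ.le).mono fun ε h =>
        Nat.cast_zero.trans_le (mul_nonneg hK h)

theorem mainTheorem9 (κ : ℝ) :
    ∃ K : ℝ, 0 < K ∧
      ∀ (S : Type u) (A : Type v) [Fintype S] [Fintype A] [DecidableEq S] [DecidableEq A]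
        [Nonempty S] [Nonempty A] (M : RegMDP S A) (μ cbar hbar : ℝ)
        (_hμ : 0 < μ) (_hsc : M.StronglyConvex μ)
        (_hc : ∀ s a, |M.c s a| ≤ cbar) (_hh : ∀ s, ∀ p ∈ M.dom s, |M.h s p| ≤ hbar)
        -- an optimal policy and a stationary distribution of it
        (πs : Policy S A) (_hopt : M.IsOptimal πs)
        (νs : S → ℝ) (_hνs : M.IsStationary πs νs)
        -- a class of sufficiently random feasible policies with ergodic state chains
        (Pol : Set (Policy S A)) (_hfeas : ∀ π ∈ Pol, M.Feasible π)
        (πlow : ℝ) (_hlow : 0 < πlow) (_hrand : ∀ π ∈ Pol, ∀ s a, πlow ≤ π s a)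
        (_herg : ∀ π ∈ Pol, (M.stateMat π).IsPrimitive),
        (∃ k : CTDConst, M.ValidConst Pol k) ∧
        ∀ (k : CTDConst) (_hk : M.ValidConst Pol k),
          -- `J ε` iterations yield an `ε`-solution
          ∃ J : ℝ → ℕ,
            -- every run whose iterates belong to the class
            (∀ (Ω : Type w) [MeasurableSpace Ω] (Pr : Measure Ω) [IsProbabilityMeasure Pr]
              (Z : ℕ → Ω → S × A) (π : ℕ → Ω → Policy S A)
              (_hrun : M.IsRun μ cbar hbar k Pr Z π)
              (_hPol : ∀ᵐ ω ∂Pr, ∀ j, π j ω ∈ Pol),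
              -- the linear rate of convergence
              (∀ j : ℕ, Integrable (fun ω => M.gap μ νs πs (π j ω)) Pr ∧
                ∫ ω, M.gap μ νs πs (π j ω) ∂Pr
                  ≤ (1 / 2) ^ (j / M.epochLen) * M.gapConst μ νs πs) ∧
              (∀ ε : ℝ, 0 < ε → ∫ ω, M.gap μ νs πs (π (J ε) ω) ∂Pr ≤ ε)) ∧
            -- iteration and sample complexity
            (μ * (1 - M.γ) * M.gapConst μ νs πs ≤ κ →
              ∃ ε₀ : ℝ, 0 < ε₀ ∧ ∀ ε : ℝ, 0 < ε → ε ≤ ε₀ →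
                (J ε : ℝ) ≤ K * Real.logb M.γ ε ∧
                (M.numSamples cbar hbar k (J ε) : ℝ) ≤
                  K * (Real.logb M.γ (1 / 2) *
                    (Real.logb 2 (1 / ε) * Real.logb k.ρ (1 / 2)
                      + Real.logb k.ρ (k.lamMin / (k.C * M.Rsq cbar hbar k))) *
                    M.sampleRate μ cbar hbar k ε) ∧
                (2 * k.lamMin ≤ k.C * M.Rsq cbar hbar k →
                  (M.numSamples cbar hbar k (J ε) : ℝ) ≤
                    K * (Real.logb M.γ (1 / 2) * Real.logb 2 (1 / ε) *
                      Real.logb k.ρ (k.lamMin / (k.C * M.Rsq cbar hbar k)) *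
                      M.sampleRate μ cbar hbar k ε))) := by
  obtain ⟨K, hK, h⟩ := mainTheorem9_general.{u, v, w} κ
  exact ⟨K, hK, fun S A _ _ _ _ _ _ M μ cbar hbar hμ hsc hc hh πs hopt νs hνs Pol hfeas πlow hlow
    hrand herg => h S A M μ cbar hbar πs νs Pol πlow hμ hsc hc hh hopt.1 hνs
      (RegMDP.f_le_of_isOptimal hopt hνs.1.1) hfeas hlow hrand herg⟩
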